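/- Let $\Lambda$ be a finite set of sites, each site $i$ carrying a finite-dimensional complex Hilbert space $\mathcal H_i$, and let $\mathcal H_\Lambda=\bigotimes_{i\in\Lambda}\mathcal H_i$; $\|\cdot\|$ is the operator norm. An operator acts nontrivially only on $X\subset\Lambda$ if it has the form $a\otimes 1_{\Lambda\setminus X}$ with $a$ an operator on $\bigotimes_{i\in X}\mathcal H_i$. Let $k\ge1$ be an integer, $g>0$, $T>0$, and let $$H(t)=\sum_{X\subset\Lambda,\,|X|\le k}h_X(t),\qquad H(t+T)=H(t),$$ be self-adjoint for every $t$, where $h_X(t)$ acts nontrivially only on $X$, each $h_X$ is integrable on $[0,T]$, and $$\sum_{X\ni i,\,|X|\le k}\|h_X(t)\|\le g\qquad\text{for all }t\in[0,T],\ i\in\Lambda .$$ No decay of the interactions with distance is assumed. Let $U_F=\mathcal T\exp\bigl(-i\int_0^T H(t)\,dt\bigr)$ be the time-ordered exponential (Dyson series), and let $H_F^{(n)}=\sum_{m=0}^nT^m\Omega_m$ be the truncated Floquet–Magnus expansion, where $$\Omega_m=\sum_{\sigma}\frac{(-1)^{m-\theta[\sigma]}\,\theta[\sigma]!\,(m-\theta[\sigma])!}{i^m(m+1)^2\,m!\,T^{m+1}}\int_0^T\!dt_1\int_0^{t_1}\!dt_2\cdots\int_0^{t_m}\!dt_{m+1}\,[H(t_{\sigma(1)}),[H(t_{\sigma(2)}),\dots,[H(t_{\sigma(m)}),H(t_{\sigma(m+1)})]\dots]],$$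 $\sigma$ runs over the permutations of $\{1,\dots,m+1\}$, and $\theta[\sigma]$ is the number of $i\in\{1,\dots,m\}$ with $\sigma(i+1)>\sigma(i)$. Put $n_0'=\lfloor 1/(16kgT)-1\rfloor$. Then for every integer $n\ge0$ there is a constant $\alpha_n>0$ depending only on $n$, $k$ and $g$ (not on $\Lambda$, the spaces $\mathcal H_i$, the terms $h_X$, $T$, $X$, the observable or the state) such that, for every system as above with $n\le n_0'$, every $X\subset\Lambda$, every operator $O_X$ acting nontrivially only on $X$ with $\|O_X\|=1$, and every unit vector $\psi_0\in\mathcal H_\Lambda$, $$\bigl|\langle\psi(T)|O_X|\psi(T)\rangle-\langle\psi^{(n)}(T)|O_X|\psi^{(n)}(T)\rangle\bigr|\le\alpha_n\,|X|\,T^{n+2},$$ where $\psi(T)=U_F\psi_0$ and $\psi^{(n)}(T)=e^{-iH_F^{(n)}T}\psi_0$. -/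

import Mathlib

open MeasureTheory Complex
open scoped BigOperators InnerProductSpace

namespace FloquetSpin

/-! ### The lattice system -/

/-- The total Hilbert space `⨂_{i ∈ Λ} ℂ^{s i}`, where `s i` labels an orthonormal basis of the
local Hilbert space at the site `i`; the product basis is labelled by the configurations. -/
abbrev TotalSpace {Λ : Type*} (s : Λ → Type*) [Fintype Λ] [DecidableEq Λ] [∀ i, Fintype (s i)] :=
  EuclideanSpace ℂ (∀ i, s i)

/-- The operators on the total Hilbert space, with the operator norm. -/
abbrev Op {Λ : Type*} (s : Λ → Type*) [Fintype Λ] [DecidableEq Λ] [∀ i, Fintype (s i)] :=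
  TotalSpace s →L[ℂ] TotalSpace s

section system

variable {Λ : Type*} {s : Λ → Type*} [Fintype Λ] [DecidableEq Λ]
  [∀ i, Fintype (s i)] [∀ i, DecidableEq (s i)]

/-- `A` acts nontrivially only on the sites of `X`: in the product basis `A` is `a ⊗ 1` with a
matrix `a` on the sites of `X` and the identity on the remaining sites. -/
def ActsOn (X : Finset Λ) (A : Op s) : Prop :=
  ∃ a : Matrix (∀ i : X, s i) (∀ i : X, s i) ℂ,
    A = Matrix.toEuclideanCLM (𝕜 := ℂ) (Matrix.of fun x y : (∀ i, s i) =>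
      if ∀ i, i ∉ X → x i = y i then a (fun i => x i) (fun i => y i) else 0)

/-- The Hamiltonian `H(t) = ∑_{|X| ≤ k} h_X(t)`. -/
noncomputable def hamiltonian (k : ℕ) (h : Finset Λ → ℝ → Op s) (t : ℝ) : Op s :=
  ∑ X : Finset Λ with X.card ≤ k, h X t

/-- The terms `h_X(t)`, `|X| ≤ k`, form a `T`-periodically driven `k`-local Hamiltonian whose
energy per site is bounded by `g`. -/
structure IsDrivenKLocal (k : ℕ) (g T : ℝ) (h : Finset Λ → ℝ → Op s) : Prop where
  actsOn : ∀ X : Finset Λ, X.card ≤ k → ∀ t, ActsOn X (h X t)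
  selfAdjoint : ∀ t, IsSelfAdjoint (hamiltonian k h t)
  periodic : Function.Periodic (hamiltonian k h) T
  integrable : ∀ X : Finset Λ, X.card ≤ k → IntervalIntegrable (h X) volume 0 T
  extensive : ∀ t ∈ Set.Icc 0 T, ∀ i : Λ,
    ∑ X : Finset Λ with X.card ≤ k ∧ i ∈ X, ‖h X t‖ ≤ g

end system

/-! ### Time evolution and the Floquet-Magnus expansion -/

section evolution

variable {A : Type*} [NormedRing A] [NormedAlgebra ℂ A]

/-- The `m`-th term of the Dyson series,
`(-i)^m ∫_0^t dt₁ ∫_0^{t₁} dt₂ ⋯ H(t₁) H(t₂) ⋯ H(t_m)`. -/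
noncomputable def dysonTerm (H : ℝ → A) : ℕ → ℝ → A
  | 0, _ => 1
  | m + 1, t => ∫ t₁ in (0 : ℝ)..t, (-I) • (H t₁ * dysonTerm H m t₁)

/-- The time-ordered exponential `𝒯 exp(-i ∫_0^t H)`. At `t = T` it is the Floquet operator. -/
noncomputable def timeOrderedExp (H : ℝ → A) (t : ℝ) : A :=
  ∑' m, dysonTerm H m t

/-- `∫_0^u dt₁ ∫_0^{t₁} dt₂ ⋯ ∫_0^{t_{m-1}} dt_m f(t₁, …, t_m)`. -/
noncomputable def orderedIntegral : (m : ℕ) → ℝ → ((Fin m → ℝ) → A) → A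
  | 0, _, f => f Fin.elim0
  | m + 1, u, f => ∫ t₁ in (0 : ℝ)..u, orderedIntegral m t₁ fun t => f (Fin.cons t₁ t)

/-- `[a₀, [a₁, …, [a_{n-1}, a_n] … ]]`. -/
def nestedCommutator : (n : ℕ) → (Fin (n + 1) → A) → A
  | 0, a => a 0
  | n + 1, a => ⁅a 0, nestedCommutator n (Fin.tail a)⁆

/-- The number `θ[σ]` of ascents of a permutation. -/
def ascents {n : ℕ} (σ : Equiv.Perm (Fin (n + 1))) : ℕ :=
  ∑ i : Fin n, if σ i.castSucc < σ i.succ then 1 else 0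

/-- The coefficient `Ω_n` of the Floquet-Magnus expansion `∑ T^n Ω_n`. -/
noncomputable def magnusTerm (H : ℝ → A) (T : ℝ) (n : ℕ) : A :=
  ∑ σ : Equiv.Perm (Fin (n + 1)),
    (((-1) ^ (n - ascents σ) * (ascents σ).factorial * (n - ascents σ).factorial : ℂ) /
        (I ^ n * ((n : ℂ) + 1) ^ 2 * n.factorial * (T : ℂ) ^ (n + 1))) •
      orderedIntegral (n + 1) T fun t => nestedCommutator n fun j => H (t (σ j))

/-- The truncated Floquet Hamiltonian `H_F^{(n)} = ∑_{m=0}^n T^m Ω_m`. -/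
noncomputable def truncatedFloquet (H : ℝ → A) (T : ℝ) (n : ℕ) : A :=
  ∑ m ∈ Finset.range (n + 1), ((T : ℂ) ^ m) • magnusTerm H T m

end evolution

/-- `n₀' = ⌊1 / (16 k g T) - 1⌋`. -/
noncomputable def nZeroPrime (k : ℕ) (g T : ℝ) : ℤ :=
  ⌊1 / (16 * k * g * T) - 1⌋

end FloquetSpin

set_option linter.unusedSectionVars false

/-! Put a = -iH and scale it by a complex coupling z. Over one period this gives two entire
families: the Dyson series U(z) = `evolution a T z`, and exp Ω(z), where Ω(z) = `magnusSum a T n z`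
is a polynomial in z. At z = 1 they are the Floquet operator and exp(-i H_F^(n) T). They solve U' =
vU and (exp Ω)' = w exp Ω in the variable z. Moving z from 0 to 1 in a Duhamel formula reduces the
comparison of evolved observables to commutators of D = w - v with a conjugated observable
(`norm_conj_evolution_sub_conj_exp_le`).

Algebra: D = O(z^{n+1}) as z → 0, because the permutation formula for Ω_m gives the Taylor
coefficients of log U(z). Chains of commutators weighted by the kernel 1_{s<t} - x satisfy (1 - x)
w_x U + x U w_x = U'. With X = U - 1 this is solved by a Neumann series in the operator Y ↦ (1 - x)
Y X + x X Y. Integrating over x in [0, 1], Beta integrals turn the Neumann series into the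
derivative of log(1 + X), and turn the powers of 1 - x and -x into the factors θ!(m - θ)!
(`hasSum_integral_chain`, `exp_magnusCoeff_isBigO`). The implied constants may depend on the volume;
no convergence of the Magnus series at z = 1 is needed.

Locality: v and w are sums of commutators of k-local operators of bounded strength per site. The
factorials produced by growing supports are cancelled by the time integrals and by the coefficients
1/(j + 1)!, so the commutator of D(z) with a local observable is at most a constant times |X| T on a
disc ‖z‖ ≤ ρ whose radius is of order 1/T, uniformly in the volume. A Lieb-Robinson type estimate
(`CommBound.conj_exp`) keeps such bounds alive under conjugation by exp Ω.

Conclusion: the commutator vanishes to order n + 1 at z = 0, so the higher order Schwarz lemma gains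
ρ^{-(n+1)}, of order T^{n+1}, on the unit disc. Together with the factor |X| T this is |X| T^{n+2}.
Periods above a fixed threshold are covered by the trivial bound 2. -/

namespace FloquetSpin

/-! ### Absolutely continuous functions given by a primitive -/

section primitive

variable {E : Type*} [NormedAddCommGroup E] [NormedSpace ℝ E]

/-- On `[0, T]` the function `F` is the primitive of the integrable function `f` with `F 0 = c`. -/
structure HasPrimitive (T : ℝ) (F f : ℝ → E) (c : E) : Prop where
  intervalIntegrable : IntervalIntegrable f volume 0 T
  eq : ∀ t ∈ Set.Icc 0 T, F t = c + ∫ s in (0 : ℝ)..t, f s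

variable {T : ℝ} {F G f g : ℝ → E} {c d : E}

theorem intervalIntegrable_of_mem_Icc (hf : IntervalIntegrable f volume 0 T) {t : ℝ}
    (ht : t ∈ Set.Icc 0 T) : IntervalIntegrable f volume 0 t :=
  hf.mono_set (by
    rw [Set.uIcc_of_le ht.1, Set.uIcc_of_le (ht.1.trans ht.2)]
    exact Set.Icc_subset_Icc_right ht.2)

theorem HasPrimitive.continuousOn (h : HasPrimitive T F f c) (hT : 0 ≤ T) :
    ContinuousOn F (Set.Icc 0 T) := by
  have h1 : ContinuousOn (fun t => c + ∫ s in (0 : ℝ)..t, f s) (Set.Icc 0 T) := by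
    refine continuousOn_const.add ?_
    have := intervalIntegral.continuousOn_primitive_interval'
      h.intervalIntegrable (a := 0) Set.left_mem_uIcc
    rwa [Set.uIcc_of_le hT] at this
  exact h1.congr h.eq

/-- This plays the role of uniqueness for differential equations. The Hamiltonian is merely
integrable in time, so identities between functions of time are proved by matching densities and
initial values instead of derivatives. -/
theorem HasPrimitive.ext (hF : HasPrimitive T F f c) (hG : HasPrimitive T G g c)
    (hfg : ∀ t ∈ Set.Icc 0 T, f t = g t) : ∀ t ∈ Set.Icc 0 T, F t = G t := by
  intro t ht
  rw [hF.eq t ht, hG.eq t ht]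
  congr 1
  refine intervalIntegral.integral_congr fun s hs => hfg s ?_
  rw [Set.uIcc_of_le ht.1] at hs
  exact ⟨hs.1, hs.2.trans ht.2⟩

theorem HasPrimitive.congr (hF : HasPrimitive T F f c) (hG : ∀ t ∈ Set.Icc 0 T, G t = F t)
    (hT : 0 ≤ T) (hfg : ∀ t ∈ Set.Icc 0 T, g t = f t) : HasPrimitive T G g c := by
  refine ⟨?_, fun t ht => ?_⟩
  · refine hF.intervalIntegrable.congr fun t ht => (hfg t ?_).symm
    rw [Set.uIoc_of_le hT] at ht
    exact ⟨ht.1.le, ht.2⟩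
  · rw [hG t ht, hF.eq t ht]
    congr 1
    refine intervalIntegral.integral_congr fun s hs => (hfg s ?_).symm
    rw [Set.uIcc_of_le ht.1] at hs
    exact ⟨hs.1, hs.2.trans ht.2⟩

theorem HasPrimitive.const (T : ℝ) (c : E) : HasPrimitive T (fun _ => c) (fun _ => 0) c :=
  ⟨by simp, by simp⟩

theorem HasPrimitive.add (hF : HasPrimitive T F f c) (hG : HasPrimitive T G g d) :
    HasPrimitive T (fun t => F t + G t) (fun t => f t + g t) (c + d) := by
  refine ⟨hF.intervalIntegrable.add hG.intervalIntegrable, fun t ht => ?_⟩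
  rw [hF.eq t ht, hG.eq t ht, intervalIntegral.integral_add
    (intervalIntegrable_of_mem_Icc hF.intervalIntegrable ht)
    (intervalIntegrable_of_mem_Icc hG.intervalIntegrable ht)]
  abel

theorem HasPrimitive.sum {ι : Type*} (S : Finset ι) {F f : ι → ℝ → E} {c : ι → E}
    (h : ∀ i ∈ S, HasPrimitive T (F i) (f i) (c i)) :
    HasPrimitive T (fun t => ∑ i ∈ S, F i t) (fun t => ∑ i ∈ S, f i t) (∑ i ∈ S, c i) := by
  classical
  induction S using Finset.induction_on with
  | empty => simpa using HasPrimitive.const T (0 : E)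
  | insert a S ha ih =>
    simp only [Finset.sum_insert ha]
    exact (h a (by simp)).add (ih fun i hi => h i (by simp [hi]))

end primitive

/-! ### Product rule for primitives with values in a Banach algebra. -/

section algebra

variable {A : Type*} [NormedRing A] [NormedAlgebra ℂ A] {T : ℝ} {F G f g : ℝ → A} {c d : A}

theorem intervalIntegrable_mul_of_continuousOn (hT : 0 ≤ T)
    (hf : IntervalIntegrable f volume 0 T) (hG : ContinuousOn G (Set.Icc 0 T)) :
    IntervalIntegrable (fun t => f t * G t) volume 0 T :=
  hf.mul_continuousOn (by rwa [Set.uIcc_of_le hT])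

theorem intervalIntegrable_continuousOn_mul (hT : 0 ≤ T)
    (hf : IntervalIntegrable f volume 0 T) (hG : ContinuousOn G (Set.Icc 0 T)) :
    IntervalIntegrable (fun t => G t * f t) volume 0 T :=
  hf.continuousOn_mul (by rwa [Set.uIcc_of_le hT])

theorem HasPrimitive.smul (hF : HasPrimitive T F f c) (a : ℂ) :
    HasPrimitive T (fun t => a • F t) (fun t => a • f t) (a • c) := by
  refine ⟨hF.intervalIntegrable.smul a, fun t ht => ?_⟩
  rw [hF.eq t ht, intervalIntegral.integral_smul, smul_add]

variable [CompleteSpace A]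

/-- Fubini on the square (0, t]², cut along the diagonal: the inner variable belongs to `g` below it
and to `f` above it, and the order of the factors is kept. -/
theorem integral_mul_integral {t : ℝ} (ht : 0 ≤ t) (hf : IntervalIntegrable f volume 0 t)
    (hg : IntervalIntegrable g volume 0 t) :
    (∫ s in (0 : ℝ)..t, f s) * (∫ s in (0 : ℝ)..t, g s) =
      (∫ s in (0 : ℝ)..t, f s * ∫ r in (0 : ℝ)..s, g r) +
        ∫ s in (0 : ℝ)..t, (∫ r in (0 : ℝ)..s, f r) * g s := by
  set μ := (volume : Measure ℝ).restrict (Set.Ioc 0 t) with hμ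
  have hf' : Integrable f μ := (intervalIntegrable_iff_integrableOn_Ioc_of_le ht).1 hf
  have hg' : Integrable g μ := (intervalIntegrable_iff_integrableOn_Ioc_of_le ht).1 hg
  have hfg : Integrable (fun z : ℝ × ℝ => f z.1 * g z.2) (μ.prod μ) :=
    hf'.op_fst_snd (op := fun x y : A => x * y) (by fun_prop)
      ⟨1, fun x y => by simpa using norm_mul_le x y⟩ hg'
  have h1 := integral_prod_bilin (𝕜 := ℂ) (ContinuousLinearMap.mul ℂ A) hf' hg'
  simp only [ContinuousLinearMap.mul_apply'] at h1
  rw [intervalIntegral.integral_of_le ht, intervalIntegral.integral_of_le ht, ← h1]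
  have hS : MeasurableSet {z : ℝ × ℝ | z.2 ≤ z.1} := measurableSet_le measurable_snd measurable_fst
  rw [← integral_add_compl hS hfg]
  congr 1
  · rw [← integral_indicator hS, integral_prod _ (hfg.indicator hS),
      intervalIntegral.integral_of_le ht]
    refine setIntegral_congr_fun measurableSet_Ioc fun s hs => ?_
    have h2 : ∀ r, Set.indicator {z : ℝ × ℝ | z.2 ≤ z.1} (fun z => f z.1 * g z.2) (s, r) =
        f s * (Set.Iic s).indicator g r := fun r => by
      by_cases h : r ≤ s <;> simp [Set.indicator, h]
    have h3 : Set.Iic s ∩ Set.Ioc 0 t = Set.Ioc 0 s := by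
      ext r; simp only [Set.mem_inter_iff, Set.mem_Iic, Set.mem_Ioc]
      exact ⟨fun h => ⟨h.2.1, h.1⟩, fun h => ⟨h.2, h.1, h.2.trans hs.2⟩⟩
    simp only [h2]
    rw [integral_const_mul_of_integrable (hg'.indicator measurableSet_Iic),
      integral_indicator measurableSet_Iic, hμ, Measure.restrict_restrict measurableSet_Iic, h3,
      intervalIntegral.integral_of_le hs.1.le]
  · rw [← integral_indicator hS.compl, integral_prod_symm _ (hfg.indicator hS.compl),
      intervalIntegral.integral_of_le ht]
    refine setIntegral_congr_fun measurableSet_Ioc fun s hs => ?_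
    have h2 : ∀ r, Set.indicator {z : ℝ × ℝ | z.2 ≤ z.1}ᶜ (fun z => f z.1 * g z.2) (r, s) =
        (Set.Iio s).indicator f r * g s := fun r => by
      by_cases h : r < s <;> simp [Set.indicator, h]
    have h3 : Set.Iio s ∩ Set.Ioc 0 t = Set.Ioo 0 s := by
      ext r; simp only [Set.mem_inter_iff, Set.mem_Iio, Set.mem_Ioc, Set.mem_Ioo]
      exact ⟨fun h => ⟨h.2.1, h.1⟩, fun h => ⟨h.2, h.1, h.2.le.trans hs.2⟩⟩
    simp only [h2]
    rw [integral_mul_const_of_integrable (hf'.indicator measurableSet_Iio),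
      integral_indicator measurableSet_Iio, hμ, Measure.restrict_restrict measurableSet_Iio, h3,
      intervalIntegral.integral_of_le hs.1.le, integral_Ioc_eq_integral_Ioo]

theorem interval_integral_mul_const {t : ℝ} (ht : 0 ≤ t) (hf : IntervalIntegrable f volume 0 t)
    (a : A) : ∫ s in (0 : ℝ)..t, f s * a = (∫ s in (0 : ℝ)..t, f s) * a := by
  rw [intervalIntegral.integral_of_le ht, intervalIntegral.integral_of_le ht]
  exact integral_mul_const_of_integrable hf.1

theorem interval_integral_const_mul {t : ℝ} (ht : 0 ≤ t) (hf : IntervalIntegrable f volume 0 t)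
    (a : A) : ∫ s in (0 : ℝ)..t, a * f s = a * ∫ s in (0 : ℝ)..t, f s := by
  rw [intervalIntegral.integral_of_le ht, intervalIntegral.integral_of_le ht]
  exact integral_const_mul_of_integrable hf.1

/-- Expand both factors as initial value plus integral. The only nontrivial term is the product of
two integrals, handled by `integral_mul_integral`. -/
theorem HasPrimitive.mul (hT : 0 ≤ T) (hF : HasPrimitive T F f c) (hG : HasPrimitive T G g d) :
    HasPrimitive T (fun t => F t * G t) (fun t => f t * G t + F t * g t) (c * d) := by
  have hFc := hF.continuousOn hT
  have hGc := hG.continuousOn hT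
  have i1 := intervalIntegrable_mul_of_continuousOn hT hF.intervalIntegrable hGc
  have i2 := intervalIntegrable_continuousOn_mul hT hG.intervalIntegrable hFc
  refine ⟨i1.add i2, fun t ht => ?_⟩
  have hf := intervalIntegrable_of_mem_Icc hF.intervalIntegrable ht
  have hg := intervalIntegrable_of_mem_Icc hG.intervalIntegrable ht
  have j1 := intervalIntegrable_of_mem_Icc i1 ht
  have j2 := intervalIntegrable_of_mem_Icc i2 ht
  have hmem : ∀ s ∈ Set.uIcc 0 t, s ∈ Set.Icc 0 T := fun s hs => by
    rw [Set.uIcc_of_le ht.1] at hs; exact ⟨hs.1, hs.2.trans ht.2⟩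
  have e1 : ∫ s in (0 : ℝ)..t, f s * G s =
      (∫ s in (0 : ℝ)..t, f s) * d + ∫ s in (0 : ℝ)..t, f s * ∫ r in (0 : ℝ)..s, g r := by
    have k : IntervalIntegrable (fun s => f s * ∫ r in (0 : ℝ)..s, g r) volume 0 t :=
      intervalIntegrable_mul_of_continuousOn ht.1 hf
        (by simpa using (HasPrimitive.mk (c := 0) hg fun _ _ => rfl).continuousOn ht.1)
    rw [← interval_integral_mul_const ht.1 hf,
      ← intervalIntegral.integral_add (hf.mul_const d) k]
    refine intervalIntegral.integral_congr fun s hs => ?_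
    simp only [hG.eq s (hmem s hs), mul_add]
  have e2 : ∫ s in (0 : ℝ)..t, F s * g s =
      c * (∫ s in (0 : ℝ)..t, g s) + ∫ s in (0 : ℝ)..t, (∫ r in (0 : ℝ)..s, f r) * g s := by
    have k : IntervalIntegrable (fun s => (∫ r in (0 : ℝ)..s, f r) * g s) volume 0 t :=
      intervalIntegrable_continuousOn_mul ht.1 hg
        (by simpa using (HasPrimitive.mk (c := 0) hf fun _ _ => rfl).continuousOn ht.1)
    rw [← interval_integral_const_mul ht.1 hg,
      ← intervalIntegral.integral_add (hg.const_mul c) k]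
    refine intervalIntegral.integral_congr fun s hs => ?_
    simp only [hF.eq s (hmem s hs), add_mul]
  rw [intervalIntegral.integral_add j1 j2, e1, e2, hF.eq t ht, hG.eq t ht, add_mul, mul_add,
    mul_add, integral_mul_integral ht.1 hf hg]
  abel

theorem HasPrimitive.mul_const (hT : 0 ≤ T) (hF : HasPrimitive T F f c) (a : A) :
    HasPrimitive T (fun t => F t * a) (fun t => f t * a) (c * a) := by
  simpa using hF.mul hT (HasPrimitive.const T a)

/-! ### Iterated integrals -/

/-- `∫_0^t dt₁ ∫_0^{t₁} dt₂ ⋯ a(t₁) a(t₂) ⋯ a(t_m)`. -/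
noncomputable def iteratedProd (a : ℝ → A) : ℕ → ℝ → A
  | 0, _ => 1
  | m + 1, t => ∫ s in (0 : ℝ)..t, a s * iteratedProd a m s

variable {a : ℝ → A}

theorem hasPrimitive_iteratedProd (hT : 0 ≤ T) (ha : IntervalIntegrable a volume 0 T) (m : ℕ) :
    HasPrimitive T (iteratedProd a (m + 1)) (fun t => a t * iteratedProd a m t) 0 := by
  induction m with
  | zero => exact ⟨by simpa [iteratedProd] using ha, fun t _ => by simp [iteratedProd]⟩
  | succ m ih =>
    exact ⟨intervalIntegrable_mul_of_continuousOn hT ha (ih.continuousOn hT),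
      fun t _ => by simp [iteratedProd]⟩

/-- The coefficients of a solution of `y' = a + z [a, y]` satisfy, together with those of the
solution `P` of `P' = z a P`, the relation `y P = ∂_z P + P y(0)`. -/
theorem sum_mul_iteratedProd (hT : 0 ≤ T) (ha : IntervalIntegrable a volume 0 T)
    {y : ℕ → ℝ → A} {c : ℕ → A} (h0 : HasPrimitive T (y 0) a (c 0))
    (hy : ∀ m, HasPrimitive T (y (m + 1)) (fun t => a t * y m t - y m t * a t) (c (m + 1)))
    (m : ℕ) : ∀ t ∈ Set.Icc 0 T,
      ∑ p ∈ Finset.HasAntidiagonal.antidiagonal m, y p.1 t * iteratedProd a p.2 t =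
        ((m : ℂ) + 1) • iteratedProd a (m + 1) t +
          ∑ p ∈ Finset.HasAntidiagonal.antidiagonal m, iteratedProd a p.1 t * c p.2 := by
  induction m with
  | zero =>
    intro t ht
    have := (hasPrimitive_iteratedProd hT ha 0).eq t ht
    simp only [iteratedProd, mul_one, zero_add] at this
    simp [iteratedProd, h0.eq t ht, add_comm]
  | succ m ih =>
    have hP := hasPrimitive_iteratedProd hT ha
    have hP0 : HasPrimitive T (iteratedProd a 0) (fun _ => 0) 1 := by
      simpa [iteratedProd] using HasPrimitive.const T (1 : A)
    have hL : HasPrimitive T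
        (fun t => y 0 t * iteratedProd a (m + 1) t +
          ∑ p ∈ Finset.HasAntidiagonal.antidiagonal m, y (p.1 + 1) t * iteratedProd a p.2 t)
        (fun t => (((m + 1 : ℕ) : ℂ) + 1) • (a t * iteratedProd a (m + 1) t) +
          ∑ p ∈ Finset.HasAntidiagonal.antidiagonal m, a t * (iteratedProd a p.1 t * c p.2))
        (c (m + 1)) := by
      have hs : ∀ p ∈ Finset.HasAntidiagonal.antidiagonal (m + 1), HasPrimitive T
          (fun t => y p.1 t * iteratedProd a p.2 t)
          (fun t => (match p.1 with
              | 0 => a t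
              | i + 1 => a t * y i t - y i t * a t) * iteratedProd a p.2 t +
            y p.1 t * (match p.2 with
              | 0 => 0
              | l + 1 => a t * iteratedProd a l t))
          (c p.1 * (match p.2 with
              | 0 => 1
              | _ + 1 => 0)) := by
        rintro ⟨i, l⟩ -
        refine HasPrimitive.mul hT ?_ ?_
        · cases i with
          | zero => exact h0
          | succ i => exact hy i
        · cases l with
          | zero => exact hP0
          | succ l => exact hP l
      have := HasPrimitive.sum _ hs
      have hc : ∑ p ∈ Finset.HasAntidiagonal.antidiagonal (m + 1), c p.1 * (match p.2 with
          | 0 => (1 : A)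
          | _ + 1 => 0) = c (m + 1) := by
        simp [Finset.Nat.antidiagonal_succ']
      rw [hc] at this
      refine this.congr (fun t _ => ?_) hT fun t ht => ?_
      · rw [Finset.Nat.antidiagonal_succ]; simp
      -- The term y₀' = a contributes a P_{m+1}. In the other terms the part -y a of the commutator
      -- cancels against y P' = y a P, leaving a times the identity of order m. Its coefficient m +
      -- 1 and the extra term add up to m + 2.
      · rw [Finset.sum_add_distrib, Finset.Nat.sum_antidiagonal_succ,
          Finset.Nat.sum_antidiagonal_succ']
        simp only [mul_zero, zero_add]
        rw [add_assoc, ← Finset.sum_add_distrib]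
        have e : ∀ p : ℕ × ℕ, (a t * y p.1 t - y p.1 t * a t) * iteratedProd a p.2 t +
            y p.1 t * (a t * iteratedProd a p.2 t) = a t * (y p.1 t * iteratedProd a p.2 t) := by
          intro p; noncomm_ring
        simp only [e, ← Finset.mul_sum]
        rw [ih t ht, mul_add, mul_smul_comm]
        push_cast
        module
    have hR : HasPrimitive T
        (fun t => (((m + 1 : ℕ) : ℂ) + 1) • iteratedProd a (m + 2) t +
          (iteratedProd a 0 t * c (m + 1) +
            ∑ p ∈ Finset.HasAntidiagonal.antidiagonal m, iteratedProd a (p.1 + 1) t * c p.2))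
        (fun t => (((m + 1 : ℕ) : ℂ) + 1) • (a t * iteratedProd a (m + 1) t) +
          ∑ p ∈ Finset.HasAntidiagonal.antidiagonal m, a t * (iteratedProd a p.1 t * c p.2))
        (c (m + 1)) := by
      have h1 := (hP (m + 1)).smul (((m + 1 : ℕ) : ℂ) + 1)
      have h2 : HasPrimitive T
          (fun t => ∑ p ∈ Finset.HasAntidiagonal.antidiagonal m, iteratedProd a (p.1 + 1) t * c p.2)
          (fun t => ∑ p ∈ Finset.HasAntidiagonal.antidiagonal m, a t * (iteratedProd a p.1 t * c p.2)) 0 := by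
        have := HasPrimitive.sum (Finset.HasAntidiagonal.antidiagonal m)
          fun p _ => (hP p.1).mul_const hT (c p.2)
        simpa [mul_assoc] using this
      have h3 := h1.add (((hP0.mul_const hT (c (m + 1)))).add h2)
      simpa using h3
    intro t ht
    have := hL.ext hR (fun _ _ => rfl) t ht
    rw [Finset.Nat.antidiagonal_succ]
    simpa using this

end algebra

/-! ### Integrals over a simplex and over a cube -/

section simplex

variable {A : Type*} [NormedRing A] [NormedAlgebra ℂ A] [CompleteSpace A]

/-- The cube `(0, u]^m`. -/
def cube (m : ℕ) (u : ℝ) : Set (Fin m → ℝ) := Set.univ.pi fun _ => Set.Ioc 0 u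

/-- The simplex `u ≥ t₀ ≥ t₁ ≥ … > 0`. -/
def simplex (m : ℕ) (u : ℝ) : Set (Fin m → ℝ) := cube m u ∩ {t | Antitone t}

theorem measurableSet_cube (m : ℕ) (u : ℝ) : MeasurableSet (cube m u) :=
  MeasurableSet.univ_pi fun _ => measurableSet_Ioc

theorem measurableSet_simplex (m : ℕ) (u : ℝ) : MeasurableSet (simplex m u) := by
  refine (measurableSet_cube m u).inter ?_
  have : {t : Fin m → ℝ | Antitone t} = ⋂ i, ⋂ j, ⋂ _ : i ≤ j, {t | t j ≤ t i} := by
    ext t; simp [Antitone]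
  rw [this]
  exact MeasurableSet.iInter fun i => MeasurableSet.iInter fun j => MeasurableSet.iInter fun _ =>
    measurableSet_le (measurable_pi_apply j) (measurable_pi_apply i)

theorem cube_mono {m : ℕ} {u v : ℝ} (h : u ≤ v) : cube m u ⊆ cube m v :=
  Set.pi_mono fun _ _ => Set.Ioc_subset_Ioc_right h

theorem cons_mem_cube {m : ℕ} {u s : ℝ} {t : Fin m → ℝ} :
    Fin.cons s t ∈ cube (m + 1) u ↔ s ∈ Set.Ioc 0 u ∧ t ∈ cube m u := by
  simp [cube, Set.mem_pi, Fin.forall_fin_succ]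

theorem cons_mem_simplex {m : ℕ} {u s : ℝ} {t : Fin m → ℝ} :
    Fin.cons s t ∈ simplex (m + 1) u ↔ s ∈ Set.Ioc 0 u ∧ t ∈ simplex m s := by
  simp only [simplex, Set.mem_inter_iff, cons_mem_cube, Set.mem_ofPred_eq]
  constructor
  · rintro ⟨⟨hs, ht⟩, ha⟩
    refine ⟨hs, fun i _ => ⟨(ht i trivial).1, ?_⟩, fun i j hij => ?_⟩
    · simpa using ha (Fin.zero_le i.succ)
    · simpa using ha (Fin.succ_le_succ_iff.2 hij)
  · rintro ⟨hs, ht, ha⟩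
    refine ⟨⟨hs, fun i hi => ⟨(ht i hi).1, (ht i hi).2.trans hs.2⟩⟩, fun i j => ?_⟩
    refine Fin.cases ?_ (fun i => ?_) i <;> refine Fin.cases ?_ (fun j => ?_) j
    · simp
    · simpa using (ht j trivial).2
    · simp
    · simpa using fun h => ha h

theorem integral_fin_succ {m : ℕ} {S : Set (Fin (m + 1) → ℝ)} (hS : MeasurableSet S)
    {f : (Fin (m + 1) → ℝ) → A} (hf : IntegrableOn f S) :
    Integrable (fun z : ℝ × (Fin m → ℝ) => S.indicator f (Fin.cons z.1 z.2))
      (volume.prod volume) ∧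
    ∫ t in S, f t = ∫ s : ℝ, ∫ t : Fin m → ℝ, S.indicator f (Fin.cons s t) := by
  have e := (volume_preserving_piFinSuccAbove (fun _ : Fin (m + 1) => ℝ) 0).symm
  have he : ∀ z : ℝ × (Fin m → ℝ),
      (MeasurableEquiv.piFinSuccAbove (fun _ : Fin (m + 1) => ℝ) 0).symm z =
        Fin.cons z.1 z.2 := fun z => by
    simp [MeasurableEquiv.piFinSuccAbove_symm_apply, Fin.insertNthEquiv]
  have hi := (integrable_indicator_iff hS).2 hf
  have h1 : Integrable (fun z : ℝ × (Fin m → ℝ) => S.indicator f (Fin.cons z.1 z.2))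
      (volume.prod volume) := by
    have := (e.integrable_comp_emb (MeasurableEquiv.measurableEmbedding _)).2 hi
    exact this.congr (Filter.Eventually.of_forall fun z => by simp only [Function.comp_apply, he])
  refine ⟨h1, ?_⟩
  rw [← integral_indicator hS, ← e.integral_comp' (S.indicator f)]
  simp only [he]
  exact integral_prod _ h1

/-- Integrability is assumed on the whole cube rather than on the simplex, since it then passes to
almost every slice, which is a cube of one dimension less. -/
theorem orderedIntegral_eq_setIntegral (m : ℕ) : ∀ {u : ℝ}, 0 ≤ u →
    ∀ {f : (Fin m → ℝ) → A}, IntegrableOn f (cube m u) →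
      orderedIntegral m u f = ∫ t in simplex m u, f t := by
  induction m with
  | zero =>
    intro u _ f _
    have h : simplex 0 u = Set.univ := by
      ext t; simp [simplex, cube, Antitone]
    rw [h, Measure.restrict_univ, volume_pi, Measure.pi_of_empty _ Fin.elim0,
      integral_dirac]
    rfl
  | succ m ih =>
    intro u hu f hf
    have hc := (integral_fin_succ (measurableSet_cube (m + 1) u) hf).1
    rw [(integral_fin_succ (measurableSet_simplex (m + 1) u)
      (hf.mono_set Set.inter_subset_left)).2]
    have h1 : ∀ (s : ℝ) (t : Fin m → ℝ), (simplex (m + 1) u).indicator f (Fin.cons s t) =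
        (Set.Ioc 0 u).indicator
          (fun s => (simplex m s).indicator (fun t => f (Fin.cons s t)) t) s := by
      intro s t
      by_cases hs : s ∈ Set.Ioc 0 u
      · by_cases ht : t ∈ simplex m s
        · rw [Set.indicator_of_mem (cons_mem_simplex.2 ⟨hs, ht⟩), Set.indicator_of_mem hs,
            Set.indicator_of_mem ht]
        · rw [Set.indicator_of_notMem fun h => ht (cons_mem_simplex.1 h).2,
            Set.indicator_of_mem hs, Set.indicator_of_notMem ht]
      · rw [Set.indicator_of_notMem fun h => hs (cons_mem_simplex.1 h).1,
          Set.indicator_of_notMem hs]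
    have h2 : ∀ s : ℝ, ∫ t : Fin m → ℝ, (simplex (m + 1) u).indicator f (Fin.cons s t) =
        (Set.Ioc 0 u).indicator (fun s => ∫ t in simplex m s, f (Fin.cons s t)) s := by
      intro s
      simp only [h1]
      by_cases hs : s ∈ Set.Ioc 0 u
      · simp only [Set.indicator_of_mem hs]
        exact integral_indicator (measurableSet_simplex m s)
      · simp [Set.indicator_of_notMem hs]
    simp only [h2]
    rw [integral_indicator measurableSet_Ioc, orderedIntegral,
      intervalIntegral.integral_of_le hu]
    refine setIntegral_congr_ae measurableSet_Ioc ?_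
    filter_upwards [hc.prod_right_ae] with s hs hsu
    refine ih hsu.1.le ?_
    have h3 : ∀ t : Fin m → ℝ, (cube (m + 1) u).indicator f (Fin.cons s t) =
        (cube m u).indicator (fun t => f (Fin.cons s t)) t := by
      intro t
      by_cases ht : t ∈ cube m u
      · rw [Set.indicator_of_mem (cons_mem_cube.2 ⟨hsu, ht⟩), Set.indicator_of_mem ht]
      · rw [Set.indicator_of_notMem fun h => ht (cons_mem_cube.1 h).2,
          Set.indicator_of_notMem ht]
    simp only [h3] at hs
    exact ((integrable_indicator_iff (measurableSet_cube m u)).1 hs).mono_set (cube_mono hsu.2)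

/-- Coincident times lie in finitely many proper linear subspaces, each of measure zero. -/
theorem ae_injective (m : ℕ) : ∀ᵐ t : Fin m → ℝ, Function.Injective t := by
  have h : ∀ i j : Fin m, i ≠ j → ∀ᵐ t : Fin m → ℝ, t i ≠ t j := by
    intro i j hij
    set S := LinearMap.ker (LinearMap.proj (R := ℝ) (φ := fun _ : Fin m => ℝ) i -
      LinearMap.proj j) with hS
    have hne : S ≠ ⊤ := by
      intro h
      have : Pi.single i (1 : ℝ) ∈ S := h ▸ Submodule.mem_top
      simp [hS, hij.symm] at this
    have := Measure.addHaar_submodule (volume : Measure (Fin m → ℝ)) S hne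
    refine (measure_eq_zero_iff_ae_notMem.1 this).mono fun t ht h => ht ?_
    simp [hS, h]
  have h' : ∀ᵐ t : Fin m → ℝ, ∀ i j : Fin m, i ≠ j → t i ≠ t j := by
    refine ae_all_iff.2 fun i => ae_all_iff.2 fun j => ?_
    by_cases hij : i = j
    · simp [hij]
    · simpa [hij] using h i j hij
  exact h'.mono fun t ht i j hij => by_contra fun hne => ht i j hne hij

theorem existsUnique_antitone_comp {m : ℕ} {t : Fin m → ℝ} (ht : Function.Injective t) :
    ∃! σ : Equiv.Perm (Fin m), Antitone (t ∘ σ) := by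
  refine ⟨Tuple.sort (fun i => -t i), ?_, ?_⟩
  · intro i j hij
    have := Tuple.monotone_sort (fun i => -t i) hij
    simpa using this
  · intro σ hσ
    refine (Tuple.eq_sort_iff (f := fun i => -t i) (σ := σ)).2 ⟨?_, ?_⟩
    · intro i j hij
      simpa using hσ hij
    · intro i j hij h
      exact absurd (σ.injective (ht (neg_injective h))) hij.ne

/-- The images of the simplex under permutations of the coordinates tile the cube: away from the
null set of ties, exactly one permutation puts a point in decreasing order. -/
theorem sum_perm_setIntegral_simplex {m : ℕ} {u : ℝ} {f : (Fin m → ℝ) → A}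
    (hf : IntegrableOn f (cube m u)) :
    ∑ σ : Equiv.Perm (Fin m), ∫ t in simplex m u, f (t ∘ σ) = ∫ t in cube m u, f t := by
  have hcube : ∀ (σ : Equiv.Perm (Fin m)) (t : Fin m → ℝ), t ∘ σ ∈ cube m u ↔ t ∈ cube m u := by
    intro σ t
    simp only [cube, Set.mem_pi, Set.mem_univ, true_implies, Function.comp_apply]
    exact σ.forall_congr_left.trans (by simp)
  have h1 : ∀ σ : Equiv.Perm (Fin m), ∫ t in simplex m u, f (t ∘ σ) =
      ∫ t, (simplex m u).indicator (fun t => f (t ∘ σ)) (t ∘ σ.symm) := by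
    intro σ
    rw [← integral_indicator (measurableSet_simplex m u)]
    have e := volume_measurePreserving_piCongrLeft (fun _ : Fin m => ℝ) σ
    rw [← e.integral_comp']
    refine integral_congr_ae (Filter.Eventually.of_forall fun t => ?_)
    have : (MeasurableEquiv.piCongrLeft (fun _ : Fin m => ℝ) σ) t = t ∘ σ.symm := by
      ext i
      obtain ⟨j, rfl⟩ := σ.surjective i
      simp [MeasurableEquiv.coe_piCongrLeft]
    simp only [this]
  have h2 : ∀ (σ : Equiv.Perm (Fin m)) (t : Fin m → ℝ),
      (simplex m u).indicator (fun t => f (t ∘ σ)) (t ∘ σ.symm) =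
        {t | Antitone (t ∘ σ.symm)}.indicator ((cube m u).indicator f) t := by
    intro σ t
    by_cases hc : t ∈ cube m u
    · by_cases ha : Antitone (t ∘ σ.symm)
      · rw [Set.indicator_of_mem (show t ∘ σ.symm ∈ simplex m u from ⟨(hcube _ _).2 hc, ha⟩), Set.indicator_of_mem (by exact ha),
          Set.indicator_of_mem hc]
        congr 1; ext i; simp
      · rw [Set.indicator_of_notMem fun h => ha h.2, Set.indicator_of_notMem (by exact ha)]
    · rw [Set.indicator_of_notMem fun h => hc ((hcube _ _).1 h.1)]
      by_cases ha : Antitone (t ∘ σ.symm)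
      · rw [Set.indicator_of_mem (by exact ha), Set.indicator_of_notMem hc]
      · rw [Set.indicator_of_notMem (by exact ha)]
  have hmeas : ∀ σ : Equiv.Perm (Fin m), MeasurableSet {t : Fin m → ℝ | Antitone (t ∘ σ.symm)} := by
    intro σ
    have : {t : Fin m → ℝ | Antitone (t ∘ σ.symm)} =
        ⋂ i, ⋂ j, ⋂ _ : i ≤ j, {t | t (σ.symm j) ≤ t (σ.symm i)} := by
      ext t; simp [Antitone]
    rw [this]
    exact MeasurableSet.iInter fun i => MeasurableSet.iInter fun j => MeasurableSet.iInter fun _ =>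
      measurableSet_le (measurable_pi_apply _) (measurable_pi_apply _)
  have hi := (integrable_indicator_iff (measurableSet_cube m u)).2 hf
  simp only [h1, h2]
  rw [← integral_finsetSum _ fun σ _ => hi.indicator (hmeas σ),
    ← integral_indicator (measurableSet_cube m u)]
  refine integral_congr_ae ?_
  filter_upwards [ae_injective m] with t ht
  obtain ⟨σ, hσ, huniq⟩ := existsUnique_antitone_comp ht
  rw [Finset.sum_eq_single σ.symm]
  · rw [Set.indicator_of_mem (by simpa using hσ)]
  · intro τ _ hτ
    rw [Set.indicator_of_notMem]
    intro h
    exact hτ (by rw [← huniq _ h]; rfl)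
  · simp

end simplex

/-! ### Chains of commutators with a kernel -/

section chain

variable {A : Type*} [NormedRing A] [NormedAlgebra ℂ A] [CompleteSpace A]

theorem norm_lie_le (a b : A) : ‖⁅a, b⁆‖ ≤ 2 * ‖a‖ * ‖b‖ := by
  rw [Ring.lie_def]
  have := norm_sub_le (a * b) (b * a)
  have h1 := norm_mul_le a b
  have h2 := norm_mul_le b a
  nlinarith

theorem norm_nestedCommutator_le (m : ℕ) (a : Fin (m + 1) → A) :
    ‖nestedCommutator m a‖ ≤ 2 ^ m * ∏ i, ‖a i‖ := by
  induction m with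
  | zero => simp [nestedCommutator]
  | succ m ih =>
    rw [nestedCommutator, Fin.prod_univ_succ]
    calc _ ≤ 2 * ‖a 0‖ * ‖nestedCommutator m (Fin.tail a)‖ := norm_lie_le _ _
      _ ≤ 2 * ‖a 0‖ * (2 ^ m * ∏ i, ‖Fin.tail a i‖) := by gcongr; exact ih _
      _ = _ := by simp only [Fin.tail]; ring

theorem aestronglyMeasurable_nestedCommutator {α : Type*} [MeasurableSpace α] {μ : Measure α}
    (m : ℕ) {a : Fin (m + 1) → α → A} (ha : ∀ i, AEStronglyMeasurable (a i) μ) :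
    AEStronglyMeasurable (fun x => nestedCommutator m fun i => a i x) μ := by
  induction m with
  | zero => simpa [nestedCommutator] using ha 0
  | succ m ih =>
    have h := ih (a := fun i => a i.succ) fun i => ha _
    simp only [nestedCommutator, Ring.lie_def]
    exact ((ha 0).mul h).sub (h.mul (ha 0))

theorem volume_restrict_cube (m : ℕ) (u : ℝ) :
    (volume : Measure (Fin m → ℝ)).restrict (cube m u) =
      Measure.pi fun _ => volume.restrict (Set.Ioc 0 u) := by
  rw [cube, volume_pi, Measure.restrict_pi_pi]

theorem integrableOn_nestedCommutator (m : ℕ) {T : ℝ} {a : ℝ → A}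
    (ha : IntegrableOn a (Set.Ioc 0 T)) (σ : Equiv.Perm (Fin (m + 1))) :
    IntegrableOn (fun t : Fin (m + 1) → ℝ => nestedCommutator m fun i => a (t (σ i)))
      (cube (m + 1) T) := by
  rw [IntegrableOn, volume_restrict_cube]
  have h1 : Integrable (fun t : Fin (m + 1) → ℝ => ∏ i, ‖a (t i)‖)
      (Measure.pi fun _ => volume.restrict (Set.Ioc 0 T)) :=
    Integrable.fintype_prod (f := fun _ s => ‖a s‖) fun _ => ha.norm
  refine (h1.const_mul (2 ^ m)).mono' ?_ (Filter.Eventually.of_forall fun t => ?_)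
  · refine aestronglyMeasurable_nestedCommutator m fun i => ?_
    exact ha.aestronglyMeasurable.comp_quasiMeasurePreserving
      (Measure.quasiMeasurePreserving_eval (fun _ => volume.restrict (Set.Ioc 0 T)) (σ i))
  · refine (norm_nestedCommutator_le m _).trans_eq ?_
    rw [Equiv.prod_comp σ fun i => ‖a (t i)‖]

/-- The kernel `1_{s < t} - x`. -/
noncomputable def ascentKernel (x t s : ℝ) : ℝ := (if s < t then 1 else 0) - x

theorem measurable_ascentKernel (x : ℝ) :
    Measurable fun z : ℝ × ℝ => ascentKernel x z.1 z.2 :=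
  (Measurable.ite (measurableSet_lt measurable_snd measurable_fst)
    measurable_const measurable_const).sub_const x

theorem abs_ascentKernel_le {x : ℝ} (hx : x ∈ Set.Icc (0 : ℝ) 1) (t s : ℝ) :
    |ascentKernel x t s| ≤ 1 := by
  unfold ascentKernel
  rw [abs_le]
  split_ifs <;> constructor <;> linarith [hx.1, hx.2]

theorem abs_ascentKernel_le' (x t s : ℝ) : |ascentKernel x t s| ≤ 1 + |x| := by
  unfold ascentKernel
  refine (abs_sub _ _).trans ?_
  split_ifs <;> simp

/-- `d₀ = a` and `d_{m+1}(s) = [a(s), ∫_0^T (1_{r < s} - x) d_m(r) dr]`. -/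
noncomputable def chainDensity (a : ℝ → A) (T x : ℝ) : ℕ → ℝ → A
  | 0, s => a s
  | m + 1, s => ⁅a s, ∫ r in (0 : ℝ)..T, ascentKernel x s r • chainDensity a T x m r⁆

/-- `∏_i (1_{t_{i+1} < t_i} - x) [a(t₀), [a(t₁), …]]`. -/
noncomputable def chainIntegrand (a : ℝ → A) (x : ℝ) (m : ℕ) (t : Fin (m + 1) → ℝ) : A :=
  (∏ i : Fin m, ascentKernel x (t i.castSucc) (t i.succ)) • nestedCommutator m fun j => a (t j)

variable {a : ℝ → A} {T : ℝ}

theorem integrableOn_chainIntegrand (m : ℕ) (x : ℝ) (ha : IntegrableOn a (Set.Ioc 0 T)) :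
    IntegrableOn (chainIntegrand a x m) (cube (m + 1) T) := by
  have hm : Measurable fun t : Fin (m + 1) → ℝ =>
      ∏ i : Fin m, ascentKernel x (t i.castSucc) (t i.succ) :=
    Finset.measurable_prod _ fun i _ => (measurable_ascentKernel x).comp
      (g := fun z : ℝ × ℝ => ascentKernel x z.1 z.2) (f := fun t : Fin (m + 1) → ℝ => (t i.castSucc, t i.succ))
      ((measurable_pi_apply i.castSucc).prodMk (measurable_pi_apply i.succ))
  have hb : ∀ t : Fin (m + 1) → ℝ,
      ‖∏ i : Fin m, ascentKernel x (t i.castSucc) (t i.succ)‖ ≤ (1 + |x|) ^ m := by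
    intro t
    rw [norm_prod]
    refine (Finset.prod_le_prod (fun _ _ => norm_nonneg _)
      fun i _ => abs_ascentKernel_le' x _ _).trans_eq ?_
    simp
  exact Integrable.bdd_smul (𝕜 := ℝ) (integrableOn_nestedCommutator m ha (Equiv.refl _)) _
    hm.aestronglyMeasurable (Filter.Eventually.of_forall hb)

theorem chainIntegrand_cons (m : ℕ) (x s : ℝ) (t : Fin (m + 1) → ℝ) :
    chainIntegrand a x (m + 1) (Fin.cons s t) =
      ⁅a s, ascentKernel x s (t 0) • chainIntegrand a x m t⁆ := by
  simp only [chainIntegrand, nestedCommutator, Fin.prod_univ_succ, Fin.castSucc_zero,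
    Fin.cons_zero, Fin.cons_succ, Fin.castSucc_succ]
  have h : (Fin.tail fun j => a ((Fin.cons s t : Fin (m + 2) → ℝ) j)) = fun j => a (t j) := rfl
  rw [h]
  simp only [Ring.lie_def, mul_smul_comm, smul_mul_assoc, smul_sub, mul_smul]

/-- The weight `b` of the first time is what lets the induction run: removing the outermost time `s`
leaves the shorter chain weighted by `ascentKernel x s` at its first time. -/
theorem setIntegral_cube_chainIntegrand (hT : 0 ≤ T) (x : ℝ) (ha : IntegrableOn a (Set.Ioc 0 T))
    (m : ℕ) : ∀ {b : ℝ → ℝ} {C : ℝ}, Measurable b → (∀ s, |b s| ≤ C) →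
      ∫ t in cube (m + 1) T, b (t 0) • chainIntegrand a x m t =
        ∫ s in (0 : ℝ)..T, b s • chainDensity a T x m s := by
  have hInt : ∀ (m : ℕ) {b : ℝ → ℝ} {C : ℝ}, Measurable b → (∀ s, |b s| ≤ C) →
      IntegrableOn (fun t : Fin (m + 1) → ℝ => b (t 0) • chainIntegrand a x m t)
        (cube (m + 1) T) := fun m b C hb hC =>
    Integrable.bdd_smul (𝕜 := ℝ) (φ := fun t : Fin (m + 1) → ℝ => b (t 0))
      (integrableOn_chainIntegrand m x ha) C
      (hb.comp (measurable_pi_apply 0)).aestronglyMeasurable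
      (Filter.Eventually.of_forall fun t => hC _)
  have hcons : ∀ (m : ℕ) (f : (Fin (m + 1) → ℝ) → A) (s : ℝ) (t : Fin m → ℝ),
      (cube (m + 1) T).indicator f (Fin.cons s t) =
        (Set.Ioc 0 T).indicator (fun s => (cube m T).indicator (fun t => f (Fin.cons s t)) t) s := by
    intro m f s t
    by_cases hs : s ∈ Set.Ioc 0 T
    · by_cases ht : t ∈ cube m T
      · rw [Set.indicator_of_mem (cons_mem_cube.2 ⟨hs, ht⟩), Set.indicator_of_mem hs,
          Set.indicator_of_mem ht]
      · rw [Set.indicator_of_notMem fun h => ht (cons_mem_cube.1 h).2,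
          Set.indicator_of_mem hs, Set.indicator_of_notMem ht]
    · rw [Set.indicator_of_notMem fun h => hs (cons_mem_cube.1 h).1,
        Set.indicator_of_notMem hs]
  have hfub : ∀ (m : ℕ) {f : (Fin (m + 1) → ℝ) → A}, IntegrableOn f (cube (m + 1) T) →
      ∫ t in cube (m + 1) T, f t =
        ∫ s in Set.Ioc 0 T, ∫ t in cube m T, f (Fin.cons s t) := by
    intro m f hf
    rw [(integral_fin_succ (measurableSet_cube (m + 1) T) hf).2,
      ← integral_indicator measurableSet_Ioc]
    refine integral_congr_ae (Filter.Eventually.of_forall fun s => ?_)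
    simp only [hcons]
    by_cases hs : s ∈ Set.Ioc 0 T
    · simp only [Set.indicator_of_mem hs]
      exact integral_indicator (measurableSet_cube m T)
    · simp [Set.indicator_of_notMem hs]
  induction m with
  | zero =>
    intro b C hb hC
    rw [hfub 0 (hInt 0 hb hC), intervalIntegral.integral_of_le hT]
    refine setIntegral_congr_fun measurableSet_Ioc fun s _ => ?_
    have h : cube 0 T = Set.univ := by ext t; simp [cube]
    simp [h, volume_pi, Measure.pi_of_empty _ Fin.elim0, chainIntegrand, nestedCommutator,
      chainDensity]
  | succ m ih =>
    intro b C hb hC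
    rw [hfub (m + 1) (hInt (m + 1) hb hC), intervalIntegral.integral_of_le hT]
    refine setIntegral_congr_fun measurableSet_Ioc fun s _ => ?_
    have hs : Measurable (ascentKernel x s) :=
      (measurable_ascentKernel x).comp (measurable_const.prodMk measurable_id)
    have hi := hInt m hs (abs_ascentKernel_le' x s)
    simp only [Fin.cons_zero, chainIntegrand_cons, chainDensity, integral_smul]
    rw [← ih hs (abs_ascentKernel_le' x s)]
    congr 1
    simp only [Ring.lie_def]
    rw [integral_sub (hi.const_mul (a s)) (hi.mul_const (a s)), integral_const_mul_of_integrable hi,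
      integral_mul_const_of_integrable hi]

/-- For decreasing times the condition t(σ(i+1)) < t(σ(i)) says that σ ascends at i. Each ascent
thus contributes 1 - x and each descent -x. -/
theorem chainIntegrand_perm {m : ℕ} {t : Fin (m + 1) → ℝ} (ht : Antitone t)
    (hinj : Function.Injective t) (x : ℝ) (σ : Equiv.Perm (Fin (m + 1))) :
    chainIntegrand a x m (t ∘ σ) =
      ((1 - x) ^ ascents σ * (-x) ^ (m - ascents σ)) •
        nestedCommutator m fun j => a (t (σ j)) := by
  have hs : StrictAnti t := ht.strictAnti_of_injective hinj
  rw [chainIntegrand]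
  congr 1
  have h1 : ∀ i : Fin m, ascentKernel x ((t ∘ σ) i.castSucc) ((t ∘ σ) i.succ) =
      if σ i.castSucc < σ i.succ then 1 - x else -x := by
    intro i
    simp only [ascentKernel, Function.comp_apply, hs.lt_iff_gt]
    split_ifs <;> simp
  have hasc : ascents σ = (Finset.univ.filter fun i : Fin m => σ i.castSucc < σ i.succ).card := by
    rw [ascents, Finset.card_filter]
  have h2 : (Finset.univ.filter fun i : Fin m => ¬ σ i.castSucc < σ i.succ).card =
      m - ascents σ := by
    have := Finset.card_filter_add_card_filter_not (s := (Finset.univ : Finset (Fin m)))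
      (fun i => σ i.castSucc < σ i.succ)
    rw [Finset.card_univ, Fintype.card_fin] at this
    omega
  simp only [h1]
  rw [Finset.prod_ite, Finset.prod_const, Finset.prod_const, ← hasc, h2]

/-- The chain integral over the cube is cut into simplices. The outcome is polynomial in `x` with
coefficients that do not involve `x`, so that a later integration over `x` is explicit. -/
theorem integral_chainDensity_eq_sum_perm (hT : 0 ≤ T) (x : ℝ)
    (ha : IntervalIntegrable a volume 0 T) (m : ℕ) :
    ∫ s in (0 : ℝ)..T, chainDensity a T x m s =
      ∑ σ : Equiv.Perm (Fin (m + 1)), ((1 - x) ^ ascents σ * (-x) ^ (m - ascents σ)) •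
        orderedIntegral (m + 1) T fun t => nestedCommutator m fun j => a (t (σ j)) := by
  have ha' := (intervalIntegrable_iff_integrableOn_Ioc_of_le hT).1 ha
  have h1 := setIntegral_cube_chainIntegrand hT x ha' m (b := fun _ => 1) (C := 1)
    measurable_const (by simp)
  simp only [one_smul] at h1
  rw [← h1, ← sum_perm_setIntegral_simplex (integrableOn_chainIntegrand m x ha')]
  refine Finset.sum_congr rfl fun σ _ => ?_
  rw [orderedIntegral_eq_setIntegral (m + 1) hT (integrableOn_nestedCommutator m ha' σ),
    ← integral_smul]
  refine setIntegral_congr_ae (measurableSet_simplex _ _) ?_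
  filter_upwards [ae_injective (m + 1)] with t ht hts
  exact chainIntegrand_perm hts.2 ht x σ

/-- The kernel picks the primitive of `f` that runs from -x∫f at time 0 to (1 - x)∫f at time T.
These two boundary values are the origin of the mixed left and right products below. -/
theorem integral_ascentKernel_smul {f : ℝ → A} (hT : 0 ≤ T)
    (hf : IntervalIntegrable f volume 0 T) (x : ℝ) :
    HasPrimitive T (fun t => ∫ s in (0 : ℝ)..T, ascentKernel x t s • f s) f
      (-(x • ∫ s in (0 : ℝ)..T, f s)) := by
  refine ⟨hf, fun t ht => ?_⟩
  have hf' := (intervalIntegrable_iff_integrableOn_Ioc_of_le hT).1 hf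
  rw [intervalIntegral.integral_of_le hT, intervalIntegral.integral_of_le hT,
    intervalIntegral.integral_of_le ht.1]
  have h1 : ∀ s, ascentKernel x t s • f s = (Set.Iio t).indicator f s - x • f s := by
    intro s
    by_cases h : s < t <;> simp [ascentKernel, h, sub_smul]
  have h3 : Set.Iio t ∩ Set.Ioc 0 T = Set.Ioo 0 t := by
    ext r; simp only [Set.mem_inter_iff, Set.mem_Iio, Set.mem_Ioc, Set.mem_Ioo]
    exact ⟨fun h => ⟨h.2.1, h.1⟩, fun h => ⟨h.2, h.1, h.2.le.trans ht.2⟩⟩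
  simp only [h1]
  rw [integral_sub (hf'.indicator measurableSet_Iio) (show Integrable (fun s => x • f s) _ from hf'.smul x),
    integral_smul,
    integral_indicator measurableSet_Iio, Measure.restrict_restrict measurableSet_Iio, h3,
    ← integral_Ioc_eq_integral_Ioo]
  abel

theorem intervalIntegrable_chainDensity (hT : 0 ≤ T) (x : ℝ)
    (ha : IntervalIntegrable a volume 0 T) (m : ℕ) :
    IntervalIntegrable (chainDensity a T x m) volume 0 T := by
  induction m with
  | zero => exact ha
  | succ m ih =>
    have hc := (integral_ascentKernel_smul hT ih x).continuousOn hT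
    exact (intervalIntegrable_mul_of_continuousOn hT ha hc).sub
      (intervalIntegrable_continuousOn_mul hT ha hc)

/-- This is `sum_mul_iteratedProd` at time T for the kernel primitives of the chain densities. In
generating functions, with w the series of the chain integrals and P that of the iterated products,
it reads (1 - x) w P + x P w = P'. -/
theorem sum_integral_chainDensity_mul (hT : 0 ≤ T) (x : ℝ)
    (ha : IntervalIntegrable a volume 0 T) (m : ℕ) :
    ∑ p ∈ Finset.HasAntidiagonal.antidiagonal m,
      ((1 - x) • ((∫ s in (0 : ℝ)..T, chainDensity a T x p.1 s) * iteratedProd a p.2 T) +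
        x • (iteratedProd a p.2 T * ∫ s in (0 : ℝ)..T, chainDensity a T x p.1 s)) =
      ((m : ℂ) + 1) • iteratedProd a (m + 1) T := by
  have hd := intervalIntegrable_chainDensity hT x ha
  have hy := fun m => integral_ascentKernel_smul hT (hd m) x
  have key := sum_mul_iteratedProd hT ha
    (y := fun m t => ∫ s in (0 : ℝ)..T, ascentKernel x t s • chainDensity a T x m s)
    (c := fun m => -(x • ∫ s in (0 : ℝ)..T, chainDensity a T x m s))
    (hy 0) (fun m => hy (m + 1)) m T ⟨hT, le_rfl⟩
  have hT' : ∀ m, ∫ s in (0 : ℝ)..T, ascentKernel x T s • chainDensity a T x m s =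
      (1 - x) • ∫ s in (0 : ℝ)..T, chainDensity a T x m s := by
    intro m
    rw [(hy m).eq T ⟨hT, le_rfl⟩, sub_smul, one_smul]
    abel
  simp only [hT'] at key
  rw [Finset.sum_add_distrib]
  rw [← Finset.Nat.sum_antidiagonal_swap (f := fun p : ℕ × ℕ =>
    x • (iteratedProd a p.2 T * ∫ s in (0 : ℝ)..T, chainDensity a T x p.1 s))]
  simp only [smul_mul_assoc, mul_neg, mul_smul_comm, Finset.sum_neg_distrib] at key
  simp only [Prod.fst_swap, Prod.snd_swap]
  rw [key]
  abel

theorem norm_integral_chainDensity_le (hT : 0 ≤ T) {x : ℝ} (hx : x ∈ Set.Icc (0 : ℝ) 1)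
    (ha : IntervalIntegrable a volume 0 T) (m : ℕ) :
    ‖∫ s in (0 : ℝ)..T, chainDensity a T x m s‖ ≤
      (∫ s in (0 : ℝ)..T, ‖a s‖) * (2 * ∫ s in (0 : ℝ)..T, ‖a s‖) ^ m := by
  set α := ∫ s in (0 : ℝ)..T, ‖a s‖ with hα
  have hα0 : 0 ≤ α := intervalIntegral.integral_nonneg hT fun _ _ => norm_nonneg _
  have key : ∀ m, ∫ s in (0 : ℝ)..T, ‖chainDensity a T x m s‖ ≤ α * (2 * α) ^ m := by
    intro m
    induction m with
    | zero => simp [chainDensity, hα]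
    | succ m ih =>
      have hd := intervalIntegrable_chainDensity hT x ha
      have h1 : ∀ t, ‖∫ r in (0 : ℝ)..T, ascentKernel x t r • chainDensity a T x m r‖ ≤
          α * (2 * α) ^ m := by
        intro t
        refine le_trans ?_ ih
        refine intervalIntegral.norm_integral_le_of_norm_le hT
          (Filter.Eventually.of_forall fun s _ => ?_) (hd m).norm
        rw [norm_smul]
        exact mul_le_of_le_one_left (norm_nonneg _) (abs_ascentKernel_le hx t s)
      calc ∫ s in (0 : ℝ)..T, ‖chainDensity a T x (m + 1) s‖
          ≤ ∫ s in (0 : ℝ)..T, ‖a s‖ * (2 * (α * (2 * α) ^ m)) := by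
            refine intervalIntegral.integral_mono_on hT (hd (m + 1)).norm
              (ha.norm.mul_const _) fun s _ => ?_
            refine (norm_lie_le _ _).trans ?_
            have := h1 s
            nlinarith [norm_nonneg (a s)]
        _ = α * (2 * α) ^ (m + 1) := by
            rw [intervalIntegral.integral_mul_const, ← hα]; ring
  exact (intervalIntegral.norm_integral_le_integral_norm hT).trans (key m)

end chain

/-! ### Power series with geometrically bounded coefficients -/

section powerSeries

variable {E : Type*} [NormedAddCommGroup E] [NormedSpace ℂ E]
  {c : ℕ → E} {C B : ℝ} {z : ℂ}

theorem norm_pow_smul_le (hc : ∀ m, ‖c m‖ ≤ C * B ^ m) (m : ℕ) :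
    ‖z ^ m • c m‖ ≤ C * (‖z‖ * B) ^ m := by
  rw [norm_smul, norm_pow, mul_pow]
  calc ‖z‖ ^ m * ‖c m‖ ≤ ‖z‖ ^ m * (C * B ^ m) := by gcongr; exact hc m
    _ = _ := by ring

theorem summable_norm_pow_smul (hB : 0 ≤ B) (hc : ∀ m, ‖c m‖ ≤ C * B ^ m) (hz : ‖z‖ * B < 1) :
    Summable fun m => ‖z ^ m • c m‖ :=
  Summable.of_nonneg_of_le (fun _ => norm_nonneg _) (norm_pow_smul_le hc)
    ((summable_geometric_of_lt_one (by positivity) hz).mul_left C)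

theorem exists_lt_mul_lt_one (hz : ‖z‖ * B < 1) : ∃ r, ‖z‖ < r ∧ r * B < 1 := by
  have h : Filter.Tendsto (fun r : ℝ => r * B) (nhdsWithin ‖z‖ (Set.Ioi ‖z‖))
      (nhds (‖z‖ * B)) :=
    ((continuous_id.mul continuous_const).tendsto _).mono_left nhdsWithin_le_nhds
  obtain ⟨r, hr⟩ := ((h.eventually (gt_mem_nhds hz)).and self_mem_nhdsWithin).exists
  exact ⟨r, hr.2, hr.1⟩

theorem hasDerivAt_tsum_pow_smul [CompleteSpace E] (hB : 0 ≤ B) (hc : ∀ m, ‖c m‖ ≤ C * B ^ m)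
    (hz : ‖z‖ * B < 1) :
    HasDerivAt (fun z : ℂ => ∑' m, z ^ m • c m) (∑' m : ℕ, z ^ m • (((m : ℂ) + 1) • c (m + 1))) z := by
  obtain ⟨r, hzr, hr⟩ := exists_lt_mul_lt_one hz
  have hr0 : 0 < r := (norm_nonneg z).trans_lt hzr
  have hC : 0 ≤ C := by simpa using (norm_nonneg _).trans (hc 0)
  have hu : Summable fun m : ℕ => (m : ℝ) * (r * B) ^ m * (C / r) := by
    have := summable_pow_mul_geometric_of_norm_lt_one 1 (r := r * B)
      (by rwa [Real.norm_of_nonneg (by positivity)])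
    simpa using this.mul_right (C / r)
  have h := hasDerivAt_tsum_of_isPreconnected (𝕜 := ℂ) (g := fun m z => z ^ m • c m)
    (g' := fun m z => ((m : ℂ) * z ^ (m - 1)) • c m) (t := Metric.ball 0 r) (y₀ := 0) (y := z)
    hu Metric.isOpen_ball (convex_ball 0 r).isPreconnected
    (fun m y _ => (hasDerivAt_pow m y).smul_const (c m)) ?_ (by simpa using hr0) ?_
    (by simpa using hzr)
  · convert h using 1
    have hs : Summable fun m : ℕ => ((m : ℂ) * z ^ (m - 1)) • c m := by
      refine Summable.of_norm_bounded hu fun m => ?_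
      cases m with
      | zero => simp
      | succ m =>
        simp only [Nat.add_sub_cancel, norm_smul, norm_mul, norm_pow, Complex.norm_natCast]
        calc _ ≤ ((m + 1 : ℕ) : ℝ) * r ^ m * (C * B ^ (m + 1)) := by
              gcongr; exact hc _
          _ = _ := by rw [mul_pow]; field_simp; ring
    rw [hs.tsum_eq_zero_add]
    simp only [Nat.cast_zero, zero_mul, zero_smul, zero_add, Nat.add_sub_cancel, smul_smul]
    refine tsum_congr fun m => ?_
    push_cast; congr 1; ring
  · intro m y hy
    have hy' : ‖y‖ < r := by simpa using hy
    cases m with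
    | zero => simp
    | succ m =>
      simp only [Nat.add_sub_cancel, norm_smul, norm_mul, norm_pow, Complex.norm_natCast]
      calc _ ≤ ((m + 1 : ℕ) : ℝ) * r ^ m * (C * B ^ (m + 1)) := by
            gcongr; exact hc _
        _ = _ := by rw [mul_pow]; field_simp; ring
  · refine summable_of_ne_finset_zero (s := {0}) fun m hm => ?_
    have : m ≠ 0 := by simpa using hm
    simp [this]

theorem norm_tsum_pow_smul_sub_sum_le [CompleteSpace E] (hB : 0 ≤ B)
    (hc : ∀ m, ‖c m‖ ≤ C * B ^ m) (hz : ‖z‖ * B ≤ 1 / 2) (N : ℕ) :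
    ‖∑' m, z ^ m • c m - ∑ m ∈ Finset.range N, z ^ m • c m‖ ≤ 2 * C * (‖z‖ * B) ^ N := by
  have hs := (summable_norm_pow_smul hB hc (hz.trans_lt (by norm_num)) (z := z)).of_norm
  have hC : 0 ≤ C := by simpa using (norm_nonneg _).trans (hc 0)
  rw [← hs.sum_add_tsum_nat_add N, add_sub_cancel_left]
  have hg : HasSum (fun m => C * (‖z‖ * B) ^ N * (‖z‖ * B) ^ m)
      (C * (‖z‖ * B) ^ N * (1 - ‖z‖ * B)⁻¹) :=
    (hasSum_geometric_of_lt_one (by positivity) (hz.trans_lt (by norm_num))).mul_left _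
  refine (tsum_of_norm_bounded hg fun m => ?_).trans ?_
  · refine (norm_pow_smul_le hc _).trans_eq ?_
    rw [pow_add]; ring
  · have : (1 - ‖z‖ * B)⁻¹ ≤ 2 := by
      rw [inv_le_comm₀ (by linarith) (by norm_num)]; linarith
    calc _ ≤ C * (‖z‖ * B) ^ N * 2 := by gcongr
      _ = _ := by ring

end powerSeries

/-! ### The logarithm of an element close to one -/

section logarithm

variable {A : Type*} [NormedRing A] [NormedAlgebra ℂ A] [CompleteSpace A]

/-- `log (1 + X) = ∑ (-1)^m X^{m+1} / (m+1)`. -/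
noncomputable def logOneAdd (X : A) : A :=
  ∑' m : ℕ, ((-1 : ℂ) ^ m / ((m : ℂ) + 1)) • X ^ (m + 1)

theorem exp_add_of_commute_complex {x y : A} (h : Commute x y) :
    NormedSpace.exp (x + y) = NormedSpace.exp x * NormedSpace.exp y :=
  letI := NormedAlgebra.restrictScalars ℚ ℂ A
  NormedSpace.exp_add_of_commute h

theorem hasDerivAt_exp_comp_of_commute {f : ℂ → A} {f' : A} {z : ℂ} (hf : HasDerivAt f f' z)
    (hcomm : ∀ w, Commute (f z) (f w)) :
    HasDerivAt (fun w => NormedSpace.exp (f w)) (NormedSpace.exp (f z) * f') z := by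
  have h1 : HasDerivAt (fun w => NormedSpace.exp (f w - f z)) f' z := by
    have h0 : HasFDerivAt (NormedSpace.exp : A → A) (1 : A →L[ℂ] A) (f z - f z) := by
      rw [sub_self]; exact hasFDerivAt_exp_zero
    have := h0.comp_hasDerivAt z (hf.sub_const (f z))
    rw [one_apply_eq_self] at this
    exact this
  have h2 := h1.const_mul (NormedSpace.exp (f z))
  refine h2.congr_of_eventuallyEq (Filter.Eventually.of_forall fun w => ?_)
  have hc : Commute (f z) (f w - f z) := (hcomm w).sub_right (Commute.refl _)
  simp only
  rw [← exp_add_of_commute_complex hc]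
  congr 1; abel

theorem norm_neg_one_pow_div_le (m : ℕ) : ‖(-1 : ℂ) ^ m / ((m : ℂ) + 1)‖ ≤ 1 := by
  have h : ‖(m : ℂ) + 1‖ = m + 1 := by
    rw [← Nat.cast_add_one, Complex.norm_natCast]; push_cast; rfl
  rw [norm_div, h]
  simp only [norm_pow, norm_neg, norm_one, one_pow]
  rw [div_le_one (by positivity)]
  linarith [(Nat.cast_nonneg m : (0 : ℝ) ≤ m)]

/-- With l(s) = log(1 + sX), the function exp(-l(s))(1 + sX) of the complex variable s has zero
derivative, because l'(s)(1 + sX) = X and everything commutes. Its value at s = 0 is 1. -/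
theorem exp_logOneAdd {X : A} (hX : ‖X‖ < 1) : NormedSpace.exp (logOneAdd X) = 1 + X := by
  set c : ℕ → A := fun m => match m with
    | 0 => 0
    | m + 1 => ((-1 : ℂ) ^ m / ((m : ℂ) + 1)) • X ^ (m + 1) with hc
  have hcb : ∀ m, ‖c m‖ ≤ 1 * ‖X‖ ^ m := by
    intro m
    cases m with
    | zero => simp [hc]
    | succ m =>
      simp only [hc, norm_smul]
      exact mul_le_mul (norm_neg_one_pow_div_le m) (norm_pow_le' X (Nat.succ_pos m))
        (norm_nonneg _) zero_le_one
  set l : ℂ → A := fun s => ∑' m, s ^ m • c m with hl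
  have hcX : ∀ m, Commute X (c m) := by
    intro m
    cases m with
    | zero => exact Commute.zero_right X
    | succ m => exact ((Commute.refl X).pow_right _).smul_right _
  -- A radius slightly above 1, so that s = 1 lies inside the open disc where the series converges.
  obtain ⟨r, hr1, hr⟩ := exists_lt_mul_lt_one (z := 1) (B := ‖X‖) (by simpa using hX)
  have hsum : ∀ s : ℂ, ‖s‖ < r → ‖s‖ * ‖X‖ < 1 := fun s hs =>
    (mul_le_mul_of_nonneg_right hs.le (norm_nonneg X)).trans_lt hr
  have hXl : ∀ s, Commute X (l s) := by
    intro s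
    by_cases h : Summable fun m => s ^ m • c m
    · exact (h.hasSum.mul_left X).unique (by
        simpa only [(((hcX _).smul_right _).eq)] using h.hasSum.mul_right X)
    · simp only [hl, tsum_eq_zero_of_not_summable h]; exact Commute.zero_right X
  have hll : ∀ s t, Commute (l s) (l t) := by
    intro s t
    have hct : ∀ m, Commute (c m) (l t) := by
      intro m
      cases m with
      | zero => exact Commute.zero_left _
      | succ m => exact ((hXl t).pow_left _).smul_left _
    by_cases h : Summable fun m => s ^ m • c m
    · exact (h.hasSum.mul_right (l t)).unique (by
        simpa only [(((hct _).smul_left _).eq)] using h.hasSum.mul_left (l t))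
    · simp only [hl, tsum_eq_zero_of_not_summable h]; exact Commute.zero_left _
  have hder : ∀ s : ℂ, ‖s‖ < r → HasDerivAt
      (fun s => NormedSpace.exp (-l s) * (1 + s • X)) 0 s := by
    intro s hs
    have h1 := hasDerivAt_tsum_pow_smul (norm_nonneg X) hcb (hsum s hs)
    have hgeo : (∑' m : ℕ, s ^ m • (((m : ℂ) + 1) • c (m + 1))) * (1 + s • X) = X := by
      have e : ∀ m : ℕ, s ^ m • (((m : ℂ) + 1) • c (m + 1)) = (-(s • X)) ^ m * X := by
        intro m
        have hm : (m : ℂ) + 1 ≠ 0 := Nat.cast_add_one_ne_zero m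
        rw [← neg_smul, smul_pow, neg_pow s m]
        simp only [hc, smul_smul, smul_mul_assoc, pow_succ X]
        congr 1; field_simp
      have hn : ‖-(s • X)‖ < 1 := by rw [norm_neg, norm_smul]; exact hsum s hs
      simp only [e]
      rw [(summable_geometric_of_norm_lt_one hn).tsum_mul_right, mul_assoc,
        show X * (1 + s • X) = (1 - -(s • X)) * X by
          rw [sub_neg_eq_add, mul_add, add_mul, mul_smul_comm, smul_mul_assoc, one_mul, mul_one],
        ← mul_assoc, geom_series_mul_neg _ hn, one_mul]
    have h2 := (hasDerivAt_exp_comp_of_commute h1.neg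
      fun w => ((hll s w).neg_left).neg_right).mul
        (((hasDerivAt_id s).smul_const X).const_add 1)
    have h3 : NormedSpace.exp (-l s) * -(∑' m : ℕ, s ^ m • (((m : ℂ) + 1) • c (m + 1))) *
        (1 + s • X) + NormedSpace.exp (-l s) * ((1 : ℂ) • X) = 0 := by
      rw [mul_neg, neg_mul, mul_assoc, hgeo, one_smul, neg_add_cancel]
    rw [← h3]
    exact h2
  have hconst : Set.EqOn (fun s => NormedSpace.exp (-l s) * (1 + s • X)) (fun _ => (1 : A))
      (Metric.ball (0 : ℂ) r) := by
    refine Metric.isOpen_ball.eqOn_of_deriv_eq (convex_ball (0 : ℂ) r).isPreconnected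
      (fun s hs => (hder s (by simpa using hs)).differentiableAt.differentiableWithinAt)
      (differentiableOn_const _) (fun s hs => ?_) (x := 0)
      (Metric.mem_ball_self ((norm_nonneg _).trans_lt hr1)) ?_
    · rw [(hder s (by simpa using hs)).deriv]; simp
    · have : l 0 = 0 := by
        simp only [hl]
        rw [tsum_eq_single 0 fun m hm => by simp [hm]]
        simp [hc]
      simp [this]
  have h1 := hconst (show (1 : ℂ) ∈ Metric.ball (0 : ℂ) r by simpa using hr1)
  have hl1 : l 1 = logOneAdd X := by
    have hs := (summable_norm_pow_smul (norm_nonneg X) hcb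
      (by simpa using hX : ‖(1 : ℂ)‖ * ‖X‖ < 1)).of_norm
    simp only [hl, logOneAdd]
    rw [hs.tsum_eq_zero_add]
    simp [hc]
  simp only [hl1, one_smul] at h1
  have h2 : NormedSpace.exp (logOneAdd X) * NormedSpace.exp (-logOneAdd X) = 1 := by
    rw [← exp_add_of_commute_complex ((Commute.refl _).neg_right), add_neg_cancel,
      NormedSpace.exp_zero]
  calc NormedSpace.exp (logOneAdd X)
      = NormedSpace.exp (logOneAdd X) * (NormedSpace.exp (-logOneAdd X) * (1 + X)) := by
        rw [h1, mul_one]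
    _ = 1 + X := by rw [← mul_assoc, h2, one_mul]

/-- Termwise differentiation. As `f z` and `f' z` need not commute, the derivative of each power is
a sum over the m + 1 positions of `f' z`, bounded by (m + 1) q^m K. -/
theorem hasDerivAt_logOneAdd_comp {f f' : ℂ → A} {r : ℝ}
    (hf : ∀ z, ‖z‖ < r → HasDerivAt f (f' z) z) {q K : ℝ} (hq : q < 1)
    (hfq : ∀ z, ‖z‖ < r → ‖f z‖ ≤ q) (hK : ∀ z, ‖z‖ < r → ‖f' z‖ ≤ K) (h0 : f 0 = 0)
    {z : ℂ} (hz : ‖z‖ < r) :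
    HasDerivAt (fun z => logOneAdd (f z))
      (∑' m : ℕ, ((-1 : ℂ) ^ m / ((m : ℂ) + 1)) •
        ∑ i ∈ Finset.range (m + 1), f z ^ (m - i) * f' z * f z ^ i) z := by
  have hr : 0 < r := (norm_nonneg z).trans_lt hz
  have hq0 : 0 ≤ q := by simpa [h0] using hfq 0 (by simpa using hr)
  have hK0 : 0 ≤ K := (norm_nonneg _).trans (hK z hz)
  have hnp : ∀ (x : A), ‖x‖ ≤ q → ∀ (y : A) (n : ℕ), ‖y * x ^ n‖ ≤ ‖y‖ * q ^ n := by
    intro x hx y n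
    induction n with
    | zero => simp
    | succ n ih =>
      rw [pow_succ, ← mul_assoc]
      calc _ ≤ ‖y * x ^ n‖ * ‖x‖ := norm_mul_le _ _
        _ ≤ (‖y‖ * q ^ n) * q := by gcongr
        _ = _ := by ring
  have hnp' : ∀ (x : A), ‖x‖ ≤ q → ∀ (y : A) (n : ℕ), ‖x ^ n * y‖ ≤ q ^ n * ‖y‖ := by
    intro x hx y n
    induction n with
    | zero => simp
    | succ n ih =>
      rw [pow_succ', mul_assoc]
      calc _ ≤ ‖x‖ * ‖x ^ n * y‖ := norm_mul_le _ _
        _ ≤ q * (q ^ n * ‖y‖) := by gcongr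
        _ = _ := by ring
  refine hasDerivAt_tsum_of_isPreconnected (𝕜 := ℂ) (u := fun m : ℕ => ((m : ℝ) * q ^ m + q ^ m) * K)
    (t := Metric.ball 0 r) (y₀ := 0) (g' := fun m z => ((-1 : ℂ) ^ m / ((m : ℂ) + 1)) •
        ∑ i ∈ Finset.range (m + 1), f z ^ (m - i) * f' z * f z ^ i)
    ?_ Metric.isOpen_ball (convex_ball 0 r).isPreconnected
    (fun m y hy => ?_) (fun m y hy => ?_) (by simpa using hr) ?_ (by simpa using hz)
  · have h1 := summable_pow_mul_geometric_of_norm_lt_one 1 (r := q)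
      (by rwa [Real.norm_of_nonneg hq0])
    simp only [pow_one] at h1
    exact (h1.add (summable_geometric_of_lt_one hq0 hq)).mul_right K
  · have := ((hf y (by simpa using hy)).fun_pow' (m + 1)).const_smul
      ((-1 : ℂ) ^ m / ((m : ℂ) + 1))
    exact this
  · have hy' : ‖y‖ < r := by simpa using hy
    rw [norm_smul]
    refine (mul_le_of_le_one_left (norm_nonneg _) (norm_neg_one_pow_div_le m)).trans ?_
    refine (norm_sum_le_of_le (Finset.range (m + 1)) (n := fun _ => q ^ m * K)
      fun i hi => ?_).trans_eq ?_
    · have him : i ≤ m := by simpa [Nat.lt_succ_iff] using hi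
      calc _ ≤ ‖f y ^ (m - i) * f' y‖ * q ^ i := hnp _ (hfq y hy') _ _
        _ ≤ (q ^ (m - i) * ‖f' y‖) * q ^ i := by gcongr; exact hnp' _ (hfq y hy') _ _
        _ ≤ (q ^ (m - i) * K) * q ^ i := by gcongr; exact hK y hy'
        _ = q ^ m * K := by
          rw [mul_right_comm, ← pow_add, Nat.sub_add_cancel him]
    · simp; ring
  · refine summable_of_ne_finset_zero (s := ∅) fun m _ => ?_
    simp [h0]

end logarithm

/-! ### The Magnus expansion as the logarithm of the Dyson series -/

theorem integral_pow_mul_one_sub_pow (i j : ℕ) :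
    ∫ x in (0 : ℝ)..1, x ^ i * (1 - x) ^ j =
      (i.factorial * j.factorial : ℝ) / (i + j + 1).factorial := by
  have h := Complex.Gamma_mul_Gamma_eq_betaIntegral (s := (i : ℂ) + 1) (t := (j : ℂ) + 1)
    (by simp; positivity) (by simp; positivity)
  rw [Complex.Gamma_nat_eq_factorial, Complex.Gamma_nat_eq_factorial,
    show (i : ℂ) + 1 + (j + 1) = ((i + j + 1 : ℕ) : ℂ) + 1 by push_cast; ring,
    Complex.Gamma_nat_eq_factorial, Complex.betaIntegral] at h
  have h2 : ∫ x in (0 : ℝ)..1, (x : ℂ) ^ ((i : ℂ) + 1 - 1) * (1 - (x : ℂ)) ^ ((j : ℂ) + 1 - 1) =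
      ((∫ x in (0 : ℝ)..1, x ^ i * (1 - x) ^ j : ℝ) : ℂ) := by
    rw [← intervalIntegral.integral_ofReal]
    refine intervalIntegral.integral_congr fun x _ => ?_
    simp [Complex.cpow_natCast]
  rw [h2] at h
  have h3 : ((i + j + 1).factorial : ℝ) ≠ 0 := by positivity
  rw [eq_div_iff h3, mul_comm]
  exact_mod_cast h.symm

section magnus

variable {A : Type*} [NormedRing A] [NormedAlgebra ℂ A] [CompleteSpace A]

/-- The operator `Y ↦ (1 - x) Y X + x X Y`. -/
noncomputable def mixedMul (X : A) (x : ℝ) : A →L[ℂ] A :=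
  ((1 - x : ℝ) : ℂ) • (ContinuousLinearMap.mul ℂ A).flip X +
    (x : ℂ) • ContinuousLinearMap.mul ℂ A X

theorem norm_mixedMul_le (X : A) {x : ℝ} (hx : x ∈ Set.Icc (0 : ℝ) 1) : ‖mixedMul X x‖ ≤ ‖X‖ := by
  refine ContinuousLinearMap.opNorm_le_bound _ (norm_nonneg _) fun Y => ?_
  simp only [mixedMul, add_apply, smul_apply,
    ContinuousLinearMap.flip_apply, ContinuousLinearMap.mul_apply']
  refine (norm_add_le _ _).trans ?_
  rw [norm_smul, norm_smul, Complex.norm_of_nonneg (by linarith [hx.2]),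
    Complex.norm_of_nonneg hx.1]
  have h1 := mul_le_mul_of_nonneg_left (norm_mul_le Y X) (by linarith [hx.2] : 0 ≤ 1 - x)
  have h2 := mul_le_mul_of_nonneg_left (norm_mul_le X Y) hx.1
  nlinarith

/-- Left and right multiplication by `X` commute, so the binomial theorem applies. -/
theorem mixedMul_pow_apply (X Y : A) (x : ℝ) (j : ℕ) :
    (mixedMul X x ^ j) Y = ∑ i ∈ Finset.range (j + 1),
      (((1 - x) ^ i * x ^ (j - i) * (j.choose i) : ℝ) : ℂ) • (X ^ (j - i) * Y * X ^ i) := by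
  have hc : Commute ((ContinuousLinearMap.mul ℂ A).flip X) (ContinuousLinearMap.mul ℂ A X) := by
    ext Y; simp [mul_assoc]
  have hR : ∀ (i : ℕ) (Y : A), ((ContinuousLinearMap.mul ℂ A).flip X ^ i) Y = Y * X ^ i := by
    intro i
    induction i with
    | zero => simp
    | succ i ih => intro Y; rw [pow_succ]; simp [ih, pow_succ', mul_assoc]
  have hL : ∀ (i : ℕ) (Y : A), (ContinuousLinearMap.mul ℂ A X ^ i) Y = X ^ i * Y := by
    intro i
    induction i with
    | zero => simp
    | succ i ih => intro Y; rw [pow_succ]; simp [ih, pow_succ, mul_assoc]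
  rw [mixedMul, ((hc.smul_left _).smul_right _).add_pow, sum_apply]
  refine Finset.sum_congr rfl fun i _ => ?_
  rw [← nsmul_eq_mul', smul_apply, smul_pow, smul_pow, smul_mul_smul_comm,
    smul_apply, mul_apply_eq_comp, hL, hR,
    ← Nat.cast_smul_eq_nsmul ℂ, smul_smul]
  push_cast
  congr 1; ring

/-- The Beta integral cancels the binomial coefficient, so all positions of `Y` receive the same
weight 1/(j + 1). This is the pattern of the derivative of X^{j+1}/(j + 1). -/
theorem integral_mixedMul_pow_apply (X Y : A) (j : ℕ) :
    ∫ x in (0 : ℝ)..1, (mixedMul X x ^ j) Y =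
      ((j : ℂ) + 1)⁻¹ • ∑ i ∈ Finset.range (j + 1), X ^ (j - i) * Y * X ^ i := by
  simp only [mixedMul_pow_apply]
  rw [intervalIntegral.integral_finsetSum fun i _ => Continuous.intervalIntegrable
    (by fun_prop) _ _, Finset.smul_sum]
  refine Finset.sum_congr rfl fun i hi => ?_
  have him : i ≤ j := by simpa [Nat.lt_succ_iff] using hi
  rw [intervalIntegral.integral_smul_const, intervalIntegral.integral_ofReal]
  congr 1
  have h1 : ∫ x in (0 : ℝ)..1, (1 - x) ^ i * x ^ (j - i) * (j.choose i : ℝ) =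
      ((j : ℝ) + 1)⁻¹ := by
    rw [intervalIntegral.integral_mul_const]
    have := integral_pow_mul_one_sub_pow (j - i) i
    simp only [mul_comm (_ ^ (j - i))] at this
    rw [this, Nat.sub_add_cancel him, Nat.choose_eq_factorial_div_factorial him,
      Nat.cast_div (Nat.factorial_mul_factorial_dvd_factorial him) (by positivity),
      Nat.factorial_succ]
    push_cast
    field_simp
  rw [h1]; push_cast; rfl

theorem hasSum_neg_pow_apply {N : A →L[ℂ] A} (hN : ‖N‖ < 1) {W Y : A} (h : W + N W = Y) :
    HasSum (fun j : ℕ => ((-N) ^ j) Y) W := by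
  have hn : ‖-N‖ < 1 := by rwa [norm_neg]
  have hs := (summable_geometric_of_norm_lt_one hn).hasSum
  have h1 : HasSum (fun j : ℕ => ((-N) ^ j) Y) ((∑' j : ℕ, (-N) ^ j) Y) :=
    (ContinuousLinearMap.apply ℂ A Y).hasSum hs
  have h2 : (∑' j : ℕ, (-N) ^ j) Y = W := by
    have := congrArg (fun F : A →L[ℂ] A => F W) (geom_series_mul_neg _ hn)
    rw [sub_neg_eq_add] at this
    simp only [mul_apply_eq_comp, one_apply_eq_self, add_comm (1 : A →L[ℂ] A)] at this
    rw [← h, add_comm W]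
    exact this
  rwa [h2] at h1

theorem hasSum_intervalIntegral_of_norm_le {F : ℕ → ℝ → A} {f : ℝ → A} {u : ℕ → ℝ}
    (hF : ∀ j, Continuous (F j)) (hu : Summable u)
    (hFu : ∀ j, ∀ x ∈ Set.Icc (0 : ℝ) 1, ‖F j x‖ ≤ u j)
    (hf : ∀ x ∈ Set.Icc (0 : ℝ) 1, HasSum (fun j => F j x) (f x)) :
    HasSum (fun j => ∫ x in (0 : ℝ)..1, F j x) (∫ x in (0 : ℝ)..1, f x) := by
  have hmem : ∀ x, x ∈ Set.uIoc (0 : ℝ) 1 → x ∈ Set.Icc (0 : ℝ) 1 := fun x hx => by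
    rw [Set.uIoc_of_le zero_le_one] at hx; exact ⟨hx.1.le, hx.2⟩
  exact intervalIntegral.hasSum_integral_of_dominated_convergence (fun j _ => u j)
    (fun j => (hF j).aestronglyMeasurable)
    (fun j => Filter.Eventually.of_forall fun x hx => hFu j x (hmem x hx))
    (Filter.Eventually.of_forall fun _ _ => hu) (by simp)
    (Filter.Eventually.of_forall fun x hx => hf x (hmem x hx))

variable {P : ℕ → A} {w : ℕ → ℝ → A} {C B : ℝ}

theorem tsum_chain_relation {z : ℂ} {x : ℝ} (hB : 0 ≤ B) (hP : ∀ m, ‖P m‖ ≤ C * B ^ m)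
    (hw : ∀ m, ‖w m x‖ ≤ C * B ^ m) (hz : ‖z‖ * B < 1)
    (hE : ∀ m, ∑ p ∈ Finset.HasAntidiagonal.antidiagonal m,
      ((1 - x) • (w p.1 x * P p.2) + x • (P p.2 * w p.1 x)) = ((m : ℂ) + 1) • P (m + 1)) :
    (1 - x) • ((∑' m, z ^ m • w m x) * ∑' m, z ^ m • P m) +
      x • ((∑' m, z ^ m • P m) * ∑' m, z ^ m • w m x) =
        ∑' m : ℕ, z ^ m • (((m : ℂ) + 1) • P (m + 1)) := by
  have sP := summable_norm_pow_smul hB hP hz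
  have sw := summable_norm_pow_smul hB hw hz
  have s1 := (summable_norm_sum_mul_antidiagonal_of_summable_norm sw sP).of_norm
  have s2 := (summable_norm_sum_mul_antidiagonal_of_summable_norm sP sw).of_norm
  rw [tsum_mul_tsum_eq_tsum_sum_antidiagonal_of_summable_norm sw sP,
    tsum_mul_tsum_eq_tsum_sum_antidiagonal_of_summable_norm sP sw,
    ← s1.tsum_const_smul, ← s2.tsum_const_smul,
    ← (s1.const_smul (1 - x)).tsum_add (s2.const_smul x)]
  refine tsum_congr fun m => ?_
  rw [← hE m, Finset.sum_add_distrib, smul_add]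
  have e1 : ∀ p ∈ Finset.HasAntidiagonal.antidiagonal m,
      z ^ p.1 • w p.1 x * z ^ p.2 • P p.2 = z ^ m • (w p.1 x * P p.2) := by
    intro p hp
    rw [smul_mul_smul_comm, ← pow_add, Finset.HasAntidiagonal.mem_antidiagonal.1 hp]
  have e2 : ∀ p ∈ Finset.HasAntidiagonal.antidiagonal m,
      z ^ p.1 • P p.1 * z ^ p.2 • w p.2 x = z ^ m • (P p.1 * w p.2 x) := by
    intro p hp
    rw [smul_mul_smul_comm, ← pow_add, Finset.HasAntidiagonal.mem_antidiagonal.1 hp]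
  rw [Finset.sum_congr rfl e1, Finset.sum_congr rfl e2,
    ← Finset.Nat.sum_antidiagonal_swap (f := fun p : ℕ × ℕ => x • (P p.2 * w p.1 x))]
  simp only [Finset.smul_sum, Prod.fst_swap, Prod.snd_swap, smul_comm x, smul_comm (1 - x)]

/-- For fixed x the relation between the chains and P says w + N w = Y, where N = `mixedMul X x` has
norm at most ‖X‖ < 1. The Neumann series for w may be integrated over x term by term, and
`integral_mixedMul_pow_apply` identifies the outcome with the derivative of log(1 + X). -/
theorem hasSum_integral_chain {z : ℂ} (hB : 0 ≤ B) (hP : ∀ m, ‖P m‖ ≤ C * B ^ m)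
    (hw : ∀ m, ∀ x ∈ Set.Icc (0 : ℝ) 1, ‖w m x‖ ≤ C * B ^ m) (hwc : ∀ m, Continuous (w m))
    (hz : ‖z‖ * B < 1)
    (hE : ∀ m, ∀ x ∈ Set.Icc (0 : ℝ) 1, ∑ p ∈ Finset.HasAntidiagonal.antidiagonal m,
      ((1 - x) • (w p.1 x * P p.2) + x • (P p.2 * w p.1 x)) = ((m : ℂ) + 1) • P (m + 1))
    {X Y : A} (hX : X = ∑' m, z ^ m • P m - 1) (hX1 : ‖X‖ < 1)
    (hY : Y = ∑' m : ℕ, z ^ m • (((m : ℂ) + 1) • P (m + 1))) :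
    ∑' m : ℕ, z ^ m • (∫ x in (0 : ℝ)..1, w m x) =
      ∑' m : ℕ, ((-1 : ℂ) ^ m / ((m : ℂ) + 1)) •
        ∑ i ∈ Finset.range (m + 1), X ^ (m - i) * Y * X ^ i := by
  have hC : 0 ≤ C := by simpa using (norm_nonneg _).trans (hP 0)
  have h1 : HasSum (fun m => ∫ x in (0 : ℝ)..1, z ^ m • w m x)
      (∫ x in (0 : ℝ)..1, ∑' m, z ^ m • w m x) := by
    refine hasSum_intervalIntegral_of_norm_le (fun m => (hwc m).const_smul _)
      ((summable_geometric_of_lt_one (by positivity) hz).mul_left C) (fun m x hx => ?_)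
      fun x hx => ((summable_norm_pow_smul hB (fun m => hw m x hx) hz).of_norm).hasSum
    rw [norm_smul, norm_pow]
    calc _ ≤ ‖z‖ ^ m * (C * B ^ m) := by gcongr; exact hw m x hx
      _ = _ := by ring
  have h2 : HasSum (fun j : ℕ => ∫ x in (0 : ℝ)..1, ((-mixedMul X x) ^ j) Y)
      (∫ x in (0 : ℝ)..1, ∑' m, z ^ m • w m x) := by
    have hcont : ∀ j : ℕ, Continuous fun x : ℝ => ((-mixedMul X x) ^ j) Y := by
      intro j
      simp only [neg_pow (mixedMul X _) j]
      have : ∀ x, ((-1 : A →L[ℂ] A) ^ j * mixedMul X x ^ j) Y =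
          ((-1 : A →L[ℂ] A) ^ j) ((mixedMul X x ^ j) Y) := fun x => rfl
      simp only [this, mixedMul_pow_apply]
      refine ContinuousLinearMap.continuous _ |>.comp ?_
      fun_prop
    refine hasSum_intervalIntegral_of_norm_le hcont
      ((summable_geometric_of_lt_one (norm_nonneg X) hX1).mul_right ‖Y‖) (fun j x hx => ?_)
      fun x hx => ?_
    · refine (ContinuousLinearMap.le_opNorm _ _).trans ?_
      gcongr
      cases j with
      | zero => rw [pow_zero, pow_zero]; exact ContinuousLinearMap.norm_id_le
      | succ j =>
        refine (norm_pow_le' _ j.succ_pos).trans ?_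
        gcongr
        rw [norm_neg]; exact norm_mixedMul_le X hx
    · refine hasSum_neg_pow_apply ((norm_mixedMul_le X hx).trans_lt hX1) ?_
      have := tsum_chain_relation (x := x) hB hP (fun m => hw m x hx) hz fun m => hE m x hx
      rw [hY, ← this, show ∑' m, z ^ m • P m = 1 + X by rw [hX]; abel]
      simp only [mixedMul, add_apply, smul_apply,
        ContinuousLinearMap.flip_apply, ContinuousLinearMap.mul_apply', Complex.coe_smul,
        mul_add, add_mul, mul_one, one_mul, smul_add]
      module
  simp only [intervalIntegral.integral_smul] at h1
  rw [h1.tsum_eq, ← h2.tsum_eq]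
  refine tsum_congr fun j => ?_
  have e : ∀ x (j : ℕ) (Z : A), ((-mixedMul X x) ^ j) Z = ((-1 : ℂ) ^ j) • (mixedMul X x ^ j) Z := by
    intro x j
    induction j with
    | zero => simp
    | succ j ih =>
      intro Z
      rw [pow_succ, pow_succ (mixedMul X x)]
      change ((-mixedMul X x) ^ j) (-(mixedMul X x Z)) = _ • (mixedMul X x ^ j) (mixedMul X x Z)
      rw [ih, map_neg, pow_succ, mul_neg_one, neg_smul, smul_neg]
  simp only [e]
  rw [intervalIntegral.integral_smul, integral_mixedMul_pow_apply, smul_smul, div_eq_mul_inv]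

end magnus

/-! ### The Magnus coefficients are the Taylor coefficients of the logarithm. -/

section magnus

variable {A : Type*} [NormedRing A] [NormedAlgebra ℂ A] [CompleteSpace A]

/-- The power series with coefficients (m + 1)⁻¹ ∫ w_m and log P(z) have equal derivatives near 0
and both vanish at 0. Hence the full series exponentiates to P(z) on a small disc, and truncation
changes the exponent by O(z^{N+1}). -/
theorem exp_sub_tsum_isBigO {P : ℕ → A} {w : ℕ → ℝ → A} {C B : ℝ} (hB : 1 ≤ B) (hP0 : P 0 = 1)
    (hP : ∀ m, ‖P m‖ ≤ C * B ^ m)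
    (hw : ∀ m, ∀ x ∈ Set.Icc (0 : ℝ) 1, ‖w m x‖ ≤ C * B ^ m) (hwc : ∀ m, Continuous (w m))
    (hE : ∀ m, ∀ x ∈ Set.Icc (0 : ℝ) 1, ∑ p ∈ Finset.HasAntidiagonal.antidiagonal m,
      ((1 - x) • (w p.1 x * P p.2) + x • (P p.2 * w p.1 x)) = ((m : ℂ) + 1) • P (m + 1))
    (N : ℕ) :
    (fun z : ℂ => NormedSpace.exp (∑ m ∈ Finset.range N,
        z ^ (m + 1) • (((m : ℂ) + 1)⁻¹ • ∫ x in (0 : ℝ)..1, w m x)) - ∑' m, z ^ m • P m)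
      =O[nhds 0] fun z => z ^ (N + 1) := by
  have hB0 : 0 ≤ B := zero_le_one.trans hB
  have hC : 0 ≤ C := by simpa using (norm_nonneg _).trans (hP 0)
  -- Small enough that ‖P(z) - 1‖ ≤ 2C‖z‖B ≤ 1/2 on the disc, which makes both the logarithm and the
  -- Neumann series converge.
  set r : ℝ := 1 / (4 * (C + 1) * B) with hr
  have hr0 : 0 < r := by positivity
  have hrB : r * B ≤ 1 / 4 := by
    rw [hr]; field_simp; linarith
  have hrC : 2 * C * (r * B) ≤ 1 / 2 := by
    rw [hr]; field_simp; linarith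
  have hzB : ∀ z : ℂ, ‖z‖ < r → ‖z‖ * B ≤ 1 / 4 := fun z hz =>
    (mul_le_mul_of_nonneg_right hz.le hB0).trans hrB
  have hzB1 : ∀ z : ℂ, ‖z‖ < r → ‖z‖ * B < 1 := fun z hz => (hzB z hz).trans_lt (by norm_num)
  set X : ℂ → A := fun z => ∑' m, z ^ m • P m - 1 with hX
  set Y : ℂ → A := fun z => ∑' m : ℕ, z ^ m • (((m : ℂ) + 1) • P (m + 1)) with hY
  have hXd : ∀ z, ‖z‖ < r → HasDerivAt X (Y z) z := fun z hz =>
    (hasDerivAt_tsum_pow_smul hB0 hP (hzB1 z hz)).sub_const 1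
  have hX1 : ∀ z, ‖z‖ < r → ‖X z‖ ≤ 1 / 2 := by
    intro z hz
    have := norm_tsum_pow_smul_sub_sum_le hB0 hP ((hzB z hz).trans (by norm_num)) 1 (z := z)
    simp only [Finset.range_one, Finset.sum_singleton, pow_zero, one_smul, hP0, pow_one] at this
    refine this.trans (le_trans ?_ hrC)
    gcongr
  have hY1 : ∀ z, ‖z‖ < r → ‖Y z‖ ≤ 2 * (C * B) := by
    intro z hz
    have hc : ∀ m : ℕ, ‖((m : ℂ) + 1) • P (m + 1)‖ ≤ C * B * (2 * B) ^ m := by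
      intro m
      have h2 : ((m : ℝ) + 1) ≤ 2 ^ m := by
        exact_mod_cast Nat.lt_two_pow_self (n := m)
      rw [norm_smul, ← Nat.cast_add_one, Complex.norm_natCast]
      push_cast
      calc _ ≤ (2 : ℝ) ^ m * (C * B ^ (m + 1)) := by gcongr; exact hP _
        _ = _ := by rw [mul_pow]; ring
    have := norm_tsum_pow_smul_sub_sum_le (by positivity) hc
      (by have := hzB z hz; linarith : ‖z‖ * (2 * B) ≤ 1 / 2) 0 (z := z)
    simpa using this
  have hX0 : X 0 = 0 := by
    simp only [hX]
    rw [tsum_eq_single 0 fun m hm => by simp [hm]]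
    simp [hP0]
  set c : ℕ → A := fun m => match m with
    | 0 => 0
    | m + 1 => ((m : ℂ) + 1)⁻¹ • ∫ x in (0 : ℝ)..1, w m x with hc
  have hcb : ∀ m, ‖c m‖ ≤ C * B ^ m := by
    intro m
    cases m with
    | zero => simpa [hc] using hC
    | succ m =>
      have h1 : ‖∫ x in (0 : ℝ)..1, w m x‖ ≤ C * B ^ m := by
        have := intervalIntegral.norm_integral_le_of_norm_le_const (a := (0 : ℝ)) (b := 1)
          (f := w m) (C := C * B ^ m) fun x hx => hw m x (by
            rw [Set.uIoc_of_le zero_le_one] at hx; exact ⟨hx.1.le, hx.2⟩)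
        simpa using this
      have h2 : ‖((m : ℂ) + 1)⁻¹‖ ≤ 1 := by
        rw [norm_inv, ← Nat.cast_add_one, Complex.norm_natCast]
        exact inv_le_one_of_one_le₀ (by push_cast; linarith [(Nat.cast_nonneg m : (0 : ℝ) ≤ m)])
      simp only [hc, norm_smul]
      calc _ ≤ 1 * (C * B ^ m) := by gcongr
        _ ≤ C * B ^ (m + 1) := by
          rw [one_mul, pow_succ]
          exact mul_le_mul_of_nonneg_left (le_mul_of_one_le_right (by positivity) hB) hC
  have hlog : Set.EqOn (fun z => ∑' m, z ^ m • c m) (fun z => logOneAdd (X z))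
      (Metric.ball (0 : ℂ) r) := by
    have hd1 := fun z (hz : ‖z‖ < r) => hasDerivAt_tsum_pow_smul hB0 hcb (hzB1 z hz)
    have hd2 := fun z (hz : ‖z‖ < r) => hasDerivAt_logOneAdd_comp hXd (by norm_num : (1 : ℝ) / 2 < 1)
      hX1 hY1 hX0 hz
    refine Metric.isOpen_ball.eqOn_of_deriv_eq (convex_ball (0 : ℂ) r).isPreconnected
      (fun z hz => (hd1 z (by simpa using hz)).differentiableAt.differentiableWithinAt)
      (fun z hz => (hd2 z (by simpa using hz)).differentiableAt.differentiableWithinAt)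
      (fun z hz => ?_) (x := 0) (Metric.mem_ball_self hr0) ?_
    · have hz' : ‖z‖ < r := by simpa using hz
      rw [(hd1 z hz').deriv, (hd2 z hz').deriv,
        ← hasSum_integral_chain hB0 hP hw hwc (hzB1 z hz') hE (X := X z) (Y := Y z) rfl
          ((hX1 z hz').trans_lt (by norm_num)) rfl]
      refine tsum_congr fun m => ?_
      simp only [hc, smul_smul]
      rw [mul_inv_cancel₀ (Nat.cast_add_one_ne_zero m), mul_one]
    · simp only [hX0]
      rw [tsum_eq_single 0 fun m hm => by simp [hm]]
      simp [hc, logOneAdd]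
  have hexp : ∀ z : ℂ, ‖z‖ < r →
      NormedSpace.exp (∑' m, z ^ m • c m) = ∑' m, z ^ m • P m := by
    intro z hz
    have h1 := hlog (show z ∈ Metric.ball (0 : ℂ) r by simpa using hz)
    simp only at h1
    rw [h1, exp_logOneAdd ((hX1 z hz).trans_lt (by norm_num))]
    simp [hX]
  set S : ℂ → A := fun z => ∑ m ∈ Finset.range N,
    z ^ (m + 1) • (((m : ℂ) + 1)⁻¹ • ∫ x in (0 : ℝ)..1, w m x) with hS
  have hS' : ∀ z, S z = ∑ m ∈ Finset.range (N + 1), z ^ m • c m := by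
    intro z
    rw [Finset.sum_range_succ']
    simp [hc, hS]
  have hdiff : (fun z : ℂ => S z - ∑' m, z ^ m • c m) =O[nhds 0] fun z => z ^ (N + 1) := by
    refine Asymptotics.IsBigO.of_bound (2 * C * B ^ (N + 1)) ?_
    filter_upwards [Metric.ball_mem_nhds (0 : ℂ) hr0] with z hz
    have hz' : ‖z‖ < r := by simpa using hz
    rw [norm_sub_rev, hS']
    refine (norm_tsum_pow_smul_sub_sum_le hB0 hcb
      ((hzB z hz').trans (by norm_num)) (N + 1)).trans_eq ?_
    rw [norm_pow, mul_pow]; ring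
  have ht1 : Filter.Tendsto S (nhds 0) (nhds 0) := by
    have : Continuous S := by fun_prop
    simpa [hS] using this.tendsto 0
  have ht2 : Filter.Tendsto (fun z : ℂ => ∑' m, z ^ m • c m) (nhds 0) (nhds 0) := by
    have h1 := (hasDerivAt_tsum_pow_smul hB0 hcb (hzB1 0 (by simpa using hr0))).continuousAt.tendsto
    have h2 : ∑' m, (0 : ℂ) ^ m • c m = 0 := by
      rw [tsum_eq_single 0 fun m hm => by simp [hm]]
      simp [hc]
    rwa [h2] at h1
  -- Strict differentiability of exp at 0 gives exp u - exp v = O(u - v) for u, v near 0, even when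
  -- u and v do not commute.
  have hstrict := (hasStrictFDerivAt_exp_zero (𝕂 := ℂ) (𝔸 := A)).isBigO_sub
  have hcomp := hstrict.comp_tendsto (ht1.prodMk_nhds ht2)
  refine Asymptotics.IsBigO.trans (Filter.EventuallyEq.trans_isBigO ?_ hcomp) hdiff
  filter_upwards [Metric.ball_mem_nhds (0 : ℂ) hr0] with z hz
  simp only [Function.comp_apply]
  rw [hexp z (by simpa using hz)]

/-- The coefficients of the logarithm of the time-ordered exponential of `a`. -/
noncomputable def magnusCoeff (a : ℝ → A) (T : ℝ) (m : ℕ) : A :=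
  ((m : ℂ) + 1)⁻¹ • ∫ x in (0 : ℝ)..1, ∫ s in (0 : ℝ)..T, chainDensity a T x m s

/-- Since `f` is only integrable, the power rule is read off from `sum_mul_iteratedProd` in the
commutative algebra ℂ. There the commutators vanish and the identity becomes (m + 1) P_{m+1} = (∫f)
P_m. -/
theorem integral_mul_pow_div_factorial {f : ℝ → ℝ} {T : ℝ} (hT : 0 ≤ T)
    (hf : IntervalIntegrable f volume 0 T) (m : ℕ) {t : ℝ} (ht : t ∈ Set.Icc 0 T) :
    ∫ s in (0 : ℝ)..t, f s * ((∫ r in (0 : ℝ)..s, f r) ^ m / m.factorial) =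
      (∫ s in (0 : ℝ)..t, f s) ^ (m + 1) / (m + 1).factorial := by
  set g : ℝ → ℂ := fun s => (f s : ℂ) with hg
  have hgi : IntervalIntegrable g volume 0 T := ⟨hf.1.ofReal, hf.2.ofReal⟩
  have hprim : HasPrimitive T (fun t => ∫ s in (0 : ℝ)..t, g s) g 0 :=
    ⟨hgi, fun t _ => by simp⟩
  have key := sum_mul_iteratedProd hT hgi
    (y := fun m t => match m with
      | 0 => ∫ s in (0 : ℝ)..t, g s
      | _ + 1 => 0) (c := fun _ => 0) hprim
    (fun m => by
      simp only [mul_comm (g _), sub_self]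
      exact HasPrimitive.const T 0)
  have hP : ∀ m, ∀ t ∈ Set.Icc 0 T, iteratedProd g m t =
      (((∫ s in (0 : ℝ)..t, f s) ^ m / m.factorial : ℝ) : ℂ) := by
    intro m
    induction m with
    | zero => intro t _; simp [iteratedProd]
    | succ m ih =>
      intro t ht
      have h1 := key m t ht
      have h2 : ∑ p ∈ Finset.HasAntidiagonal.antidiagonal m, (match p.1 with
          | 0 => ∫ s in (0 : ℝ)..t, g s
          | _ + 1 => (0 : ℂ)) * iteratedProd g p.2 t =
          (∫ s in (0 : ℝ)..t, g s) * iteratedProd g m t := by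
        rw [Finset.sum_eq_single (0, m)]
        · rintro ⟨i, j⟩ hp hne
          cases i with
          | zero =>
            have : j = m := by simpa using hp
            exact absurd (by rw [this]) hne
          | succ i => simp
        · simp
      have h4 : ∫ s in (0 : ℝ)..t, g s = ((∫ s in (0 : ℝ)..t, f s : ℝ) : ℂ) :=
        intervalIntegral.integral_ofReal
      rw [h2, ih t ht, h4] at h1
      simp only [mul_zero, Finset.sum_const_zero, add_zero, smul_eq_mul] at h1
      have hm : (m : ℂ) + 1 ≠ 0 := Nat.cast_add_one_ne_zero m
      rw [← mul_right_inj' hm, ← h1, Nat.factorial_succ]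
      push_cast
      field_simp
      ring
  have h := hP (m + 1) t ht
  rw [iteratedProd] at h
  have h3 : ∫ s in (0 : ℝ)..t, g s * iteratedProd g m s = ((∫ s in (0 : ℝ)..t,
      f s * ((∫ r in (0 : ℝ)..s, f r) ^ m / m.factorial) : ℝ) : ℂ) := by
    rw [← intervalIntegral.integral_ofReal]
    refine intervalIntegral.integral_congr fun s hs => ?_
    rw [Set.uIcc_of_le ht.1] at hs
    simp only [hP m s ⟨hs.1, hs.2.trans ht.2⟩]
    push_cast; rfl
  rw [h3] at h
  exact_mod_cast h

variable {a : ℝ → A} {T : ℝ}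

/-- The Picard iteration bound. The exponent `p` records where the iteration starts: 0 for the Dyson
terms, 1 for the logarithmic derivative, whose first term is already an integral. -/
theorem norm_le_pow_div_factorial (hT : 0 ≤ T) (ha : IntervalIntegrable a volume 0 T)
    {F : ℕ → ℝ → A} {G : ℕ → ℝ → A} {K L : ℝ} (hL : 0 ≤ L) {p : ℕ}
    (h0 : ∀ t ∈ Set.Icc 0 T,
      ‖F 0 t‖ ≤ K * ((∫ s in (0 : ℝ)..t, ‖a s‖) ^ p / p.factorial))
    (hF : ∀ m, ∀ t ∈ Set.Icc 0 T, F (m + 1) t = ∫ s in (0 : ℝ)..t, G m s)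
    (hG : ∀ m t, ‖G m t‖ ≤ L * ‖a t‖ * ‖F m t‖) (m : ℕ) :
    ∀ t ∈ Set.Icc 0 T, ‖F m t‖ ≤
      K * L ^ m * ((∫ s in (0 : ℝ)..t, ‖a s‖) ^ (m + p) / (m + p).factorial) := by
  induction m with
  | zero => intro t ht; simpa using h0 t ht
  | succ m ih =>
    intro t ht
    have hn := ha.norm
    have hc : ContinuousOn (fun t => ∫ s in (0 : ℝ)..t, ‖a s‖) (Set.Icc 0 T) :=
      (HasPrimitive.mk (c := 0) hn fun t _ => by simp).continuousOn hT
    rw [hF m t ht]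
    refine (intervalIntegral.norm_integral_le_of_norm_le ht.1
      (g := fun s => K * L ^ (m + 1) *
        (‖a s‖ * ((∫ r in (0 : ℝ)..s, ‖a r‖) ^ (m + p) / (m + p).factorial)))
      (Filter.Eventually.of_forall fun s hs => ?_) ?_).trans_eq ?_
    · refine (hG m s).trans ?_
      have := ih s ⟨hs.1.le, hs.2.trans ht.2⟩
      calc _ ≤ L * ‖a s‖ * (K * L ^ m *
            ((∫ r in (0 : ℝ)..s, ‖a r‖) ^ (m + p) / (m + p).factorial)) := by gcongr
        _ = _ := by ring
    · refine IntervalIntegrable.const_mul ?_ _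
      refine intervalIntegrable_of_mem_Icc ?_ ht
      exact hn.mul_continuousOn (by
        rw [Set.uIcc_of_le hT]; exact (hc.pow _).div_const _)
    · rw [intervalIntegral.integral_const_mul, integral_mul_pow_div_factorial hT hn _ ht,
        Nat.add_right_comm]

theorem norm_iteratedProd_le (hT : 0 ≤ T) (ha : IntervalIntegrable a volume 0 T) (m : ℕ) :
    ∀ t ∈ Set.Icc 0 T, ‖iteratedProd a m t‖ ≤
      ‖(1 : A)‖ * ((∫ s in (0 : ℝ)..t, ‖a s‖) ^ m / m.factorial) := by
  have := norm_le_pow_div_factorial hT ha (F := iteratedProd a)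
    (G := fun m s => a s * iteratedProd a m s) (K := ‖(1 : A)‖) zero_le_one (p := 0)
    (fun t _ => by simp [iteratedProd]) (fun m t _ => rfl)
    (fun m t => by rw [one_mul]; exact norm_mul_le _ _) m
  simpa using this

/-- Factorial decay beats every geometric rate `b`, which is what makes the series in z entire. -/
theorem pow_div_factorial_le {α b : ℝ} (hα : 0 ≤ α) (hb : 0 < b) (m : ℕ) :
    α ^ m / m.factorial ≤ Real.exp (α / b) * b ^ m := by
  have := Real.pow_div_factorial_le_exp (α / b) (by positivity) m
  calc α ^ m / m.factorial = (α / b) ^ m / m.factorial * b ^ m := by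
        rw [div_pow]; field_simp
    _ ≤ _ := by gcongr

theorem exp_magnusCoeff_isBigO (hT : 0 ≤ T) (ha : IntervalIntegrable a volume 0 T) (N : ℕ) :
    (fun z : ℂ => NormedSpace.exp (∑ m ∈ Finset.range N, z ^ (m + 1) • magnusCoeff a T m) -
        ∑' m, z ^ m • iteratedProd a m T) =O[nhds 0] fun z => z ^ (N + 1) := by
  set α := ∫ s in (0 : ℝ)..T, ‖a s‖ with hα
  have hα0 : 0 ≤ α := intervalIntegral.integral_nonneg hT fun _ _ => norm_nonneg _
  -- The rate must dominate the factor 2α that each commutator costs, and be at least 1.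
  set B : ℝ := 2 * α + 1 with hB
  set C : ℝ := ‖(1 : A)‖ * Real.exp (α / B) + α with hC
  have hB1 : 1 ≤ B := by linarith
  refine exp_sub_tsum_isBigO (C := C) (B := B) hB1 rfl (fun m => ?_) (fun m x hx => ?_)
    (fun m => ?_) (fun m x _ => sum_integral_chainDensity_mul hT x ha m) N
  · refine (norm_iteratedProd_le hT ha m T ⟨hT, le_rfl⟩).trans ?_
    calc _ ≤ ‖(1 : A)‖ * (Real.exp (α / B) * B ^ m) := by
          gcongr; exact pow_div_factorial_le hα0 (by positivity) m
      _ = (‖(1 : A)‖ * Real.exp (α / B)) * B ^ m := by ring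
      _ ≤ C * B ^ m := by gcongr; linarith
  · refine (norm_integral_chainDensity_le hT hx ha m).trans ?_
    have : 0 ≤ ‖(1 : A)‖ * Real.exp (α / B) := by positivity
    calc _ ≤ C * (2 * α) ^ m := by
          gcongr; linarith
      _ ≤ C * B ^ m := by gcongr; linarith
  · simp only [integral_chainDensity_eq_sum_perm hT _ ha]
    fun_prop

theorem orderedIntegral_smul (m : ℕ) (c : ℂ) : ∀ (u : ℝ) (f : (Fin m → ℝ) → A),
    orderedIntegral m u (fun t => c • f t) = c • orderedIntegral m u f := by
  induction m with
  | zero => intro u f; rfl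
  | succ m ih =>
    intro u f
    simp only [orderedIntegral, ih, intervalIntegral.integral_smul]

theorem nestedCommutator_smul (m : ℕ) (c : ℂ) (b : Fin (m + 1) → A) :
    nestedCommutator m (fun j => c • b j) = c ^ (m + 1) • nestedCommutator m b := by
  induction m with
  | zero => simp [nestedCommutator]
  | succ m ih =>
    have h := ih (Fin.tail b)
    have e : (Fin.tail fun j => c • b j) = fun j => c • Fin.tail b j := rfl
    rw [nestedCommutator, e, h, nestedCommutator]
    simp only [Ring.lie_def, smul_mul_smul_comm, smul_sub]
    rw [← pow_succ', ← pow_succ]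

theorem ascents_le {m : ℕ} (σ : Equiv.Perm (Fin (m + 1))) : ascents σ ≤ m := by
  refine (Finset.sum_le_card_nsmul _ _ 1 fun i _ => ?_).trans (by simp)
  split_ifs <;> simp

/-- Integrating (1 - x)^θ (-x)^{m-θ} over [0, 1] gives the sign and θ!(m - θ)!/(m + 1)!, the
combinatorial factor of the Floquet-Magnus formula. -/
theorem magnusCoeff_eq_sum_perm (hT : 0 ≤ T) (ha : IntervalIntegrable a volume 0 T) (m : ℕ) :
    magnusCoeff a T m = ∑ σ : Equiv.Perm (Fin (m + 1)),
      (((-1) ^ (m - ascents σ) * ((ascents σ).factorial * (m - ascents σ).factorial) /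
        (((m : ℝ) + 1) * (m + 1).factorial) : ℝ) : ℂ) •
        orderedIntegral (m + 1) T fun t => nestedCommutator m fun j => a (t (σ j)) := by
  rw [magnusCoeff]
  simp only [integral_chainDensity_eq_sum_perm hT _ ha]
  rw [intervalIntegral.integral_finsetSum fun i _ => Continuous.intervalIntegrable
    (by fun_prop) _ _, Finset.smul_sum]
  refine Finset.sum_congr rfl fun σ _ => ?_
  rw [intervalIntegral.integral_smul_const]
  have h1 : ∫ x in (0 : ℝ)..1, (1 - x) ^ ascents σ * (-x) ^ (m - ascents σ) =
      (-1) ^ (m - ascents σ) * ((ascents σ).factorial * (m - ascents σ).factorial /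
        (m + 1).factorial) := by
    have := integral_pow_mul_one_sub_pow (m - ascents σ) (ascents σ)
    rw [Nat.sub_add_cancel (ascents_le σ)] at this
    rw [mul_comm ((ascents σ).factorial : ℝ), ← this, ← intervalIntegral.integral_const_mul]
    refine intervalIntegral.integral_congr fun x _ => ?_
    rw [neg_pow x]; ring
  rw [h1, ← Complex.coe_smul, smul_smul]
  congr 1
  push_cast
  have hm : (m : ℂ) + 1 ≠ 0 := Nat.cast_add_one_ne_zero m
  have hm' : (((m + 1).factorial : ℕ) : ℂ) ≠ 0 := by
    exact_mod_cast (Nat.factorial_pos _).ne'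
  field_simp

/-- Of the m + 1 factors -i, one goes into -iT and the other m equal 1/i^m. Moreover (m + 1)(m + 1)!
= (m + 1)² m!. -/
theorem magnusCoeff_neg_I_smul {H : ℝ → A} (hT : 0 < T) (hH : IntervalIntegrable H volume 0 T)
    (m : ℕ) :
    magnusCoeff (fun t => (-I) • H t) T m = (-(I * T)) • ((T : ℂ) ^ m • magnusTerm H T m) := by
  have hI : IntervalIntegrable (fun t => (-I) • H t) volume 0 T := hH.smul (-I)
  rw [magnusCoeff_eq_sum_perm hT.le hI, magnusTerm, Finset.smul_sum, Finset.smul_sum]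
  refine Finset.sum_congr rfl fun σ _ => ?_
  simp only [nestedCommutator_smul, orderedIntegral_smul, smul_smul]
  congr 1
  have hm : (m : ℂ) + 1 ≠ 0 := Nat.cast_add_one_ne_zero m
  have hT' : (T : ℂ) ≠ 0 := by exact_mod_cast hT.ne'
  have hf : ((m.factorial : ℕ) : ℂ) ≠ 0 := by exact_mod_cast (Nat.factorial_pos _).ne'
  have hI : (-I) ^ m * I ^ m = 1 := by rw [← mul_pow]; simp
  have hI0 : I ^ m ≠ 0 := pow_ne_zero _ I_ne_zero
  have hI' : (-I) ^ m = (I ^ m)⁻¹ := by exact eq_inv_of_mul_eq_one_left hI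
  rw [Nat.factorial_succ, pow_succ (-I), hI']
  push_cast
  field_simp
  ring

end magnus

/-! ### Operators acting on a set of sites -/

section localOperators

variable {Λ : Type*} {s : Λ → Type*} [Fintype Λ] [DecidableEq Λ]
  [∀ i, Fintype (s i)] [∀ i, DecidableEq (s i)]

/-- The matrix `a ⊗ 1` of an operator acting on the sites of `X`. -/
def localMatrix (X : Finset Λ) (a : Matrix (∀ i : X, s i) (∀ i : X, s i) ℂ) :
    Matrix (∀ i, s i) (∀ i, s i) ℂ :=
  Matrix.of fun x y : (∀ i, s i) =>
    if ∀ i, i ∉ X → x i = y i then a (fun i => x i) (fun i => y i) else 0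

/-- The configuration `p` on `X` and `x` elsewhere. -/
def glue (X : Finset Λ) (p : ∀ i : X, s i) (x : ∀ i, s i) : ∀ i, s i :=
  fun i => if h : i ∈ X then p ⟨i, h⟩ else x i

theorem glue_of_mem {X : Finset Λ} {p : ∀ i : X, s i} {x : ∀ i, s i} {i : Λ} (h : i ∈ X) :
    glue X p x i = p ⟨i, h⟩ := by simp [glue, h]

theorem glue_of_notMem {X : Finset Λ} {p : ∀ i : X, s i} {x : ∀ i, s i} {i : Λ} (h : i ∉ X) :
    glue X p x i = x i := by simp [glue, h]

theorem localMatrix_mul (X : Finset Λ) (a b : Matrix (∀ i : X, s i) (∀ i : X, s i) ℂ) :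
    localMatrix X a * localMatrix X b = localMatrix X (a * b) := by
  ext x y
  simp only [Matrix.mul_apply, localMatrix, Matrix.of_apply]
  by_cases hxy : ∀ i, i ∉ X → x i = y i
  · rw [if_pos hxy]
    refine (Finset.sum_of_injOn (fun p => glue X p x) (fun p _ q _ h => ?_) (by simp)
      (fun w _ hw => ?_) fun p _ => ?_).symm
    · ext i
      have := congrFun h i
      simpa [glue_of_mem i.2] using this
    · rw [if_neg, zero_mul]
      intro h
      refine hw ⟨fun i => w i, by simp, ?_⟩
      ext i
      by_cases hi : i ∈ X
      · simp [glue_of_mem hi]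
      · simp [glue_of_notMem hi, h i hi]
    · have h1 : ∀ i, i ∉ X → x i = glue X p x i := fun i hi => (glue_of_notMem hi).symm
      have h2 : ∀ i, i ∉ X → glue X p x i = y i := fun i hi => (h1 i hi).symm.trans (hxy i hi)
      have h3 : (fun i : X => glue X p x i) = p := by ext i; exact glue_of_mem i.2
      rw [if_pos h1, if_pos h2, h3]
  · rw [if_neg hxy]
    refine Finset.sum_eq_zero fun w _ => ?_
    by_cases h1 : ∀ i, i ∉ X → x i = w i
    · rw [if_neg (c := ∀ i, i ∉ X → w i = y i) fun h2 => hxy fun i hi => (h1 i hi).trans (h2 i hi),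
        mul_zero]
    · rw [if_neg h1, zero_mul]

/-- Only one intermediate configuration contributes: `y` on X and `x` elsewhere. The resulting entry
is symmetric in the two factors, whence operators on disjoint sets commute. -/
theorem localMatrix_mul_apply_of_disjoint {X Y : Finset Λ} (h : Disjoint X Y)
    (a : Matrix (∀ i : X, s i) (∀ i : X, s i) ℂ) (b : Matrix (∀ i : Y, s i) (∀ i : Y, s i) ℂ)
    (x y : ∀ i, s i) :
    (localMatrix X a * localMatrix Y b) x y =
      if ∀ i, i ∉ X → i ∉ Y → x i = y i then
        a (fun i => x i) (fun i => y i) * b (fun i => x i) (fun i => y i) else 0 := by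
  simp only [Matrix.mul_apply, localMatrix, Matrix.of_apply]
  have hYX : ∀ i, i ∈ Y → i ∉ X := fun i hi hi' => Finset.disjoint_left.1 h hi' hi
  rw [Finset.sum_eq_single (glue X (fun i => y i) x)]
  · have h1 : ∀ i, i ∉ X → x i = glue X (fun i => y i) x i := fun i hi => (glue_of_notMem hi).symm
    have h2 : (∀ i, i ∉ Y → glue X (fun i => y i) x i = y i) ↔ ∀ i, i ∉ X → i ∉ Y → x i = y i := by
      refine forall_congr' fun i => ?_
      by_cases hi : i ∈ X
      · simp [hi, glue_of_mem hi]
      · simp [hi, glue_of_notMem hi]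
    have h3 : (fun i : X => glue X (fun i => y i) x i) = fun i : X => y i := by
      ext i; exact glue_of_mem i.2
    have h4 : (fun i : Y => glue X (fun i => y i) x i) = fun i : Y => x i := by
      ext i; exact glue_of_notMem (hYX i i.2)
    rw [if_pos h1, h3, h4]
    simp only [h2]
    split_ifs <;> simp
  · intro w _ hw
    by_cases h1 : ∀ i, i ∉ X → x i = w i
    · rw [if_neg (c := ∀ i, i ∉ Y → w i = y i), mul_zero]
      intro h2
      refine hw (funext fun i => ?_)
      by_cases hi : i ∈ X
      · rw [glue_of_mem hi]; exact h2 i (Finset.disjoint_left.1 h hi)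
      · rw [glue_of_notMem hi]; exact (h1 i hi).symm
    · rw [if_neg h1, zero_mul]
  · simp

theorem localMatrix_commute_of_disjoint {X Y : Finset Λ} (h : Disjoint X Y)
    (a : Matrix (∀ i : X, s i) (∀ i : X, s i) ℂ) (b : Matrix (∀ i : Y, s i) (∀ i : Y, s i) ℂ) :
    localMatrix X a * localMatrix Y b = localMatrix Y b * localMatrix X a := by
  ext x y
  rw [localMatrix_mul_apply_of_disjoint h, localMatrix_mul_apply_of_disjoint h.symm]
  have : (∀ i, i ∉ X → i ∉ Y → x i = y i) ↔ ∀ i, i ∉ Y → i ∉ X → x i = y i :=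
    forall_congr' fun i => ⟨fun h h1 h2 => h h2 h1, fun h h1 h2 => h h2 h1⟩
  simp only [this, mul_comm (a _ _)]

theorem localMatrix_mono {X Y : Finset Λ} (h : X ⊆ Y)
    (a : Matrix (∀ i : X, s i) (∀ i : X, s i) ℂ) :
    ∃ b : Matrix (∀ i : Y, s i) (∀ i : Y, s i) ℂ, localMatrix X a = localMatrix Y b := by
  refine ⟨Matrix.of fun p q => if ∀ i : Y, (i : Λ) ∉ X → p i = q i then
    a (fun i => p ⟨i, h i.2⟩) (fun i => q ⟨i, h i.2⟩) else 0, ?_⟩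
  ext x y
  simp only [localMatrix, Matrix.of_apply]
  by_cases h1 : ∀ i, i ∉ X → x i = y i
  · rw [if_pos h1, if_pos fun i hi => h1 i fun h' => hi (h h')]
    have h2 : ∀ i : Y, (i : Λ) ∉ X → x i = y i := fun i hi => h1 i hi
    rw [if_pos h2]
  · rw [if_neg h1]
    by_cases h2 : ∀ i, i ∉ Y → x i = y i
    · rw [if_pos h2, if_neg]
      intro h3
      refine h1 fun i hi => ?_
      by_cases hY : i ∈ Y
      · exact h3 ⟨i, hY⟩ hi
      · exact h2 i hY
    · rw [if_neg h2]

theorem localMatrix_star (X : Finset Λ) (a : Matrix (∀ i : X, s i) (∀ i : X, s i) ℂ) :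
    star (localMatrix X a) = localMatrix X (star a) := by
  ext x y
  simp only [localMatrix, Matrix.star_apply, Matrix.of_apply]
  have : (∀ i, i ∉ X → x i = y i) ↔ ∀ i, i ∉ X → y i = x i :=
    forall_congr' fun i => forall_congr' fun _ => eq_comm
  simp only [this]
  split_ifs <;> simp

theorem actsOn_iff {X : Finset Λ} {A : Op s} :
    ActsOn X A ↔ ∃ a, A = Matrix.toEuclideanCLM (𝕜 := ℂ) (localMatrix X a) := Iff.rfl

variable {X Y : Finset Λ} {A B : Op s}

/-- The operators acting on `X` as a submodule. -/
def localSubmodule (s : Λ → Type*) [∀ i, Fintype (s i)] [∀ i, DecidableEq (s i)] (X : Finset Λ) :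
    Submodule ℂ (Op s) where
  carrier := {A | ActsOn X A}
  add_mem' := by
    rintro _ _ ⟨a, rfl⟩ ⟨b, rfl⟩
    refine actsOn_iff.2 ⟨a + b, ?_⟩
    rw [← map_add]
    congr 1
    ext x y
    simp only [localMatrix, Matrix.of_apply, Matrix.add_apply]
    split_ifs <;> simp
  zero_mem' := by
    refine actsOn_iff.2 ⟨0, ?_⟩
    rw [← map_zero (Matrix.toEuclideanCLM (𝕜 := ℂ) (n := ∀ i, s i))]
    congr 1
    ext x y
    simp [localMatrix]
  smul_mem' := by
    rintro c _ ⟨a, rfl⟩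
    refine actsOn_iff.2 ⟨c • a, ?_⟩
    rw [← map_smul]
    congr 1
    ext x y
    simp only [localMatrix, Matrix.of_apply, Matrix.smul_apply]
    split_ifs <;> simp

theorem ActsOn.mul (hA : ActsOn X A) (hB : ActsOn X B) : ActsOn X (A * B) := by
  obtain ⟨a, rfl⟩ := actsOn_iff.1 hA
  obtain ⟨b, rfl⟩ := actsOn_iff.1 hB
  exact actsOn_iff.2 ⟨a * b, by rw [← map_mul, localMatrix_mul]⟩

theorem ActsOn.star (hA : ActsOn X A) : ActsOn X (star A) := by
  obtain ⟨a, rfl⟩ := actsOn_iff.1 hA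
  exact actsOn_iff.2 ⟨Star.star a, by rw [← map_star, localMatrix_star]⟩

theorem ActsOn.mono (hA : ActsOn X A) (h : X ⊆ Y) : ActsOn Y A := by
  obtain ⟨a, rfl⟩ := actsOn_iff.1 hA
  obtain ⟨b, hb⟩ := localMatrix_mono h a
  exact actsOn_iff.2 ⟨b, by rw [hb]⟩

theorem ActsOn.commute (hA : ActsOn X A) (hB : ActsOn Y B) (h : Disjoint X Y) : Commute A B := by
  obtain ⟨a, rfl⟩ := actsOn_iff.1 hA
  obtain ⟨b, rfl⟩ := actsOn_iff.1 hB
  rw [commute_iff_eq, ← map_mul, ← map_mul, localMatrix_commute_of_disjoint h]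

theorem ActsOn.lie_eq_zero (hA : ActsOn X A) (hB : ActsOn Y B) (h : Disjoint X Y) : ⁅A, B⁆ = 0 := by
  rw [Ring.lie_def, (hA.commute hB h).eq, sub_self]

theorem ActsOn.lie (hA : ActsOn X A) (hB : ActsOn Y B) : ActsOn (X ∪ Y) ⁅A, B⁆ := by
  have hA' := hA.mono (Finset.subset_union_left (s₂ := Y))
  have hB' := hB.mono (Finset.subset_union_right (s₁ := X))
  exact (localSubmodule s _).sub_mem (hA'.mul hB') (hB'.mul hA')

/-- Needed for observables with |X| = 0, where the claimed bound is 0 and the two expectations must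
agree exactly. -/
theorem actsOn_empty_iff : ActsOn ∅ A ↔ ∃ c : ℂ, A = c • (1 : Op s) := by
  have key : ∀ a : Matrix (∀ i : (∅ : Finset Λ), s i) (∀ i : (∅ : Finset Λ), s i) ℂ,
      localMatrix ∅ a = a (fun i => (Finset.notMem_empty _ i.2).elim)
        (fun i => (Finset.notMem_empty _ i.2).elim) • (1 : Matrix (∀ i, s i) (∀ i, s i) ℂ) := by
    intro a
    ext x y
    simp only [localMatrix, Matrix.of_apply, Matrix.smul_apply, Matrix.one_apply, smul_eq_mul]
    have h : (∀ i, i ∉ (∅ : Finset Λ) → x i = y i) ↔ x = y := by simp [funext_iff]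
    simp only [h]
    split_ifs
    · rw [mul_one]; congr 1 <;> ext i <;> exact (Finset.notMem_empty _ i.2).elim
    · simp
  constructor
  · intro hA
    obtain ⟨a, rfl⟩ := actsOn_iff.1 hA
    exact ⟨_, by rw [key, map_smul, map_one]⟩
  · rintro ⟨c, rfl⟩
    refine actsOn_iff.2 ⟨Matrix.of fun _ _ => c, ?_⟩
    rw [key, map_smul, map_one, Matrix.of_apply]

end localOperators

/-! ### Operators that are sums of local terms -/

section isLocal

variable {Λ : Type*} [Fintype Λ] [DecidableEq Λ] {A : Type*} [NormedRing A] [StarRing A]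
  [CStarRing A] [NormedAlgebra ℂ A] [StarModule ℂ A] [FiniteDimensional ℂ A] [CompleteSpace A]
  {L : Finset Λ → Submodule ℂ A}

/-- The operators acting on the sets of sites, as an abstract family of subspaces. -/
structure LocalAlgebras (L : Finset Λ → Submodule ℂ A) : Prop where
  lie_mem : ∀ {X Y a b}, a ∈ L X → b ∈ L Y → ⁅a, b⁆ ∈ L (X ∪ Y)
  lie_eq_zero : ∀ {X Y a b}, a ∈ L X → b ∈ L Y → Disjoint X Y → ⁅a, b⁆ = 0
  star_mem : ∀ {X a}, a ∈ L X → star a ∈ L X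

/-- A family of operators `Φ Y` acting on sets `Y` of at most `K` sites, whose norms add up to at
most `r` at each site. -/
structure LocalFamily (L : Finset Λ → Submodule ℂ A) (K : ℕ) (r : ℝ) (Φ : Finset Λ → A) : Prop where
  mem : ∀ Y, Φ Y ∈ L Y
  eq_zero : ∀ Y : Finset Λ, K < Y.card → Φ Y = 0
  sum_le : ∀ i, ∑ Y : Finset Λ with i ∈ Y, ‖Φ Y‖ ≤ r

/-- `R` is the sum of a local family. -/
def IsLocal (L : Finset Λ → Submodule ℂ A) (K : ℕ) (r : ℝ) (R : A) : Prop :=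
  ∃ Φ : Finset Λ → A, LocalFamily L K r Φ ∧ R = ∑ Y, Φ Y

variable {K K₁ K₂ : ℕ} {r r₁ r₂ : ℝ} {R R₁ R₂ : A} {Φ Ψ : Finset Λ → A}

theorem LocalFamily.add (h₁ : LocalFamily L K r₁ Φ) (h₂ : LocalFamily L K r₂ Ψ) :
    LocalFamily L K (r₁ + r₂) (fun Y => Φ Y + Ψ Y) where
  mem Y := (L Y).add_mem (h₁.mem Y) (h₂.mem Y)
  eq_zero Y hY := by rw [h₁.eq_zero Y hY, h₂.eq_zero Y hY, add_zero]
  sum_le i := by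
    refine le_trans (Finset.sum_le_sum fun Y _ => norm_add_le _ _) ?_
    rw [Finset.sum_add_distrib]
    exact add_le_add (h₁.sum_le i) (h₂.sum_le i)

theorem LocalFamily.smul (h : LocalFamily L K r Φ) (c : ℂ) :
    LocalFamily L K (‖c‖ * r) (fun Y => c • Φ Y) where
  mem Y := (L Y).smul_mem c (h.mem Y)
  eq_zero Y hY := by rw [h.eq_zero Y hY, smul_zero]
  sum_le i := by
    simp only [norm_smul, ← Finset.mul_sum]
    exact mul_le_mul_of_nonneg_left (h.sum_le i) (norm_nonneg c)

theorem LocalFamily.star (h : LocalFamily L K r Φ) (hL : LocalAlgebras L) : LocalFamily L K r (fun Y => star (Φ Y)) where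
  mem Y := hL.star_mem (h.mem Y)
  eq_zero Y hY := by rw [h.eq_zero Y hY, star_zero]
  sum_le i := by simpa only [norm_star] using h.sum_le i

theorem LocalFamily.mono (h : LocalFamily L K₁ r₁ Φ) (hK : K₁ ≤ K₂) (hr : r₁ ≤ r₂) :
    LocalFamily L K₂ r₂ Φ where
  mem := h.mem
  eq_zero Y hY := h.eq_zero Y (hK.trans_lt hY)
  sum_le i := (h.sum_le i).trans hr

theorem IsLocal.add (h₁ : IsLocal L K r₁ R₁) (h₂ : IsLocal L K r₂ R₂) :
    IsLocal L K (r₁ + r₂) (R₁ + R₂) := by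
  obtain ⟨Φ, hΦ, rfl⟩ := h₁
  obtain ⟨Ψ, hΨ, rfl⟩ := h₂
  exact ⟨_, hΦ.add hΨ, Finset.sum_add_distrib.symm⟩

theorem IsLocal.smul (h : IsLocal L K r R) (c : ℂ) : IsLocal L K (‖c‖ * r) (c • R) := by
  obtain ⟨Φ, hΦ, rfl⟩ := h
  exact ⟨_, hΦ.smul c, Finset.smul_sum⟩

theorem IsLocal.mono (h : IsLocal L K₁ r₁ R) (hK : K₁ ≤ K₂) (hr : r₁ ≤ r₂) : IsLocal L K₂ r₂ R := by
  obtain ⟨Φ, hΦ, rfl⟩ := h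
  exact ⟨Φ, hΦ.mono hK hr, rfl⟩

theorem isLocal_zero (hr : 0 ≤ r) : IsLocal L K r (0 : A) :=
  ⟨fun _ => 0, ⟨fun Y => (L Y).zero_mem, fun _ _ => rfl, fun i => by simpa using hr⟩, by simp⟩

theorem isLocal_sum {ι : Type*} (t : Finset ι) {f : ι → A} {w : ι → ℝ}
    (h : ∀ i ∈ t, IsLocal L K (w i) (f i)) : IsLocal L K (∑ i ∈ t, w i) (∑ i ∈ t, f i) := by
  classical
  induction t using Finset.induction_on with
  | empty => simpa using isLocal_zero le_rfl
  | insert i t hi ih =>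
    rw [Finset.sum_insert hi, Finset.sum_insert hi]
    exact (h i (Finset.mem_insert_self _ _)).add
      (ih fun j hj => h j (Finset.mem_insert_of_mem hj))

/-- A skew-adjoint local operator is a sum of skew-adjoint local terms. -/
theorem IsLocal.exists_skewAdjoint (hL : LocalAlgebras L) (h : IsLocal L K r R) (hR : star R = -R) :
    ∃ Φ : Finset Λ → A, LocalFamily L K r Φ ∧ (∀ Y, star (Φ Y) = -Φ Y) ∧ R = ∑ Y, Φ Y := by
  obtain ⟨Φ, hΦ, rfl⟩ := h
  -- Replace each term Φ(Y) by its skew-adjoint part (Φ(Y) - Φ(Y)*)/2.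
  refine ⟨_, ((hΦ.add ((hΦ.star hL).smul (-1))).smul (1 / 2)).mono le_rfl (le_of_eq ?_), fun Y => ?_, ?_⟩
  · norm_num; ring
  · simp only [star_smul, star_add, star_star, RCLike.star_def, map_neg, map_div₀, map_one,
      map_ofNat]
    rw [← smul_neg]
    congr 1
    simp [add_comm]
  · rw [← Finset.smul_sum, Finset.sum_add_distrib, ← Finset.smul_sum, ← star_sum, hR]
    rw [smul_neg, neg_smul, one_smul, neg_neg, ← two_smul ℂ, smul_smul]
    norm_num

theorem convex_isLocal (K : ℕ) : Convex ℝ {p : A × ℝ | IsLocal L K p.2 p.1} := by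
  intro p hp q hq a b ha hb _
  have h1 := hp.smul (a : ℂ)
  have h2 := hq.smul (b : ℂ)
  rw [Complex.norm_of_nonneg ha, Complex.coe_smul] at h1
  rw [Complex.norm_of_nonneg hb, Complex.coe_smul] at h2
  exact h1.add h2

/-- Compactness: the decompositions of a convergent sequence stay bounded in a finite-dimensional
space, and all three conditions on a local family survive along a convergent subsequence. -/
theorem isClosed_isLocal (K : ℕ) : IsClosed {p : A × ℝ | IsLocal L K p.2 p.1} := by
  refine IsSeqClosed.isClosed fun u p hu hlim => ?_
  choose Φ hΦ hsum using hu
  have : ProperSpace (Finset Λ → A) := FiniteDimensional.proper ℂ _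
  have hlim1 := (continuous_fst.tendsto p).comp hlim
  have hlim2 := (continuous_snd.tendsto p).comp hlim
  obtain ⟨C, hC⟩ := (Metric.isBounded_range_of_tendsto _ hlim1).exists_norm_le
  obtain ⟨D, hD⟩ := (Metric.isBounded_range_of_tendsto _ hlim2).exists_norm_le
  have hC' : ∀ n, ‖(u n).1‖ ≤ C := fun n => hC _ ⟨n, rfl⟩
  have hD' : ∀ n, (u n).2 ≤ D := fun n => (le_abs_self _).trans (hD _ ⟨n, rfl⟩)
  have hne : ∀ n (Y : Finset Λ), Y ≠ ∅ → ‖Φ n Y‖ ≤ |D| := by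
    intro n Y hY
    obtain ⟨i, hi⟩ := Finset.nonempty_iff_ne_empty.2 hY
    calc ‖Φ n Y‖ ≤ ∑ Y : Finset Λ with i ∈ Y, ‖Φ n Y‖ :=
          Finset.single_le_sum (f := fun Y => ‖Φ n Y‖) (fun _ _ => norm_nonneg _) (by simpa using hi)
      _ ≤ (u n).2 := (hΦ n).sum_le i
      _ ≤ |D| := (hD' n).trans (le_abs_self D)
  -- No site sum sees the term of the empty set, so it is bounded as the total minus the remaining
  -- terms.
  have hempty : ∀ n, ‖Φ n ∅‖ ≤ C + Fintype.card (Finset Λ) * |D| := by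
    intro n
    have : Φ n ∅ = (u n).1 - ∑ Y ∈ Finset.univ.erase ∅, Φ n Y := by
      rw [hsum n, ← Finset.add_sum_erase _ _ (Finset.mem_univ ∅), add_sub_cancel_right]
    rw [this]
    refine (norm_sub_le _ _).trans (add_le_add (hC' n) ?_)
    refine (norm_sum_le_of_le _ fun Y hY => hne n Y (Finset.ne_of_mem_erase hY)).trans ?_
    rw [Finset.sum_const, nsmul_eq_mul]
    refine mul_le_mul_of_nonneg_right ?_ (abs_nonneg D)
    exact_mod_cast Finset.card_le_univ _
  have hC0 : 0 ≤ C := (norm_nonneg _).trans (hC' 0)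
  have hbdd : ∀ n, Φ n ∈ Metric.closedBall (0 : Finset Λ → A)
      (C + Fintype.card (Finset Λ) * |D| + |D|) := by
    intro n
    rw [mem_closedBall_zero_iff, pi_norm_le_iff_of_nonneg (by positivity)]
    intro Y
    by_cases hY : Y = ∅
    · subst hY; exact (hempty n).trans (le_add_of_nonneg_right (abs_nonneg D))
    · exact (hne n Y hY).trans (le_add_of_nonneg_left (by positivity))
  obtain ⟨Ψ, -, φ, hφ, hconv⟩ := tendsto_subseq_of_bounded Metric.isBounded_closedBall hbdd
  have hY : ∀ Y, Filter.Tendsto (fun n => Φ (φ n) Y) Filter.atTop (nhds (Ψ Y)) := fun Y =>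
    ((continuous_apply Y).tendsto Ψ).comp hconv
  refine ⟨Ψ, ⟨fun Y => ?_, fun Y hK => ?_, fun i => ?_⟩, ?_⟩
  · exact (L Y).closed_of_finiteDimensional.mem_of_tendsto (hY Y)
      (Filter.Eventually.of_forall fun n => (hΦ (φ n)).mem Y)
  · refine tendsto_nhds_unique (hY Y) ?_
    simp only [fun n => (hΦ n).eq_zero Y hK]
    exact tendsto_const_nhds
  · exact le_of_tendsto_of_tendsto' (tendsto_finsetSum _ fun Y _ => (hY Y).norm)
      (hlim2.comp hφ.tendsto_atTop) fun n => (hΦ (φ n)).sum_le i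
  · refine tendsto_nhds_unique (hlim1.comp hφ.tendsto_atTop) ?_
    refine (tendsto_finsetSum Finset.univ fun Y _ => hY Y).congr fun n => ?_
    exact (hsum (φ n)).symm

/-- The pairs (operator, strength) form a closed convex set, which therefore contains averages. No
measurable choice of decompositions is required. -/
theorem isLocal_intervalIntegral {f : ℝ → A} {w : ℝ → ℝ} {t : ℝ} (ht : 0 ≤ t)
    (hw : IntervalIntegrable w volume 0 t) (hw0 : 0 ≤ ∫ u in (0 : ℝ)..t, w u)
    (h : ∀ u ∈ Set.Ioc 0 t, IsLocal L K (w u) (f u)) :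
    IsLocal L K (∫ u in (0 : ℝ)..t, w u) (∫ u in (0 : ℝ)..t, f u) := by
  rcases ht.eq_or_lt with rfl | ht
  · simpa using isLocal_zero le_rfl
  by_cases hf : IntervalIntegrable f volume 0 t
  swap
  -- The integral of a non-integrable function is 0 by convention, and 0 is local.
  · rw [intervalIntegral.integral_undef hf]
    exact isLocal_zero hw0
  rw [intervalIntegrable_iff_integrableOn_Ioc_of_le ht.le] at hf hw
  have : NeZero (volume.restrict (Set.Ioc 0 t)) := ⟨by
    rw [Ne, Measure.restrict_eq_zero, Real.volume_Ioc]; simpa using ht⟩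
  have hav := (convex_isLocal (L := L) K).average_mem (isClosed_isLocal K)
    (μ := volume.restrict (Set.Ioc 0 t)) (f := fun u => (f u, w u))
    ((ae_restrict_iff' measurableSet_Ioc).2 (Filter.Eventually.of_forall h)) (hf.prodMk hw)
  rw [average_eq, integral_pair hf hw] at hav
  have hr : (volume.restrict (Set.Ioc 0 t)).real Set.univ = t := by
    simp [measureReal_def, ht.le]
  rw [hr] at hav
  have h2 := IsLocal.smul hav (t : ℂ)
  rw [Complex.norm_of_nonneg ht.le, Complex.coe_smul] at h2
  simp only [Prod.smul_fst, Prod.smul_snd, smul_eq_mul] at h2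
  rw [smul_smul, mul_inv_cancel₀ ht.ne', one_smul, mul_inv_cancel_left₀ ht.ne'] at h2
  rwa [intervalIntegral.integral_of_le ht.le, intervalIntegral.integral_of_le ht.le]

end isLocal

/-! ### Commutators of local operators. -/

section commutator

variable {Λ : Type*} [Fintype Λ] [DecidableEq Λ] {A : Type*} [NormedRing A] [StarRing A]
  [CStarRing A] [NormedAlgebra ℂ A] [StarModule ℂ A] [FiniteDimensional ℂ A] [CompleteSpace A]
  {L : Finset Λ → Submodule ℂ A}
  {K K₁ K₂ : ℕ} {r r₁ r₂ : ℝ} {R R₁ R₂ : A} {Φ Ψ : Finset Λ → A}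

theorem sum_not_disjoint_le {β : Finset Λ → ℝ} (hβ : ∀ Y, 0 ≤ β Y)
    (h : ∀ i, ∑ Y : Finset Λ with i ∈ Y, β Y ≤ r) (Z : Finset Λ) :
    ∑ Y : Finset Λ with ¬Disjoint Z Y, β Y ≤ Z.card * r := by
  calc ∑ Y : Finset Λ with ¬Disjoint Z Y, β Y
      ≤ ∑ Y : Finset Λ, ∑ i ∈ Z, if i ∈ Y then β Y else 0 := by
        rw [Finset.sum_filter]
        refine Finset.sum_le_sum fun Y _ => ?_
        have h0 : ∀ i ∈ Z, 0 ≤ if i ∈ Y then β Y else 0 := fun i _ => by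
          split_ifs
          exacts [hβ Y, le_rfl]
        split_ifs with hd
        · exact Finset.sum_nonneg h0
        · obtain ⟨i, hiZ, hiY⟩ := Finset.not_disjoint_iff.1 hd
          refine le_trans (le_of_eq ?_) (Finset.single_le_sum h0 hiZ)
          rw [if_pos hiY]
    _ = ∑ i ∈ Z, ∑ Y : Finset Λ with i ∈ Y, β Y := by
        rw [Finset.sum_comm]
        simp only [Finset.sum_filter]
    _ ≤ Z.card * r := by
        rw [← nsmul_eq_mul]
        exact Finset.sum_le_card_nsmul _ _ _ fun i _ => h i

theorem sum_mul_sum_not_disjoint_le {β γ : Finset Λ → ℝ} (hβ : ∀ Y, 0 ≤ β Y) (hγ : ∀ Y, 0 ≤ γ Y)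
    (h : ∀ i, ∑ Y : Finset Λ with i ∈ Y, β Y ≤ r) (hK : ∀ Z : Finset Λ, K < Z.card → γ Z = 0)
    (hr : 0 ≤ r) (t : Finset (Finset Λ)) :
    ∑ Z ∈ t, γ Z * ∑ Y : Finset Λ with ¬Disjoint Z Y, β Y ≤ K * r * ∑ Z ∈ t, γ Z := by
  rw [Finset.mul_sum]
  refine Finset.sum_le_sum fun Z _ => ?_
  by_cases hZ : K < Z.card
  · simp [hK Z hZ]
  · rw [mul_comm]
    refine mul_le_mul_of_nonneg_right ((sum_not_disjoint_le hβ h Z).trans ?_) (hγ Z)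
    exact mul_le_mul_of_nonneg_right (by exact_mod_cast not_lt.1 hZ) hr

theorem lie_sum_right {ι : Type*} (t : Finset ι) (a : A) (f : ι → A) :
    ⁅a, ∑ i ∈ t, f i⁆ = ∑ i ∈ t, ⁅a, f i⁆ := by
  simp only [Ring.lie_def, Finset.mul_sum, Finset.sum_mul, Finset.sum_sub_distrib]

theorem lie_sum_left {ι : Type*} (t : Finset ι) (f : ι → A) (a : A) :
    ⁅∑ i ∈ t, f i, a⁆ = ∑ i ∈ t, ⁅f i, a⁆ := by
  simp only [Ring.lie_def, Finset.mul_sum, Finset.sum_mul, Finset.sum_sub_distrib]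

/-- Only intersecting pairs Z, W contribute. If a site lies in Z ∪ W, it lies in Z or in W; summing
first over the other set costs |Z| r₂ ≤ K₁ r₂ or |W| r₁ ≤ K₂ r₁, and the commutator costs a factor
2. -/
theorem IsLocal.lie (hL : LocalAlgebras L) (h₁ : IsLocal L K₁ r₁ R₁) (h₂ : IsLocal L K₂ r₂ R₂) (hr₁ : 0 ≤ r₁) (hr₂ : 0 ≤ r₂) :
    IsLocal L (K₁ + K₂) (2 * (K₁ + K₂) * r₁ * r₂) ⁅R₁, R₂⁆ := by
  obtain ⟨Φ, hΦ, rfl⟩ := h₁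
  obtain ⟨Ψ, hΨ, rfl⟩ := h₂
  refine ⟨fun Y => ∑ p : Finset Λ × Finset Λ with p.1 ∪ p.2 = Y, ⁅Φ p.1, Ψ p.2⁆,
    ⟨fun Y => ?_, fun Y hY => ?_, fun i => ?_⟩, ?_⟩
  · refine (L Y).sum_mem fun p hp => ?_
    have := hL.lie_mem (hΦ.mem p.1) (hΨ.mem p.2)
    rwa [(Finset.mem_filter.1 hp).2] at this
  · refine Finset.sum_eq_zero fun p hp => ?_
    rw [← (Finset.mem_filter.1 hp).2] at hY
    have hc := hY.trans_le (Finset.card_union_le _ _)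
    rcases lt_or_ge K₁ p.1.card with h | h
    · rw [hΦ.eq_zero _ h, Ring.lie_def, zero_mul, mul_zero, sub_zero]
    · rw [hΨ.eq_zero p.2 (by omega), Ring.lie_def, zero_mul, mul_zero, sub_zero]
  · have hbound : ∀ Z W, ‖⁅Φ Z, Ψ W⁆‖ ≤ if ¬Disjoint Z W then 2 * ‖Φ Z‖ * ‖Ψ W‖ else 0 := by
      intro Z W
      split_ifs with hd
      · rw [hL.lie_eq_zero (hΦ.mem Z) (hΨ.mem W) hd, norm_zero]
      · exact norm_lie_le _ _
    have hnn : ∀ Z W, 0 ≤ if ¬Disjoint Z W then 2 * ‖Φ Z‖ * ‖Ψ W‖ else 0 := fun Z W =>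
      (norm_nonneg _).trans (hbound Z W)
    calc ∑ Y : Finset Λ with i ∈ Y,
          ‖∑ p : Finset Λ × Finset Λ with p.1 ∪ p.2 = Y, ⁅Φ p.1, Ψ p.2⁆‖
        ≤ ∑ Y : Finset Λ with i ∈ Y, ∑ p : Finset Λ × Finset Λ with p.1 ∪ p.2 = Y,
          (if ¬Disjoint p.1 p.2 then 2 * ‖Φ p.1‖ * ‖Ψ p.2‖ else 0) :=
          Finset.sum_le_sum fun Y _ => norm_sum_le_of_le _ fun p _ => hbound p.1 p.2
      _ = ∑ p : Finset Λ × Finset Λ with i ∈ p.1 ∪ p.2,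
          (if ¬Disjoint p.1 p.2 then 2 * ‖Φ p.1‖ * ‖Ψ p.2‖ else 0) := by
          rw [Finset.sum_comm' (t' := Finset.univ.filter fun p : Finset Λ × Finset Λ =>
            i ∈ p.1 ∪ p.2) (s' := fun p => {p.1 ∪ p.2})]
          · simp
          · intro Y p
            simp only [Finset.mem_filter, Finset.mem_univ, true_and, Finset.mem_singleton]
            constructor
            · rintro ⟨h1, rfl⟩; exact ⟨rfl, h1⟩
            · rintro ⟨rfl, h1⟩; exact ⟨h1, rfl⟩
      _ ≤ (∑ Z : Finset Λ with i ∈ Z, ∑ W : Finset Λ,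
            if ¬Disjoint Z W then 2 * ‖Φ Z‖ * ‖Ψ W‖ else 0) +
          ∑ W : Finset Λ with i ∈ W, ∑ Z : Finset Λ,
            if ¬Disjoint Z W then 2 * ‖Φ Z‖ * ‖Ψ W‖ else 0 := by
          have e1 : (Finset.univ.filter fun p : Finset Λ × Finset Λ => i ∈ p.1 ∪ p.2) =
              ((Finset.univ.filter fun Z : Finset Λ => i ∈ Z) ×ˢ (Finset.univ : Finset (Finset Λ)))
              ∪ ((Finset.univ : Finset (Finset Λ)) ×ˢ
                (Finset.univ.filter fun Z : Finset Λ => i ∈ Z)) := by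
            ext p; simp
          rw [e1]
          refine (le_add_of_nonneg_right (Finset.sum_nonneg fun p _ => hnn p.1 p.2)).trans
            (le_of_eq Finset.sum_union_inter) |>.trans (le_of_eq ?_)
          rw [Finset.sum_product, Finset.sum_product_right]
      _ ≤ 2 * (K₁ * r₂ * r₁) + 2 * (K₂ * r₁ * r₂) := by
          refine add_le_add ?_ ?_
          · have := sum_mul_sum_not_disjoint_le (γ := fun Z => ‖Φ Z‖) (β := fun W => ‖Ψ W‖)
              (fun _ => norm_nonneg _) (fun _ => norm_nonneg _) hΨ.sum_le
              (fun Z hZ => by rw [hΦ.eq_zero Z hZ, norm_zero]) hr₂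
              (Finset.univ.filter fun Z : Finset Λ => i ∈ Z)
            have h3 := this.trans
              (mul_le_mul_of_nonneg_left (hΦ.sum_le i) (by positivity))
            refine le_trans (le_of_eq ?_) (mul_le_mul_of_nonneg_left h3 zero_le_two)
            rw [Finset.mul_sum]
            refine Finset.sum_congr rfl fun Z _ => ?_
            rw [← Finset.sum_filter, Finset.mul_sum, Finset.mul_sum]
            exact Finset.sum_congr rfl fun W _ => by ring
          · have := sum_mul_sum_not_disjoint_le (γ := fun Z => ‖Ψ Z‖) (β := fun W => ‖Φ W‖)
              (fun _ => norm_nonneg _) (fun _ => norm_nonneg _) hΦ.sum_le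
              (fun Z hZ => by rw [hΨ.eq_zero Z hZ, norm_zero]) hr₁
              (Finset.univ.filter fun Z : Finset Λ => i ∈ Z)
            have h3 := this.trans
              (mul_le_mul_of_nonneg_left (hΨ.sum_le i) (by positivity))
            refine le_trans (le_of_eq ?_) (mul_le_mul_of_nonneg_left h3 zero_le_two)
            rw [Finset.mul_sum]
            refine Finset.sum_congr rfl fun Z _ => ?_
            rw [← Finset.sum_filter, Finset.mul_sum, Finset.mul_sum]
            refine Finset.sum_congr (by simp only [disjoint_comm]) fun W _ => by ring
      _ = 2 * (K₁ + K₂) * r₁ * r₂ := by ring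
  · have : ∀ p : Finset Λ × Finset Λ, p ∈ (Finset.univ : Finset _) → p.1 ∪ p.2 ∈
      (Finset.univ : Finset (Finset Λ)) := fun _ _ => Finset.mem_univ _
    rw [lie_sum_right, Finset.sum_fiberwise_of_maps_to this, ← Finset.univ_product_univ,
      Finset.sum_product_right]
    exact Finset.sum_congr rfl fun W _ => lie_sum_left _ _ _

end commutator

/-! ### Commutators with local operators under a time evolution -/

section conjugation

variable {A : Type*} [NormedRing A] [NormedAlgebra ℂ A] [CompleteSpace A]

theorem hasDerivAt_conj_exp {f : ℝ → A} {f' : A} {t : ℝ} (G : A) (hf : HasDerivAt f f' t) :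
    HasDerivAt (fun t : ℝ => NormedSpace.exp (t • G) * f t * NormedSpace.exp (t • -G))
      (NormedSpace.exp (t • G) * (⁅G, f t⁆ + f') * NormedSpace.exp (t • -G)) t := by
  have h1 := hasDerivAt_exp_smul_const (𝕂 := ℝ) G t
  have h2 := hasDerivAt_exp_smul_const' (𝕂 := ℝ) (-G) t
  refine ((h1.mul hf).mul h2).congr_deriv ?_
  simp only [Ring.lie_def, Pi.mul_apply]
  noncomm_ring

theorem hasDerivAt_conj_exp_const (G B : A) (t : ℝ) :
    HasDerivAt (fun t : ℝ => NormedSpace.exp (t • G) * B * NormedSpace.exp (t • -G))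
      ⁅G, NormedSpace.exp (t • G) * B * NormedSpace.exp (t • -G)⁆ t := by
  have h1 := hasDerivAt_exp_smul_const' (𝕂 := ℝ) G t
  have h2 := hasDerivAt_exp_smul_const (𝕂 := ℝ) (-G) t
  refine ((h1.mul_const B).mul h2).congr_deriv ?_
  rw [Ring.lie_def]
  noncomm_ring

variable [StarRing A] [CStarRing A]

theorem exp_mem_unitary {x : A} (hx : star x = -x) : NormedSpace.exp x ∈ unitary A := by
  let _ : NormedAlgebra ℚ A := NormedAlgebra.restrictScalars ℚ ℂ A
  exact NormedSpace.exp_mem_unitary_of_mem_skewAdjoint (skewAdjoint.mem_iff.2 hx)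

variable [StarModule ℂ A]

theorem star_real_smul {x : A} (hx : star x = -x) (t : ℝ) : star (t • x) = -(t • x) := by
  have : StarModule ℝ A := inferInstance
  rw [star_smul, hx, star_trivial, smul_neg]

theorem norm_conj_exp {G : A} (hG : star G = -G) (t : ℝ) (x : A) :
    ‖NormedSpace.exp (t • G) * x * NormedSpace.exp (t • -G)‖ = ‖x‖ := by
  have hG' : star (-G) = -(-G) := by rw [star_neg, hG]
  rw [CStarRing.norm_mul_mem_unitary _ (exp_mem_unitary (star_real_smul hG' t)),
    CStarRing.norm_mem_unitary_mul _ (exp_mem_unitary (star_real_smul hG t))]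

/-- If `a` commutes with `G - G'`, then the evolution generated by `G` changes the commutator with
`a` at most at the rate `‖⁅a, ⁅G', B(t)⁆⁆‖`. -/
theorem norm_lie_conj_exp_le {G G' a B : A} {c : ℝ} (hG : star G = -G) (hG' : star G' = -G')
    (ha : Commute a (G - G'))
    (hc : ∀ t ∈ Set.Icc (0 : ℝ) 1,
      ‖⁅a, ⁅G', NormedSpace.exp (t • G) * B * NormedSpace.exp (t • -G)⁆⁆‖ ≤ c)
    {t : ℝ} (ht : t ∈ Set.Icc (0 : ℝ) 1) :
    ‖⁅a, NormedSpace.exp (t • G) * B * NormedSpace.exp (t • -G)⁆‖ ≤ ‖⁅a, B⁆‖ + c := by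
  set b : ℝ → A := fun t => NormedSpace.exp (t • G) * B * NormedSpace.exp (t • -G) with hb
  set H := G - G' with hH
  have hHstar : star (-H) = -(-H) := by rw [star_neg, hH, star_sub, hG, hG']; abel
  have hbd : ∀ t, HasDerivAt b ⁅G, b t⁆ t := fun t => hasDerivAt_conj_exp_const G B t
  have hf : ∀ t, HasDerivAt (fun t => ⁅a, b t⁆) ⁅a, ⁅G, b t⁆⁆ t := fun t => by
    simp only [Ring.lie_def a]
    exact ((hbd t).const_mul a).sub ((hbd t).mul_const a)
  have hh := fun t => hasDerivAt_conj_exp (-H) (hf t)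
  -- Jacobi identity with [a, H] = 0: in the frame rotating with H = G - G', only G' drives the
  -- commutator with `a`. The rotation is unitary and preserves norms.
  have hid : ∀ t, ⁅-H, ⁅a, b t⁆⁆ + ⁅a, ⁅G, b t⁆⁆ = ⁅a, ⁅G', b t⁆⁆ := fun t => by
    have hG2 : G = H + G' := by rw [hH]; abel
    have e1 : a * H = H * a := ha
    rw [hG2]
    simp only [Ring.lie_def]
    have e2 : ∀ x, a * (H * x) = H * (a * x) := fun x => by rw [← mul_assoc, e1, mul_assoc]
    noncomm_ring
    simp only [e2, e1]
    abel
  have hbound : ∀ t ∈ Set.Ico (0 : ℝ) 1, ‖NormedSpace.exp (t • -H) * (⁅-H, ⁅a, b t⁆⁆ + ⁅a, ⁅G, b t⁆⁆)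
      * NormedSpace.exp (t • -(-H))‖ ≤ c := fun t ht => by
    rw [norm_conj_exp hHstar, hid]
    exact hc t (Set.Ico_subset_Icc_self ht)
  have := norm_image_sub_le_of_norm_deriv_le_segment'
    (fun t _ => (hh t).hasDerivWithinAt) hbound t ht
  have h3 := (norm_le_norm_add_norm_sub' _ _).trans (add_le_add le_rfl this)
  rw [norm_conj_exp hHstar, norm_conj_exp hHstar] at h3
  have h0 : b 0 = B := by simp [hb]
  rw [h0] at h3
  have hc0 : 0 ≤ c := (norm_nonneg _).trans (hc t ht)
  have h4 : c * (t - 0) ≤ c := by nlinarith [ht.1, ht.2]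
  exact h3.trans (add_le_add le_rfl h4)

end conjugation

/-! ### Stability of commutator bounds under short local evolutions. -/

section commBound

variable {Λ : Type*} [Fintype Λ] [DecidableEq Λ] {A : Type*} [NormedRing A] [StarRing A]
  [CStarRing A] [NormedAlgebra ℂ A] [StarModule ℂ A] [FiniteDimensional ℂ A] [CompleteSpace A]
  {L : Finset Λ → Submodule ℂ A} {K : ℕ} {r C : ℝ} {G R B : A} {X : Finset Λ}

/-- The commutators of `B` with the members of a local family add up to at most `C` times the
strength of the family. -/
def CommBound (L : Finset Λ → Submodule ℂ A) (C : ℝ) (B : A) : Prop :=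
  ∀ ⦃K : ℕ⦄ ⦃r : ℝ⦄ ⦃Φ : Finset Λ → A⦄, LocalFamily L K r Φ → ∑ Y, ‖⁅Φ Y, B⁆‖ ≤ C * r

theorem commBound_of_mem (hL : LocalAlgebras L) (hB : B ∈ L X) :
    CommBound L (2 * X.card * ‖B‖) B := by
  intro K r Φ hΦ
  calc ∑ Y, ‖⁅Φ Y, B⁆‖ ≤ ∑ Y, 2 * ‖B‖ * (if ¬Disjoint X Y then ‖Φ Y‖ else 0) := by
        refine Finset.sum_le_sum fun Y _ => ?_
        split_ifs with h
        · rw [hL.lie_eq_zero (hΦ.mem Y) hB h.symm, norm_zero, mul_zero]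
        · exact (norm_lie_le _ _).trans_eq (by ring)
    _ = 2 * ‖B‖ * ∑ Y : Finset Λ with ¬Disjoint X Y, ‖Φ Y‖ := by
        rw [← Finset.mul_sum, Finset.sum_filter]
    _ ≤ 2 * ‖B‖ * (X.card * r) := by
        refine mul_le_mul_of_nonneg_left ?_ (by positivity)
        exact sum_not_disjoint_le (fun _ => norm_nonneg _) hΦ.sum_le X
    _ = 2 * X.card * ‖B‖ * r := by ring

theorem IsLocal.norm_lie_le (h : IsLocal L K r R) (hB : CommBound L C B) : ‖⁅R, B⁆‖ ≤ C * r := by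
  obtain ⟨Φ, hΦ, rfl⟩ := h
  rw [lie_sum_left]
  exact (norm_sum_le _ _).trans (hB hΦ)

/-- A Lieb-Robinson type bound: a short evolution by a local generator at most doubles the constant
in `CommBound`. -/
theorem CommBound.conj_exp [Nonempty Λ] (hL : LocalAlgebras L) (hB : CommBound L C B) (hG : IsLocal L K r G)
    (hstar : star G = -G) (hr : 0 ≤ r) (hC : 0 ≤ C) (hK : 4 * K * r ≤ 1) :
    CommBound L (2 * C) (NormedSpace.exp G * B * NormedSpace.exp (-G)) := by
  obtain ⟨Ψ, hΨ, hΨstar, hGsum⟩ := hG.exists_skewAdjoint hL hstar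
  set b : ℝ → A := fun t => NormedSpace.exp (t • G) * B * NormedSpace.exp (t • -G) with hb
  have hcont : Continuous b := continuous_iff_continuousAt.2 fun t =>
    (hasDerivAt_conj_exp_const G B t).continuousAt
  -- Taking the maximum over the evolution time for each term of the generator separately makes the
  -- estimate below self-consistent; no iteration over paths of overlapping sets is needed.
  have hmax : ∀ Z : Finset Λ, ∃ u ∈ Set.Icc (0 : ℝ) 1, ∀ t ∈ Set.Icc (0 : ℝ) 1,
      ‖⁅Ψ Z, b t⁆‖ ≤ ‖⁅Ψ Z, b u⁆‖ := fun Z => by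
    have : Continuous fun t => ‖⁅Ψ Z, b t⁆‖ := by
      simp only [Ring.lie_def]
      exact ((continuous_const.mul hcont).sub (hcont.mul continuous_const)).norm
    exact isCompact_Icc.exists_isMaxOn (Set.nonempty_Icc.2 zero_le_one) this.continuousOn
  choose u hu hmax using hmax
  set σ : Finset Λ → ℝ := fun Z => ‖⁅Ψ Z, b (u Z)⁆‖ with hσ
  have hσ0 : ∀ Z, 0 ≤ σ Z := fun Z => norm_nonneg _
  have hσK : ∀ Z : Finset Λ, K < Z.card → σ Z = 0 := fun Z hZ => by
    simp [hσ, hΨ.eq_zero Z hZ, Ring.lie_def]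
  -- The terms of the generator that avoid Y commute with `a`, so only those meeting Y enter.
  have key : ∀ (Y : Finset Λ) (a : A), a ∈ L Y → ∀ t ∈ Set.Icc (0 : ℝ) 1,
      ‖⁅a, b t⁆‖ ≤ ‖⁅a, B⁆‖ + 2 * ‖a‖ * ∑ Z : Finset Λ with ¬Disjoint Y Z, σ Z := by
    intro Y a ha t ht
    refine norm_lie_conj_exp_le (G' := ∑ Z : Finset Λ with ¬Disjoint Y Z, Ψ Z) hstar ?_ ?_ ?_ ht
    · rw [star_sum, ← Finset.sum_neg_distrib]
      exact Finset.sum_congr rfl fun Z _ => hΨstar Z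
    · have : G - ∑ Z : Finset Λ with ¬Disjoint Y Z, Ψ Z = ∑ Z : Finset Λ with Disjoint Y Z, Ψ Z := by
        rw [hGsum, ← Finset.sum_filter_add_sum_filter_not Finset.univ (fun Z => Disjoint Y Z) Ψ,
          add_sub_cancel_right]
      rw [this]
      refine Commute.sum_right _ _ _ fun Z hZ => ?_
      have h0 := hL.lie_eq_zero ha (hΨ.mem Z) (Finset.mem_filter.1 hZ).2
      rw [Ring.lie_def] at h0
      exact sub_eq_zero.1 h0
    · intro v hv
      refine (FloquetSpin.norm_lie_le _ _).trans (mul_le_mul_of_nonneg_left ?_ (by positivity))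
      rw [lie_sum_left]
      exact norm_sum_le_of_le _ fun Z _ => hmax Z v hv
  have hswap : ∀ {q : ℝ} {Φ : Finset Λ → A}, (∀ i, ∑ Y : Finset Λ with i ∈ Y, ‖Φ Y‖ ≤ q) → 0 ≤ q →
      ∑ Y, 2 * ‖Φ Y‖ * ∑ Z : Finset Λ with ¬Disjoint Y Z, σ Z ≤ 2 * (K * q * ∑ Z, σ Z) := by
    intro q Φ hΦ hq
    have h := sum_mul_sum_not_disjoint_le (γ := σ) (β := fun Y => ‖Φ Y‖) (fun _ => norm_nonneg _)
      hσ0 hΦ hσK hq Finset.univ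
    refine le_trans (le_of_eq ?_) (mul_le_mul_of_nonneg_left h zero_le_two)
    simp only [Finset.mul_sum, Finset.sum_filter, mul_ite, mul_zero]
    rw [Finset.sum_comm]
    refine Finset.sum_congr rfl fun Z _ => Finset.sum_congr rfl fun Y _ => ?_
    simp only [disjoint_comm (a := Y)]
    split_ifs <;> ring
  -- The sum S of the maxima satisfies S ≤ C r + 2 K r S, and 2 K r ≤ 1/2 absorbs the last term.
  have hS : ∑ Z, σ Z ≤ 2 * C * r := by
    have h1 : ∑ Z, σ Z ≤ C * r + 2 * (K * r * ∑ Z, σ Z) :=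
      calc ∑ Z, σ Z ≤ ∑ Z, (‖⁅Ψ Z, B⁆‖ + 2 * ‖Ψ Z‖ * ∑ W : Finset Λ with ¬Disjoint Z W, σ W) :=
            Finset.sum_le_sum fun Z _ => key Z _ (hΨ.mem Z) _ (hu Z)
        _ ≤ _ := by
            rw [Finset.sum_add_distrib]
            exact add_le_add (hB hΨ) (hswap hΨ.sum_le hr)
    nlinarith [Finset.sum_nonneg fun Z (_ : Z ∈ Finset.univ) => hσ0 Z]
  intro K' q Φ hΦ
  obtain ⟨i⟩ := ‹Nonempty Λ›
  have hq : 0 ≤ q := (Finset.sum_nonneg fun _ _ => norm_nonneg _).trans (hΦ.sum_le i)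
  have h1 : b 1 = NormedSpace.exp G * B * NormedSpace.exp (-G) := by simp [hb]
  rw [← h1]
  calc ∑ Y, ‖⁅Φ Y, b 1⁆‖ ≤ ∑ Y, (‖⁅Φ Y, B⁆‖ + 2 * ‖Φ Y‖ * ∑ W : Finset Λ with ¬Disjoint Y W, σ W) :=
        Finset.sum_le_sum fun Y _ => key Y _ (hΦ.mem Y) _ (by simp)
    _ ≤ C * q + 2 * (K * q * ∑ Z, σ Z) := by
        rw [Finset.sum_add_distrib]
        exact add_le_add (hB hΦ) (hswap hΦ.sum_le hq)
    -- Inserting S ≤ 2 C r gives C q (1 + 4 K r), and 4 K r ≤ 1.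
    _ ≤ 2 * C * q := by
        have h2 := mul_le_mul_of_nonneg_left hS (by positivity : 0 ≤ 2 * (K * q))
        have h3 := mul_le_mul_of_nonneg_left hK (by positivity : 0 ≤ C * q)
        nlinarith

end commBound

/-! ### The logarithmic derivative of the evolution with respect to the coupling -/

section logDeriv

variable {A : Type*} [NormedRing A] [NormedAlgebra ℂ A] [CompleteSpace A] {a : ℝ → A} {T : ℝ}

/-- The coefficients of the power series `v(z) = ∑ z^j v_j` with `U' = v U`, where
`U(z) = ∑ z^m P_m` collects the iterated integrals of `a`. -/
noncomputable def logDerivCoeff (a : ℝ → A) : ℕ → ℝ → A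
  | 0, t => ∫ s in (0 : ℝ)..t, a s
  | m + 1, t => ∫ s in (0 : ℝ)..t, ⁅a s, logDerivCoeff a m s⁆

theorem hasPrimitive_logDerivCoeff_zero (ha : IntervalIntegrable a volume 0 T) :
    HasPrimitive T (logDerivCoeff a 0) a 0 :=
  ⟨ha, fun t _ => by simp [logDerivCoeff]⟩

theorem hasPrimitive_logDerivCoeff_succ (hT : 0 ≤ T) (ha : IntervalIntegrable a volume 0 T)
    (m : ℕ) : HasPrimitive T (logDerivCoeff a (m + 1))
      (fun t => a t * logDerivCoeff a m t - logDerivCoeff a m t * a t) 0 := by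
  have hInt : ∀ {F f : ℝ → A}, HasPrimitive T F f 0 →
      IntervalIntegrable (fun t => a t * F t - F t * a t) volume 0 T := fun hF =>
    (intervalIntegrable_mul_of_continuousOn hT ha (hF.continuousOn hT)).sub
      (intervalIntegrable_continuousOn_mul hT ha (hF.continuousOn hT))
  induction m with
  | zero => exact ⟨hInt (hasPrimitive_logDerivCoeff_zero ha), fun t _ => by
      simp [logDerivCoeff, Ring.lie_def]⟩
  | succ m ih => exact ⟨hInt ih, fun t _ => by simp [logDerivCoeff, Ring.lie_def]⟩

theorem norm_logDerivCoeff_le (hT : 0 ≤ T) (ha : IntervalIntegrable a volume 0 T) (m : ℕ) :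
    ∀ t ∈ Set.Icc 0 T, ‖logDerivCoeff a m t‖ ≤
      2 ^ m * ((∫ s in (0 : ℝ)..t, ‖a s‖) ^ (m + 1) / (m + 1).factorial) := by
  have := norm_le_pow_div_factorial hT ha (F := logDerivCoeff a)
    (G := fun m s => ⁅a s, logDerivCoeff a m s⁆) (K := 1) (L := 2) zero_le_two (p := 1)
    (fun t ht => by
      simpa [logDerivCoeff] using intervalIntegral.norm_integral_le_integral_norm ht.1)
    (fun m t _ => rfl) (fun m t => norm_lie_le _ _) m
  simpa using this

theorem exists_norm_logDerivCoeff_le (hT : 0 ≤ T) (ha : IntervalIntegrable a volume 0 T) {b : ℝ}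
    (hb : 0 < b) : ∃ C, ∀ m, ‖logDerivCoeff a m T‖ ≤ C * b ^ m := by
  set α := ∫ s in (0 : ℝ)..T, ‖a s‖ with hα
  have hα0 : 0 ≤ α := intervalIntegral.integral_nonneg hT fun _ _ => norm_nonneg _
  -- Half the target rate leaves room for the factor 2^m coming from the commutators.
  refine ⟨Real.exp (α / (b / 2)) * (b / 2), fun m => ?_⟩
  refine (norm_logDerivCoeff_le hT ha m T ⟨hT, le_rfl⟩).trans ?_
  calc (2 : ℝ) ^ m * (α ^ (m + 1) / (m + 1).factorial)
      ≤ 2 ^ m * (Real.exp (α / (b / 2)) * (b / 2) ^ (m + 1)) := by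
        gcongr; exact pow_div_factorial_le hα0 (by positivity) _
    _ = Real.exp (α / (b / 2)) * (b / 2) * (2 * (b / 2)) ^ m := by rw [pow_succ, mul_pow]; ring
    _ = _ := by rw [mul_div_cancel₀ b two_ne_zero]

theorem exists_norm_iteratedProd_le (hT : 0 ≤ T) (ha : IntervalIntegrable a volume 0 T) {b : ℝ}
    (hb : 0 < b) : ∃ C, ∀ m, ‖iteratedProd a m T‖ ≤ C * b ^ m := by
  set α := ∫ s in (0 : ℝ)..T, ‖a s‖ with hα
  have hα0 : 0 ≤ α := intervalIntegral.integral_nonneg hT fun _ _ => norm_nonneg _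
  refine ⟨‖(1 : A)‖ * Real.exp (α / b), fun m => ?_⟩
  refine (norm_iteratedProd_le hT ha m T ⟨hT, le_rfl⟩).trans ?_
  rw [mul_assoc]
  gcongr
  exact pow_div_factorial_le hα0 hb _

/-- The time evolution over `[0, T]` with the generator `a` scaled by `z`. -/
noncomputable def evolution (a : ℝ → A) (T : ℝ) (z : ℂ) : A :=
  ∑' m, z ^ m • iteratedProd a m T

/-- The logarithmic derivative of `evolution` with respect to `z`. -/
noncomputable def evolutionLogDeriv (a : ℝ → A) (T : ℝ) (z : ℂ) : A :=
  ∑' m, z ^ m • logDerivCoeff a m T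

theorem hasDerivAt_comp_ofReal {f : ℂ → A} {f' : A} {t : ℝ} (h : HasDerivAt f f' (t : ℂ)) :
    HasDerivAt (fun t : ℝ => f t) f' t := by
  have := HasDerivAt.scomp t h (Complex.ofRealCLM.hasDerivAt (x := t))
  rw [Complex.ofRealCLM_apply, Complex.ofReal_one, one_smul] at this
  exact this

theorem exists_pos_mul_lt_one (z : ℂ) : ∃ b : ℝ, 0 < b ∧ ‖z‖ * b < 1 := by
  refine ⟨1 / (‖z‖ + 1), by positivity, ?_⟩
  rw [mul_one_div, div_lt_one (by positivity)]
  linarith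

theorem evolution_zero : evolution a T 0 = 1 := by
  rw [evolution, tsum_eq_single 0 fun m hm => by simp [hm]]
  simp [iteratedProd]

theorem summable_evolutionLogDeriv (hT : 0 ≤ T) (ha : IntervalIntegrable a volume 0 T) (z : ℂ) :
    Summable fun m => ‖z ^ m • logDerivCoeff a m T‖ := by
  obtain ⟨b, hb, hz⟩ := exists_pos_mul_lt_one z
  obtain ⟨C, hC⟩ := exists_norm_logDerivCoeff_le hT ha hb
  exact summable_norm_pow_smul hb.le hC hz

theorem differentiable_evolutionLogDeriv (hT : 0 ≤ T) (ha : IntervalIntegrable a volume 0 T) :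
    Differentiable ℂ (evolutionLogDeriv a T) := by
  intro z
  obtain ⟨b, hb, hz⟩ := exists_pos_mul_lt_one z
  obtain ⟨C, hC⟩ := exists_norm_logDerivCoeff_le hT ha hb
  exact (hasDerivAt_tsum_pow_smul hb.le hC hz).differentiableAt

/-- Coefficient by coefficient, U' = vU is `sum_mul_iteratedProd` with zero initial values. -/
theorem hasDerivAt_evolution (hT : 0 ≤ T) (ha : IntervalIntegrable a volume 0 T) (z : ℂ) :
    HasDerivAt (evolution a T) (evolutionLogDeriv a T z * evolution a T z) z := by
  obtain ⟨b, hb, hz⟩ := exists_pos_mul_lt_one z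
  obtain ⟨C, hC⟩ := exists_norm_iteratedProd_le hT ha hb
  refine (hasDerivAt_tsum_pow_smul hb.le hC hz).congr_deriv ?_
  rw [evolution, evolutionLogDeriv, tsum_mul_tsum_eq_tsum_sum_antidiagonal_of_summable_norm
    (summable_evolutionLogDeriv hT ha z) (summable_norm_pow_smul hb.le hC hz)]
  refine tsum_congr fun m => ?_
  have h := sum_mul_iteratedProd hT ha (c := fun _ => 0) (hasPrimitive_logDerivCoeff_zero ha)
    (hasPrimitive_logDerivCoeff_succ hT ha) m T ⟨hT, le_rfl⟩
  simp only [mul_zero, Finset.sum_const_zero, add_zero] at h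
  rw [← h, Finset.smul_sum]
  refine Finset.sum_congr rfl fun p hp => ?_
  rw [smul_mul_smul_comm, ← pow_add, Finset.HasAntidiagonal.mem_antidiagonal.1 hp]

variable [StarRing A] [CStarRing A] [StarModule ℂ A]

theorem star_intervalIntegral (f : ℝ → A) (t : ℝ) :
    star (∫ s in (0 : ℝ)..t, f s) = ∫ s in (0 : ℝ)..t, star (f s) := by
  have h : ∀ μ : Measure ℝ, star (∫ s, f s ∂μ) = ∫ s, star (f s) ∂μ := fun μ =>
    ((starL' ℝ : A ≃L[ℝ] A).integral_comp_comm f).symm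
  rw [intervalIntegral, intervalIntegral, star_sub, h, h]

theorem star_lie_of_skew {x y : A} (hx : star x = -x) (hy : star y = -y) : star ⁅x, y⁆ = -⁅x, y⁆ := by
  rw [Ring.lie_def, star_sub, star_mul, star_mul, hx, hy]
  noncomm_ring

theorem star_logDerivCoeff (ha : ∀ t, star (a t) = -a t) (m : ℕ) (t : ℝ) :
    star (logDerivCoeff a m t) = -logDerivCoeff a m t := by
  induction m generalizing t with
  | zero =>
    rw [logDerivCoeff, star_intervalIntegral]
    simp only [ha, intervalIntegral.integral_neg]
  | succ m ih =>
    rw [logDerivCoeff, star_intervalIntegral]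
    simp only [star_lie_of_skew (ha _) (ih _), intervalIntegral.integral_neg]

theorem star_ofReal_smul {x : A} (hx : star x = -x) (t : ℝ) :
    star ((t : ℂ) • x) = -((t : ℂ) • x) := by
  rw [star_smul, hx, RCLike.star_def, Complex.conj_ofReal, smul_neg]

theorem star_evolutionLogDeriv (ha : ∀ t, star (a t) = -a t) (t : ℝ) :
    star (evolutionLogDeriv a T t) = -evolutionLogDeriv a T t := by
  rw [evolutionLogDeriv, tsum_star, ← tsum_neg]
  refine tsum_congr fun m => ?_
  have := star_ofReal_smul (star_logDerivCoeff ha m T) (t ^ m)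
  push_cast at this
  exact this

/-- Unitarity is obtained by differentiating in the real coupling rather than in time: v(t) is
skew-adjoint, so U*U is constant, and U(0) = 1. -/
theorem star_evolution_mul_self (hT : 0 ≤ T) (ha : IntervalIntegrable a volume 0 T)
    (hstar : ∀ t, star (a t) = -a t) (t : ℝ) :
    star (evolution a T t) * evolution a T t = 1 := by
  have hd : ∀ t : ℝ, HasDerivAt (fun t : ℝ => star (evolution a T t) * evolution a T t) 0 t := by
    intro t
    have h1 := hasDerivAt_comp_ofReal (hasDerivAt_evolution hT ha (t : ℂ))
    refine (h1.star.mul h1).congr_deriv ?_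
    rw [star_mul, star_evolutionLogDeriv hstar]
    noncomm_ring
  have hc := is_const_of_deriv_eq_zero (fun t => (hd t).differentiableAt) (fun t => (hd t).deriv)
  rw [hc t 0, Complex.ofReal_zero, evolution_zero, star_one, one_mul]

theorem norm_evolution_le [NormOneClass A] (hT : 0 ≤ T) (ha : IntervalIntegrable a volume 0 T)
    (hstar : ∀ t, star (a t) = -a t) (t : ℝ) : ‖evolution a T t‖ ≤ 1 := by
  have h := CStarRing.norm_star_mul_self (x := evolution a T t)
  rw [star_evolution_mul_self hT ha hstar, norm_one] at h
  nlinarith [norm_nonneg (evolution a T t)]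

end logDeriv

/-! ### The derivative of the exponential -/

section dexp

variable {A : Type*} [NormedRing A] [NormedAlgebra ℂ A] [CompleteSpace A]

/-- The iterated commutators `ad_x^j h`. -/
def iterLie (x h : A) : ℕ → A
  | 0 => h
  | j + 1 => ⁅x, iterLie x h j⁆

theorem norm_iterLie_le (x h : A) (j : ℕ) : ‖iterLie x h j‖ ≤ (2 * ‖x‖) ^ j * ‖h‖ := by
  induction j with
  | zero => simp [iterLie]
  | succ j ih =>
    calc ‖iterLie x h (j + 1)‖ ≤ 2 * ‖x‖ * ‖iterLie x h j‖ := norm_lie_le _ _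
      _ ≤ 2 * ‖x‖ * ((2 * ‖x‖) ^ j * ‖h‖) := by gcongr
      _ = _ := by ring

/-- The terms `ad_x^j h / (j + 1)!` of the logarithmic derivative of the exponential at `x` in the
direction `h`. -/
noncomputable def dexpTerm (x h : A) (j : ℕ) : A :=
  (((j + 1).factorial : ℂ))⁻¹ • iterLie x h j

theorem norm_dexpTerm_le (x h : A) (j : ℕ) :
    ‖dexpTerm x h j‖ ≤ (2 * ‖x‖) ^ j / j.factorial * ‖h‖ := by
  rw [dexpTerm, norm_smul, norm_inv, Complex.norm_natCast]
  calc ((j + 1).factorial : ℝ)⁻¹ * ‖iterLie x h j‖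
      ≤ (j.factorial : ℝ)⁻¹ * ((2 * ‖x‖) ^ j * ‖h‖) := by
        gcongr
        · exact Nat.le_succ j
        · exact norm_iterLie_le x h j
    _ = _ := by ring

theorem summable_norm_dexpTerm (x h : A) : Summable fun j => ‖dexpTerm x h j‖ :=
  Summable.of_nonneg_of_le (fun _ => norm_nonneg _) (norm_dexpTerm_le x h)
    ((Real.summable_pow_div_factorial _).mul_right _)

theorem lie_dexpTerm (x h : A) (j : ℕ) :
    x * dexpTerm x h j = dexpTerm x h j * x + ((j : ℂ) + 2) • dexpTerm x h (j + 1) := by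
  have hj : ((j + 2 : ℕ) : ℂ) ≠ 0 := by exact_mod_cast Nat.succ_ne_zero (j + 1)
  have e : ((j : ℂ) + 2) • dexpTerm x h (j + 1) =
      (((j + 1).factorial : ℂ))⁻¹ • iterLie x h (j + 1) := by
    rw [dexpTerm, smul_smul, Nat.factorial_succ (j + 1)]
    congr 1
    push_cast at hj ⊢
    rw [mul_inv, show (j : ℂ) + 1 + 1 = j + 2 by ring, mul_inv_cancel_left₀ hj]
  rw [e, iterLie, dexpTerm, Ring.lie_def, mul_smul_comm, smul_mul_assoc, ← smul_add]
  congr 1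
  abel

/-- The derivative of `x ^ n / n!` in the direction `h`. -/
noncomputable def powDeriv (x h : A) : ℕ → A
  | 0 => 0
  | n + 1 => ((n : ℂ) + 1)⁻¹ • (h * ((n.factorial : ℂ)⁻¹ • x ^ n) + x * powDeriv x h n)

theorem hasDerivAt_pow_div_factorial {f : ℂ → A} {f' : A} {z : ℂ} (hf : HasDerivAt f f' z) (n : ℕ) :
    HasDerivAt (fun w => (n.factorial : ℂ)⁻¹ • f w ^ n) (powDeriv (f z) f' n) z := by
  induction n with
  | zero => simpa [powDeriv] using hasDerivAt_const z (1 : A)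
  | succ n ih =>
    refine (((hf.mul ih).const_smul ((n : ℂ) + 1)⁻¹).congr_of_eventuallyEq ?_)
    refine Filter.Eventually.of_forall fun w => ?_
    simp only [Pi.smul_apply, Pi.mul_apply]
    rw [mul_smul_comm, smul_smul, ← pow_succ', Nat.factorial_succ, Nat.cast_mul, mul_inv]
    push_cast
    rfl

/-- The identity d exp(x) = (∑ ad_x^j h/(j + 1)!) exp(x), sorted by degree. Moving `x` to the right
through `lie_dexpTerm` produces two sums; with the term starting with `h`, their weights p₂ and p₁ +
1 add up to n + 2. -/
theorem powDeriv_succ (x h : A) (n : ℕ) :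
    powDeriv x h (n + 1) = ∑ p ∈ Finset.HasAntidiagonal.antidiagonal n,
      dexpTerm x h p.1 * ((p.2.factorial : ℂ)⁻¹ • x ^ p.2) := by
  induction n with
  | zero => simp [powDeriv, dexpTerm, iterLie]
  | succ n ih =>
    have hn : ((n + 1 : ℕ) : ℂ) + 1 ≠ 0 := Nat.cast_add_one_ne_zero _
    rw [powDeriv, inv_smul_eq_iff₀ hn, ih]
    set β : ℕ → A := fun l => (l.factorial : ℂ)⁻¹ • x ^ l with hβ
    have hβs : ∀ l, x * β l = ((l : ℂ) + 1) • β (l + 1) := fun l => by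
      simp only [hβ]
      rw [mul_smul_comm, ← pow_succ', smul_smul, Nat.factorial_succ, Nat.cast_mul, mul_inv]
      push_cast
      rw [mul_inv_cancel_left₀ (Nat.cast_add_one_ne_zero l)]
    have h1 : x * ∑ p ∈ Finset.HasAntidiagonal.antidiagonal n, dexpTerm x h p.1 * β p.2 =
        ∑ p ∈ Finset.HasAntidiagonal.antidiagonal n,
          ((p.2 : ℂ) + 1) • (dexpTerm x h p.1 * β (p.2 + 1)) +
        ∑ p ∈ Finset.HasAntidiagonal.antidiagonal n,
          ((p.1 : ℂ) + 2) • (dexpTerm x h (p.1 + 1) * β p.2) := by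
      rw [Finset.mul_sum, ← Finset.sum_add_distrib]
      refine Finset.sum_congr rfl fun p _ => ?_
      rw [← mul_assoc, lie_dexpTerm, add_mul, mul_assoc, hβs, mul_smul_comm, smul_mul_assoc]
    have h2 : ∑ p ∈ Finset.HasAntidiagonal.antidiagonal (n + 1),
        (p.2 : ℂ) • (dexpTerm x h p.1 * β p.2) = ∑ p ∈ Finset.HasAntidiagonal.antidiagonal n,
          ((p.2 : ℂ) + 1) • (dexpTerm x h p.1 * β (p.2 + 1)) := by
      rw [Finset.Nat.sum_antidiagonal_succ']
      simp
    have h3 : ∑ p ∈ Finset.HasAntidiagonal.antidiagonal (n + 1),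
        ((p.1 : ℂ) + 1) • (dexpTerm x h p.1 * β p.2) = h * β (n + 1) +
        ∑ p ∈ Finset.HasAntidiagonal.antidiagonal n,
          ((p.1 : ℂ) + 2) • (dexpTerm x h (p.1 + 1) * β p.2) := by
      rw [Finset.Nat.sum_antidiagonal_succ]
      congr 1
      · simp [dexpTerm, iterLie]
      · refine Finset.sum_congr rfl fun p _ => ?_
        push_cast
        rw [add_assoc, one_add_one_eq_two]
    rw [h1, add_left_comm, ← h3, ← h2, ← Finset.sum_add_distrib, Finset.smul_sum]
    refine Finset.sum_congr rfl fun p hp => ?_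
    rw [← add_smul, ← Finset.HasAntidiagonal.mem_antidiagonal.1 hp]
    congr 1
    push_cast
    ring

theorem norm_pow_le_norm_one_mul (x : A) (n : ℕ) : ‖x ^ n‖ ≤ ‖(1 : A)‖ * ‖x‖ ^ n := by
  induction n with
  | zero => simp
  | succ n ih =>
    rw [pow_succ, pow_succ, ← mul_assoc]
    exact (norm_mul_le _ _).trans (mul_le_mul_of_nonneg_right ih (norm_nonneg _))

theorem norm_powDeriv_le {x h : A} {M N : ℝ} (hx : ‖x‖ ≤ M) (hh : ‖h‖ ≤ N) (n : ℕ) :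
    ‖powDeriv x h n‖ ≤ N * ‖(1 : A)‖ * (M ^ (n - 1) / (n - 1).factorial) := by
  have hM : 0 ≤ M := (norm_nonneg _).trans hx
  have hN : 0 ≤ N := (norm_nonneg _).trans hh
  induction n with
  | zero => rw [powDeriv, norm_zero]; positivity
  | succ n ih =>
    have hn : ‖((n : ℂ) + 1)⁻¹‖ = ((n : ℝ) + 1)⁻¹ := by
      rw [norm_inv]; norm_cast
    have h1 : ‖h * ((n.factorial : ℂ)⁻¹ • x ^ n)‖ ≤ N * ‖(1 : A)‖ * (M ^ n / n.factorial) := by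
      calc ‖h * ((n.factorial : ℂ)⁻¹ • x ^ n)‖ ≤ ‖h‖ * ‖(n.factorial : ℂ)⁻¹ • x ^ n‖ :=
            norm_mul_le _ _
        _ ≤ N * ((n.factorial : ℝ)⁻¹ * (‖(1 : A)‖ * M ^ n)) := by
          rw [norm_smul, norm_inv, Complex.norm_natCast]
          gcongr
          exact (norm_pow_le_norm_one_mul x n).trans (by gcongr)
        _ = _ := by ring
    have h2 : ‖x * powDeriv x h n‖ ≤ n * (N * ‖(1 : A)‖ * (M ^ n / n.factorial)) := by
      cases n with
      | zero => simp [powDeriv]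
      | succ n =>
        calc ‖x * powDeriv x h (n + 1)‖ ≤ ‖x‖ * ‖powDeriv x h (n + 1)‖ := norm_mul_le _ _
          _ ≤ M * (N * ‖(1 : A)‖ * (M ^ n / n.factorial)) := by gcongr; exact ih
          _ = _ := by
            rw [Nat.factorial_succ]
            push_cast
            field_simp
            ring
    rw [powDeriv, norm_smul, hn, inv_mul_le_iff₀ (by positivity), Nat.add_sub_cancel]
    refine (norm_add_le _ _).trans ((add_le_add h1 h2).trans_eq ?_)
    ring

theorem summable_pow_div_factorial_smul (x : A) :
    Summable fun n : ℕ => ‖(n.factorial : ℂ)⁻¹ • x ^ n‖ :=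
  NormedSpace.norm_expSeries_summable' (𝕂 := ℂ) x

/-- Termwise differentiation of the exponential series. Compactness of a closed disc bounds `f` and
`f'`, which gives the uniform summable majorant. -/
theorem hasDerivAt_exp_comp {f f' : ℂ → A} (hf : ∀ z, HasDerivAt f (f' z) z)
    (hf' : Continuous f') (z : ℂ) :
    HasDerivAt (fun z => NormedSpace.exp (f z))
      ((∑' j, dexpTerm (f z) (f' z) j) * NormedSpace.exp (f z)) z := by
  have hfc : Continuous f := continuous_iff_continuousAt.2 fun z => (hf z).continuousAt
  obtain ⟨M, hM⟩ := (isCompact_closedBall z 1).exists_bound_of_continuousOn hfc.continuousOn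
  obtain ⟨N, hN⟩ := (isCompact_closedBall z 1).exists_bound_of_continuousOn hf'.continuousOn
  have hz : z ∈ Metric.ball z 1 := Metric.mem_ball_self one_pos
  have husum : Summable fun n : ℕ => N * ‖(1 : A)‖ * (M ^ (n - 1) / (n - 1).factorial) :=
    (summable_nat_add_iff 1).1 (by
      simpa using (Real.summable_pow_div_factorial M).mul_left (N * ‖(1 : A)‖))
  have hbound : ∀ (n : ℕ), ∀ w ∈ Metric.ball z 1, ‖powDeriv (f w) (f' w) n‖ ≤
      N * ‖(1 : A)‖ * (M ^ (n - 1) / (n - 1).factorial) := fun n w hw =>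
    norm_powDeriv_le (hM w (Metric.ball_subset_closedBall hw))
      (hN w (Metric.ball_subset_closedBall hw)) n
  have hderiv : ∀ (n : ℕ), ∀ w ∈ Metric.ball z 1,
      HasDerivAt (fun w => (n.factorial : ℂ)⁻¹ • f w ^ n) (powDeriv (f w) (f' w) n) w :=
    fun n w _ => hasDerivAt_pow_div_factorial (hf w) n
  have hsum : Summable fun n : ℕ => (n.factorial : ℂ)⁻¹ • f z ^ n :=
    (summable_pow_div_factorial_smul (f z)).of_norm
  have h := hasDerivAt_tsum_of_isPreconnected husum Metric.isOpen_ball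
    (convex_ball z 1).isPreconnected hderiv hbound hz hsum hz
  have hexp : (fun z => NormedSpace.exp (f z)) = fun w => ∑' n : ℕ, (n.factorial : ℂ)⁻¹ • f w ^ n := by
    ext w; rw [NormedSpace.exp_eq_tsum ℂ]
  rw [hexp]
  refine h.congr_deriv ?_
  have hs : Summable fun n => powDeriv (f z) (f' z) n :=
    Summable.of_norm_bounded husum fun n => hbound n z hz
  rw [hs.tsum_eq_zero_add, powDeriv, zero_add, congrFun hexp z,
    tsum_mul_tsum_eq_tsum_sum_antidiagonal_of_summable_norm
      (summable_norm_dexpTerm _ _) (summable_pow_div_factorial_smul (f z))]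
  exact tsum_congr fun n => powDeriv_succ _ _ n

end dexp

/-! ### Locality of the coefficients -/

section skewAdjoint

variable {A : Type*} [NormedRing A] [NormedAlgebra ℂ A] [CompleteSpace A] [StarRing A]
  [CStarRing A] [StarModule ℂ A] {a : ℝ → A} {T : ℝ}

theorem star_orderedIntegral (m : ℕ) : ∀ (u : ℝ) (f : (Fin m → ℝ) → A),
    star (orderedIntegral m u f) = orderedIntegral m u fun t => star (f t) := by
  induction m with
  | zero => intro u f; rfl
  | succ m ih =>
    intro u f
    simp only [orderedIntegral, star_intervalIntegral, ih]

theorem star_nestedCommutator (m : ℕ) : ∀ b : Fin (m + 1) → A, (∀ j, star (b j) = -b j) →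
    star (nestedCommutator m b) = -nestedCommutator m b := by
  induction m with
  | zero => intro b hb; exact hb 0
  | succ m ih =>
    intro b hb
    exact star_lie_of_skew (hb 0) (ih _ fun j => hb j.succ)

theorem star_magnusCoeff (hT : 0 ≤ T) (ha : IntervalIntegrable a volume 0 T)
    (hstar : ∀ t, star (a t) = -a t) (m : ℕ) :
    star (magnusCoeff a T m) = -magnusCoeff a T m := by
  rw [magnusCoeff_eq_sum_perm hT ha, star_sum, ← Finset.sum_neg_distrib]
  refine Finset.sum_congr rfl fun σ _ => star_ofReal_smul ?_ _
  rw [star_orderedIntegral]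
  simp only [star_nestedCommutator m _ fun j => hstar _]
  simpa using orderedIntegral_smul (m + 1) (-1) T
    fun t => nestedCommutator m fun j => a (t (σ j))

end skewAdjoint

/-! ### Strength per site of the series coefficients. -/

section locality

variable {Λ : Type*} [Fintype Λ] [DecidableEq Λ] {A : Type*} [NormedRing A] [StarRing A]
  [CStarRing A] [NormedAlgebra ℂ A] [StarModule ℂ A] [FiniteDimensional ℂ A] [CompleteSpace A]
  {L : Finset Λ → Submodule ℂ A} {k K : ℕ} {g r ω ω' C T : ℝ} {x h B : A} {a : ℝ → A}

/-- The support grows to (j + 2)k sites, so the next commutator costs 2(j + 2)kg. The integral of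
u^{j+1} returns 1/(j + 2), hence no factorial survives and the series has a radius independent of
the volume. -/
theorem isLocal_logDerivCoeff (hL : LocalAlgebras L) (hg : 0 ≤ g)
    (ha : ∀ t ∈ Set.Icc 0 T, IsLocal L k g (a t)) (j : ℕ) : ∀ t ∈ Set.Icc 0 T,
      IsLocal L ((j + 1) * k) (g * (2 * k * g) ^ j * t ^ (j + 1)) (logDerivCoeff a j t) := by
  induction j with
  | zero =>
    intro t ht
    have e : ∫ _ in (0 : ℝ)..t, g = g * t := by simp [mul_comm]
    have := isLocal_intervalIntegral (L := L) (K := k) (f := a) (w := fun _ => g) ht.1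
      (by simp) (by rw [e]; exact mul_nonneg hg ht.1)
      (fun u hu => ha u ⟨hu.1.le, hu.2.trans ht.2⟩)
    rw [e] at this
    simpa [logDerivCoeff] using this
  | succ j ih =>
    intro t ht
    set c : ℝ := 2 * (k + ((j + 1) * k : ℕ)) * g * (g * (2 * k * g) ^ j) with hc
    have e : ∫ u in (0 : ℝ)..t, c * u ^ (j + 1) = g * (2 * k * g) ^ (j + 1) * t ^ (j + 1 + 1) := by
      rw [intervalIntegral.integral_const_mul, integral_pow, hc]
      have : (j : ℝ) + 1 + 1 ≠ 0 := by positivity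
      push_cast
      field_simp
      ring
    have := isLocal_intervalIntegral (L := L) (K := (j + 1 + 1) * k)
      (f := fun s => ⁅a s, logDerivCoeff a j s⁆) (w := fun u => c * u ^ (j + 1)) ht.1
      (Continuous.intervalIntegrable (by fun_prop) _ _)
      (by rw [e]; exact mul_nonneg (by positivity) (pow_nonneg ht.1 _))
      (fun u hu => by
        have hu' : u ∈ Set.Icc 0 T := ⟨hu.1.le, hu.2.trans ht.2⟩
        refine ((ha u hu').lie hL (ih u hu') hg
          (mul_nonneg (by positivity) (pow_nonneg hu.1.le _))).mono (le_of_eq (by ring))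
          (le_of_eq ?_)
        rw [hc]; ring)
    rw [e] at this
    exact this

theorem isLocal_nestedCommutator (hL : LocalAlgebras L) (hg : 0 ≤ g) (m : ℕ) :
    ∀ b : Fin (m + 1) → A, (∀ j, IsLocal L k g (b j)) →
      IsLocal L ((m + 1) * k) (g * (2 * k * g) ^ m * (m + 1).factorial) (nestedCommutator m b) := by
  induction m with
  | zero => intro b hb; simpa [nestedCommutator] using hb 0
  | succ m ih =>
    intro b hb
    refine ((hb 0).lie hL (ih _ fun j => hb j.succ) hg (by positivity)).mono (le_of_eq (by ring))
      (le_of_eq ?_)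
    rw [Nat.factorial_succ (m + 1)]
    push_cast
    ring

theorem isLocal_orderedIntegral (hr : 0 ≤ r) (m : ℕ) : ∀ u ∈ Set.Icc 0 T,
    ∀ f : (Fin m → ℝ) → A, (∀ t, (∀ i, t i ∈ Set.Icc 0 T) → IsLocal L K r (f t)) →
      IsLocal L K (r * T ^ m) (orderedIntegral m u f) := by
  induction m with
  | zero => intro u _ f hf; simpa [orderedIntegral] using hf Fin.elim0 fun i => i.elim0
  | succ m ih =>
    intro u hu f hf
    have hT : 0 ≤ T := hu.1.trans hu.2
    have e : ∫ _ in (0 : ℝ)..u, r * T ^ m = u * (r * T ^ m) := by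
      rw [intervalIntegral.integral_const, sub_zero, smul_eq_mul]
    have := isLocal_intervalIntegral (L := L) (K := K)
      (f := fun t₁ => orderedIntegral m t₁ fun t => f (Fin.cons t₁ t)) (w := fun _ => r * T ^ m)
      hu.1 (by simp) (by rw [e]; exact mul_nonneg hu.1 (by positivity))
      (fun t₁ ht₁ => ih t₁ ⟨ht₁.1.le, ht₁.2.trans hu.2⟩ _ fun t ht => hf _ fun i => by
        refine Fin.cases ?_ (fun i => ?_) i
        · exact ⟨ht₁.1.le, ht₁.2.trans hu.2⟩
        · exact ht i)
    rw [e] at this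
    refine this.mono le_rfl ?_
    calc u * (r * T ^ m) ≤ T * (r * T ^ m) := by gcongr; exact hu.2
      _ = r * T ^ (m + 1) := by ring

/-- A bound, up to the factor `T ^ (m + 1)`, for the local strength of `magnusCoeff a T m`. -/
noncomputable def magnusBound (k : ℕ) (g : ℝ) (m : ℕ) : ℝ :=
  ∑ σ : Equiv.Perm (Fin (m + 1)),
    ‖(((-1) ^ (m - ascents σ) * ((ascents σ).factorial * (m - ascents σ).factorial) /
      (((m : ℝ) + 1) * (m + 1).factorial) : ℝ) : ℂ)‖ * (g * (2 * k * g) ^ m * (m + 1).factorial)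

theorem magnusBound_nonneg (hg : 0 ≤ g) (m : ℕ) : 0 ≤ magnusBound k g m :=
  Finset.sum_nonneg fun _ _ => by positivity

theorem isLocal_magnusCoeff (hL : LocalAlgebras L) (hg : 0 ≤ g) (hT : 0 ≤ T)
    (ha : IntervalIntegrable a volume 0 T) (hloc : ∀ t ∈ Set.Icc 0 T, IsLocal L k g (a t)) (m : ℕ) :
    IsLocal L ((m + 1) * k) (magnusBound k g m * T ^ (m + 1)) (magnusCoeff a T m) := by
  rw [magnusCoeff_eq_sum_perm hT ha, magnusBound, Finset.sum_mul]
  refine isLocal_sum _ fun σ _ => ?_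
  rw [mul_assoc]
  refine IsLocal.smul ?_ _
  refine isLocal_orderedIntegral (by positivity) (m + 1) T ⟨hT, le_rfl⟩ _ fun t ht => ?_
  exact isLocal_nestedCommutator hL hg m _ fun j => hloc _ (ht _)

theorem isLocal_iterLie (hL : LocalAlgebras L) (hx : IsLocal L K ω x) (hh : IsLocal L K ω' h)
    (hω : 0 ≤ ω) (hω' : 0 ≤ ω') (j : ℕ) :
    IsLocal L ((j + 1) * K) ((2 * K * ω) ^ j * (j + 1).factorial * ω') (iterLie x h j) := by
  induction j with
  | zero => simpa [iterLie] using hh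
  | succ j ih =>
    refine (hx.lie hL ih hω (by positivity)).mono (le_of_eq (by ring)) (le_of_eq ?_)
    rw [Nat.factorial_succ (j + 1)]
    push_cast
    ring

theorem norm_lie_tsum_le {f : ℕ → A} {c : ℝ} (hf : Summable f)
    (hc : ∀ j, ‖⁅f j, B⁆‖ ≤ c * (1 / 2) ^ j) : ‖⁅∑' j, f j, B⁆‖ ≤ 2 * c := by
  have e : ⁅∑' j, f j, B⁆ = ∑' j, ⁅f j, B⁆ := by
    simp only [Ring.lie_def]
    rw [(hf.mul_right B).tsum_sub (hf.mul_left B), hf.tsum_mul_right, hf.tsum_mul_left]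
  rw [e]
  have h2 := (hasSum_geometric_two).mul_left c
  rw [mul_comm c 2] at h2
  exact tsum_of_norm_bounded h2 hc

/-- The factor (j + 1)! in the strength of the iterated commutators is cancelled by the coefficient
of `dexpTerm`. What remains is a geometric series of ratio 2Kω ≤ 1/2. -/
theorem norm_lie_tsum_dexpTerm_le (hL : LocalAlgebras L) (hx : IsLocal L K ω x)
    (hh : IsLocal L K ω' h) (hω : 0 ≤ ω) (hω' : 0 ≤ ω') (hB : CommBound L C B) (hC : 0 ≤ C)
    (hK : 4 * K * ω ≤ 1) : ‖⁅∑' j, dexpTerm x h j, B⁆‖ ≤ 2 * (C * ω') := by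
  refine norm_lie_tsum_le (summable_norm_dexpTerm x h).of_norm fun j => ?_
  have h1 := ((isLocal_iterLie hL hx hh hω hω' j).smul ((j + 1).factorial : ℂ)⁻¹).norm_lie_le hB
  refine h1.trans ?_
  rw [norm_inv, Complex.norm_natCast]
  have hf : ((j + 1).factorial : ℝ) ≠ 0 := by positivity
  calc C * (((j + 1).factorial : ℝ)⁻¹ * ((2 * K * ω) ^ j * (j + 1).factorial * ω'))
      = C * ω' * (2 * K * ω) ^ j := by field_simp
    _ ≤ C * ω' * (1 / 2) ^ j := by gcongr; linarith

theorem norm_lie_evolutionLogDeriv_le (hL : LocalAlgebras L) (hg : 0 ≤ g) (hT : 0 ≤ T)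
    (ha : IntervalIntegrable a volume 0 T) (hloc : ∀ t ∈ Set.Icc 0 T, IsLocal L k g (a t))
    (hB : CommBound L C B) (hC : 0 ≤ C) {z : ℂ} (hz : 4 * k * g * (‖z‖ * T) ≤ 1) :
    ‖⁅evolutionLogDeriv a T z, B⁆‖ ≤ 2 * (C * (g * T)) := by
  refine norm_lie_tsum_le (summable_evolutionLogDeriv hT ha z).of_norm fun j => ?_
  have h1 := ((isLocal_logDerivCoeff hL hg hloc j T ⟨hT, le_rfl⟩).smul (z ^ j)).norm_lie_le hB
  refine h1.trans ?_
  rw [norm_pow]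
  calc C * (‖z‖ ^ j * (g * (2 * k * g) ^ j * T ^ (j + 1)))
      = C * (g * T) * (2 * k * g * (‖z‖ * T)) ^ j := by
        rw [mul_pow (2 * k * g) (‖z‖ * T), mul_pow ‖z‖ T]; ring
    _ ≤ C * (g * T) * (1 / 2) ^ j := by gcongr; linarith

end locality

/-! ### The logarithmic derivative of the truncated Magnus expansion -/

/-- Cauchy's estimate on circles about z of radius R > ‖z‖, on which every point has norm at most
2R; then R decreases to ‖z‖. -/
theorem deriv_isBigO_pow {E : Type*} [NormedAddCommGroup E] [NormedSpace ℂ E] {f : ℂ → E}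
    (hf : Differentiable ℂ f) {m : ℕ} (h : f =O[nhds 0] fun z => z ^ (m + 1)) :
    deriv f =O[nhds 0] fun z => z ^ m := by
  obtain ⟨C, hC0, hC⟩ := h.exists_pos
  obtain ⟨δ, hδ, hball⟩ := Metric.eventually_nhds_iff_ball.1 hC.bound
  refine Asymptotics.IsBigO.of_bound (C * 2 ^ (m + 1)) ?_
  filter_upwards [Metric.ball_mem_nhds (0 : ℂ) (half_pos hδ)] with z hz
  rw [mem_ball_zero_iff] at hz
  have hR : ∀ R ∈ Set.Ioo ‖z‖ (δ / 2), ‖deriv f z‖ ≤ C * 2 ^ (m + 1) * R ^ m := by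
    intro R hR
    have hR0 : 0 < R := (norm_nonneg z).trans_lt hR.1
    have h1 := Complex.norm_deriv_le_of_forall_mem_sphere_norm_le (c := z) (f := f)
      (C := C * (2 * R) ^ (m + 1)) hR0 hf.diffContOnCl fun w hw => by
        have hw2 : ‖w‖ ≤ 2 * R := by
          have := norm_le_norm_add_norm_sub' w z
          rw [← dist_eq_norm w z, Metric.mem_sphere.1 hw] at this
          linarith [hR.1]
        refine (hball w ?_).trans ?_
        · rw [mem_ball_zero_iff]; linarith [hR.2]
        · rw [norm_pow]; gcongr
    refine h1.trans_eq ?_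
    rw [mul_pow, pow_succ R]
    field_simp
  have hlim : Filter.Tendsto (fun R : ℝ => C * 2 ^ (m + 1) * R ^ m) (nhdsWithin ‖z‖ (Set.Ioi ‖z‖))
      (nhds (C * 2 ^ (m + 1) * ‖z‖ ^ m)) :=
    (Continuous.tendsto (by fun_prop) _).mono_left nhdsWithin_le_nhds
  rw [norm_pow]
  refine ge_of_tendsto hlim ?_
  filter_upwards [Ioo_mem_nhdsGT hz] with R hR'
  exact hR R hR'

section magnusSum

variable {A : Type*} [NormedRing A] [NormedAlgebra ℂ A] [CompleteSpace A] {a : ℝ → A} {T : ℝ}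
  {n : ℕ}

/-- The truncated Magnus expansion with the generator scaled by `z`. -/
noncomputable def magnusSum (a : ℝ → A) (T : ℝ) (n : ℕ) (z : ℂ) : A :=
  ∑ m ∈ Finset.range (n + 1), z ^ (m + 1) • magnusCoeff a T m

/-- The derivative of `magnusSum`. -/
noncomputable def magnusSumDeriv (a : ℝ → A) (T : ℝ) (n : ℕ) (z : ℂ) : A :=
  ∑ m ∈ Finset.range (n + 1), (((m : ℂ) + 1) * z ^ m) • magnusCoeff a T m

/-- The logarithmic derivative of the exponential of `magnusSum`. -/
noncomputable def magnusLogDeriv (a : ℝ → A) (T : ℝ) (n : ℕ) (z : ℂ) : A :=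
  ∑' j, dexpTerm (magnusSum a T n z) (magnusSumDeriv a T n z) j

theorem hasDerivAt_magnusSum (z : ℂ) :
    HasDerivAt (magnusSum a T n) (magnusSumDeriv a T n z) z := by
  refine HasDerivAt.fun_sum fun m _ => ?_
  have := (hasDerivAt_pow (m + 1) z).smul_const (magnusCoeff a T m)
  push_cast at this
  exact this

theorem continuous_magnusSumDeriv : Continuous (magnusSumDeriv a T n) := by
  unfold magnusSumDeriv
  fun_prop

theorem magnusSum_zero : magnusSum a T n 0 = 0 := by simp [magnusSum]

theorem hasDerivAt_exp_magnusSum (z : ℂ) :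
    HasDerivAt (fun z => NormedSpace.exp (magnusSum a T n z))
      (magnusLogDeriv a T n z * NormedSpace.exp (magnusSum a T n z)) z :=
  hasDerivAt_exp_comp hasDerivAt_magnusSum continuous_magnusSumDeriv z

theorem exp_mul_exp_neg (x : A) : NormedSpace.exp x * NormedSpace.exp (-x) = 1 := by
  rw [← exp_add_of_commute_complex (Commute.neg_right (Commute.refl x)), add_neg_cancel,
    NormedSpace.exp_zero]

theorem exp_neg_mul_exp (x : A) : NormedSpace.exp (-x) * NormedSpace.exp x = 1 := by
  simpa using exp_mul_exp_neg (-x)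

/-- The derivative exists by the chain rule, and its value follows from differentiating exp(-Ω)
exp(Ω) = 1. -/
theorem hasDerivAt_exp_neg_magnusSum (z : ℂ) :
    HasDerivAt (fun z => NormedSpace.exp (-magnusSum a T n z))
      (-(NormedSpace.exp (-magnusSum a T n z) * magnusLogDeriv a T n z)) z := by
  have h1 := hasDerivAt_exp_comp (f := fun z => -magnusSum a T n z)
    (f' := fun z => -magnusSumDeriv a T n z) (fun z => (hasDerivAt_magnusSum z).neg)
    continuous_magnusSumDeriv.neg z
  refine h1.congr_deriv ?_
  set Y := ∑' j, dexpTerm (-magnusSum a T n z) (-magnusSumDeriv a T n z) j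
  have h2 := h1.mul (hasDerivAt_exp_magnusSum (a := a) (T := T) (n := n) z)
  have h3 : HasDerivAt ((fun z => NormedSpace.exp (-magnusSum a T n z)) *
      fun z => NormedSpace.exp (magnusSum a T n z)) 0 z := by
    refine (hasDerivAt_const z (1 : A)).congr_of_eventuallyEq (Filter.Eventually.of_forall ?_)
    exact fun z => exp_neg_mul_exp _
  have h4 := h2.unique h3
  rw [mul_assoc, exp_neg_mul_exp, mul_one, ← mul_assoc] at h4
  have h5 := eq_neg_of_add_eq_zero_left h4
  rw [h5, neg_mul, mul_assoc, exp_mul_exp_neg, mul_one]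

theorem magnusLogDeriv_eq (z : ℂ) : magnusLogDeriv a T n z =
    deriv (fun z => NormedSpace.exp (magnusSum a T n z)) z *
      NormedSpace.exp (-magnusSum a T n z) := by
  rw [(hasDerivAt_exp_magnusSum z).deriv, mul_assoc, exp_mul_exp_neg, mul_one]

theorem differentiable_magnusLogDeriv : Differentiable ℂ (magnusLogDeriv a T n) := by
  have h1 : Differentiable ℂ fun z => NormedSpace.exp (magnusSum a T n z) := fun z =>
    (hasDerivAt_exp_magnusSum z).differentiableAt
  have h2 : Differentiable ℂ fun z => NormedSpace.exp (-magnusSum a T n z) := fun z =>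
    (hasDerivAt_exp_neg_magnusSum z).differentiableAt
  rw [show magnusLogDeriv a T n = _ from funext magnusLogDeriv_eq]
  exact h1.deriv.mul h2

/-- From (w - v) exp Ω = (exp Ω - U)' - v (exp Ω - U), where exp Ω - U = O(z^{n+2}). Differentiation
loses one order, and v and exp(-Ω) are bounded near 0. -/
theorem magnusLogDeriv_sub_isBigO (hT : 0 ≤ T) (ha : IntervalIntegrable a volume 0 T) :
    (fun z => magnusLogDeriv a T n z - evolutionLogDeriv a T z) =O[nhds 0]
      fun z : ℂ => z ^ (n + 1) := by
  have hE : (fun z => NormedSpace.exp (magnusSum a T n z) - evolution a T z) =O[nhds 0]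
      fun z : ℂ => z ^ (n + 1 + 1) := exp_magnusCoeff_isBigO hT ha (n + 1)
  have hd : ∀ z, HasDerivAt (fun z => NormedSpace.exp (magnusSum a T n z) - evolution a T z)
      (magnusLogDeriv a T n z * NormedSpace.exp (magnusSum a T n z) -
        evolutionLogDeriv a T z * evolution a T z) z := fun z =>
    (hasDerivAt_exp_magnusSum z).sub (hasDerivAt_evolution hT ha z)
  have h1 := deriv_isBigO_pow (fun z => (hd z).differentiableAt) hE
  have hv : evolutionLogDeriv a T =O[nhds 0] fun _ => (1 : ℂ) :=
    ((differentiable_evolutionLogDeriv hT ha).continuous.tendsto 0).isBigO_one ℂ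
  have hV : (fun z => NormedSpace.exp (-magnusSum a T n z)) =O[nhds 0] fun _ => (1 : ℂ) :=
    (hasDerivAt_exp_neg_magnusSum 0).continuousAt.tendsto.isBigO_one ℂ
  have h2 : (fun z => evolutionLogDeriv a T z *
      (NormedSpace.exp (magnusSum a T n z) - evolution a T z)) =O[nhds 0]
      fun z : ℂ => z ^ (n + 1) := by
    refine (hv.mul hE).trans ?_
    simp only [one_mul]
    exact (Asymptotics.isLittleO_pow_pow (Nat.lt_succ_self _)).isBigO
  have h3 := (h1.sub h2).mul hV
  simp only [mul_one] at h3
  refine h3.congr_left fun z => ?_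
  rw [(hd z).deriv]
  have e := exp_mul_exp_neg (magnusSum a T n z)
  calc _ = (magnusLogDeriv a T n z - evolutionLogDeriv a T z) *
        (NormedSpace.exp (magnusSum a T n z) * NormedSpace.exp (-magnusSum a T n z)) := by
          noncomm_ring
    _ = _ := by rw [e, mul_one]

variable [StarRing A] [CStarRing A] [StarModule ℂ A]

theorem star_magnusSum (hT : 0 ≤ T) (ha : IntervalIntegrable a volume 0 T)
    (hstar : ∀ t, star (a t) = -a t) (t : ℝ) :
    star (magnusSum a T n t) = -magnusSum a T n t := by
  rw [magnusSum, star_sum, ← Finset.sum_neg_distrib]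
  refine Finset.sum_congr rfl fun m _ => ?_
  have := star_ofReal_smul (star_magnusCoeff hT ha hstar m) (t ^ (m + 1))
  push_cast at this
  exact this

theorem star_magnusSumDeriv (hT : 0 ≤ T) (ha : IntervalIntegrable a volume 0 T)
    (hstar : ∀ t, star (a t) = -a t) (t : ℝ) :
    star (magnusSumDeriv a T n t) = -magnusSumDeriv a T n t := by
  rw [magnusSumDeriv, star_sum, ← Finset.sum_neg_distrib]
  refine Finset.sum_congr rfl fun m _ => ?_
  have := star_ofReal_smul (star_magnusCoeff hT ha hstar m) (((m : ℝ) + 1) * t ^ m)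
  push_cast at this
  exact this

theorem star_iterLie {x h : A} (hx : star x = -x) (hh : star h = -h) (j : ℕ) :
    star (iterLie x h j) = -iterLie x h j := by
  induction j with
  | zero => exact hh
  | succ j ih => exact star_lie_of_skew hx ih

theorem star_magnusLogDeriv (hT : 0 ≤ T) (ha : IntervalIntegrable a volume 0 T)
    (hstar : ∀ t, star (a t) = -a t) (t : ℝ) :
    star (magnusLogDeriv a T n t) = -magnusLogDeriv a T n t := by
  rw [magnusLogDeriv, tsum_star, ← tsum_neg]
  refine tsum_congr fun j => ?_
  have := star_ofReal_smul (star_iterLie (star_magnusSum (n := n) hT ha hstar t)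
    (star_magnusSumDeriv (n := n) hT ha hstar t) j) (((j + 1).factorial : ℝ)⁻¹)
  push_cast at this
  exact this

end magnusSum

/-! ### Schwarz estimate for the difference of the logarithmic derivatives. -/

section locality

variable {Λ : Type*} [Fintype Λ] [DecidableEq Λ] {A : Type*} [NormedRing A] [StarRing A]
  [CStarRing A] [NormedAlgebra ℂ A] [StarModule ℂ A] [FiniteDimensional ℂ A] [CompleteSpace A]
  {L : Finset Λ → Submodule ℂ A} {k n : ℕ} {g ρ C T : ℝ} {B : A} {a : ℝ → A}

/-- A bound for the local strength of `magnusSum`, where `x` is the size of the generator. -/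
noncomputable def magnusSumBound (k : ℕ) (g : ℝ) (n : ℕ) (x : ℝ) : ℝ :=
  ∑ m ∈ Finset.range (n + 1), magnusBound k g m * x ^ (m + 1)

/-- A bound for the local strength of `magnusSumDeriv`. -/
noncomputable def magnusSumDerivBound (k : ℕ) (g : ℝ) (n : ℕ) (x : ℝ) : ℝ :=
  ∑ m ∈ Finset.range (n + 1), ((m : ℝ) + 1) * magnusBound k g m * x ^ m

theorem magnusSumBound_nonneg (hg : 0 ≤ g) {x : ℝ} (hx : 0 ≤ x) : 0 ≤ magnusSumBound k g n x :=
  Finset.sum_nonneg fun m _ => mul_nonneg (magnusBound_nonneg hg m) (by positivity)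

theorem magnusSumDerivBound_nonneg (hg : 0 ≤ g) {x : ℝ} (hx : 0 ≤ x) :
    0 ≤ magnusSumDerivBound k g n x :=
  Finset.sum_nonneg fun m _ =>
    mul_nonneg (mul_nonneg (by positivity) (magnusBound_nonneg hg m)) (by positivity)

theorem isLocal_magnusSum (hL : LocalAlgebras L) (hg : 0 ≤ g) (hT : 0 ≤ T)
    (ha : IntervalIntegrable a volume 0 T) (hloc : ∀ t ∈ Set.Icc 0 T, IsLocal L k g (a t))
    {z : ℂ} (hz : ‖z‖ ≤ ρ) :
    IsLocal L ((n + 1) * k) (magnusSumBound k g n (ρ * T)) (magnusSum a T n z) := by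
  refine isLocal_sum _ fun m hm => ?_
  refine ((isLocal_magnusCoeff hL hg hT ha hloc m).smul (z ^ (m + 1))).mono ?_ ?_
  · exact Nat.mul_le_mul_right k (Finset.mem_range.1 hm)
  · rw [norm_pow]
    have := magnusBound_nonneg (k := k) hg m
    calc ‖z‖ ^ (m + 1) * (magnusBound k g m * T ^ (m + 1))
        ≤ ρ ^ (m + 1) * (magnusBound k g m * T ^ (m + 1)) := by gcongr
      _ = _ := by rw [mul_pow]; ring

theorem isLocal_magnusSumDeriv (hL : LocalAlgebras L) (hg : 0 ≤ g) (hT : 0 ≤ T)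
    (ha : IntervalIntegrable a volume 0 T) (hloc : ∀ t ∈ Set.Icc 0 T, IsLocal L k g (a t))
    {z : ℂ} (hz : ‖z‖ ≤ ρ) :
    IsLocal L ((n + 1) * k) (T * magnusSumDerivBound k g n (ρ * T)) (magnusSumDeriv a T n z) := by
  rw [magnusSumDerivBound, Finset.mul_sum]
  refine isLocal_sum _ fun m hm => ?_
  refine ((isLocal_magnusCoeff hL hg hT ha hloc m).smul (((m : ℂ) + 1) * z ^ m)).mono ?_ ?_
  · exact Nat.mul_le_mul_right k (Finset.mem_range.1 hm)
  · have h1 : ‖(m : ℂ) + 1‖ = (m : ℝ) + 1 := by norm_cast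
    rw [norm_mul, norm_pow, h1]
    have := magnusBound_nonneg (k := k) hg m
    calc ((m : ℝ) + 1) * ‖z‖ ^ m * (magnusBound k g m * T ^ (m + 1))
        ≤ ((m : ℝ) + 1) * ρ ^ m * (magnusBound k g m * T ^ (m + 1)) := by gcongr
      _ = _ := by rw [mul_pow]; ring

/-- The logarithmic derivatives of the truncated Magnus expansion and of the evolution agree to
order `n + 1`, locally. -/
theorem norm_lie_magnusLogDeriv_sub_le (hL : LocalAlgebras L) (hg : 0 ≤ g) (hT : 0 ≤ T)
    (ha : IntervalIntegrable a volume 0 T) (hloc : ∀ t ∈ Set.Icc 0 T, IsLocal L k g (a t))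
    (hB : CommBound L C B) (hC : 0 ≤ C) (hρ : 1 < ρ) (h1 : 4 * k * g * (ρ * T) ≤ 1)
    (h2 : 4 * ((n + 1) * k : ℕ) * magnusSumBound k g n (ρ * T) ≤ 1) {z : ℂ} (hz : ‖z‖ ≤ 1) :
    ‖⁅magnusLogDeriv a T n z - evolutionLogDeriv a T z, B⁆‖ ≤
      (2 * C * T * (magnusSumDerivBound k g n (ρ * T) + g)) * (1 / ρ) ^ (n + 1) := by
  have hρ0 : 0 < ρ := by linarith
  have hρT : 0 ≤ ρ * T := by positivity
  set M := 2 * C * T * (magnusSumDerivBound k g n (ρ * T) + g) with hM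
  have hM0 : 0 ≤ M := by
    have := magnusSumDerivBound_nonneg (k := k) (n := n) hg hρT
    positivity
  set D : ℂ → A := fun z => magnusLogDeriv a T n z - evolutionLogDeriv a T z with hD
  set f : ℂ → A := fun z => ⁅D z, B⁆ with hf
  have hDd : Differentiable ℂ D :=
    differentiable_magnusLogDeriv.sub (differentiable_evolutionLogDeriv hT ha)
  have hfd : Differentiable ℂ f := by
    have : f = fun z => D z * B - B * D z := rfl
    rw [this]
    exact (hDd.mul_const B).sub (hDd.const_mul B)
  have hbound : ∀ z : ℂ, ‖z‖ ≤ ρ → ‖f z‖ ≤ M := by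
    intro z hz
    have e : f z = ⁅magnusLogDeriv a T n z, B⁆ - ⁅evolutionLogDeriv a T z, B⁆ := by
      simp only [hf, hD, Ring.lie_def]
      noncomm_ring
    have b1 := norm_lie_tsum_dexpTerm_le hL (isLocal_magnusSum (n := n) hL hg hT ha hloc hz)
      (isLocal_magnusSumDeriv (n := n) hL hg hT ha hloc hz) (magnusSumBound_nonneg hg hρT)
      (mul_nonneg hT (magnusSumDerivBound_nonneg hg hρT)) hB hC h2
    have b2 := norm_lie_evolutionLogDeriv_le hL hg hT ha hloc hB hC (z := z) (by
      refine le_trans ?_ h1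
      gcongr)
    rw [e]
    refine (norm_sub_le _ _).trans ((add_le_add b1 b2).trans_eq ?_)
    rw [hM]; ring
  have hO : f =O[nhds 0] fun z : ℂ => z ^ (n + 1) := by
    have hDO := magnusLogDeriv_sub_isBigO (n := n) hT ha
    refine Asymptotics.IsBigO.trans (Asymptotics.IsBigO.of_bound (2 * ‖B‖) ?_) hDO
    refine Filter.Eventually.of_forall fun z => (norm_lie_le _ _).trans_eq ?_
    ring
  have hf0 : f 0 = 0 := by
    obtain ⟨c, hc⟩ := hO.bound
    have := hc.self_of_nhds
    simpa using this
  have hz' : z ∈ Metric.ball (0 : ℂ) ρ := by rw [mem_ball_zero_iff]; linarith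
  -- The volume-dependent O(z^{n+1}) is used only for the order of vanishing. The Schwarz lemma
  -- takes its quantitative input from the volume-independent bound on the disc of radius ρ.
  have := Complex.dist_le_mul_div_pow_of_mapsTo_ball_of_isLittleO (f := f) (c := 0) (z := z)
    (R₁ := ρ) (R₂ := M) (n := n) hfd.differentiableOn
    (fun w hw => by
      rw [hf0, mem_closedBall_zero_iff]
      exact hbound w (mem_ball_zero_iff.1 hw).le)
    (by
      simp only [hf0, sub_zero]
      refine (hO.trans_isLittleO (Asymptotics.isLittleO_pow_pow (Nat.lt_succ_self n))).trans_le ?_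
      intro w
      simp) hz'
  rw [hf0, dist_zero_right, dist_zero_right] at this
  refine this.trans ?_
  gcongr

end locality

/-! ### Comparison of the evolved observables -/

section comparison

variable {Λ : Type*} [Fintype Λ] [DecidableEq Λ] {A : Type*} [NormedRing A] [StarRing A]
  [CStarRing A] [NormedAlgebra ℂ A] [StarModule ℂ A] [FiniteDimensional ℂ A] [CompleteSpace A]
  {L : Finset Λ → Submodule ℂ A} {k n : ℕ} {g ρ C T : ℝ} {O : A} {a : ℝ → A}

/-- Interpolate with W(t) = exp(-Ω(t)) U(t) between W(0) = 1 and W(1), after conjugating O to O₁ =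
exp(-Ω(1)) O exp(Ω(1)). The derivative of W* O₁ W is U* [D, exp(Ω) O₁ exp(-Ω)] U. Two conjugations
double the commutator constant twice, and the estimate for D contributes another factor 2, giving
8C. -/
theorem norm_conj_evolution_sub_conj_exp_le [Nonempty Λ] [NormOneClass A]
    (hL : LocalAlgebras L) (hg : 0 ≤ g)
    (hT : 0 ≤ T) (ha : IntervalIntegrable a volume 0 T) (hstar : ∀ t, star (a t) = -a t)
    (hloc : ∀ t ∈ Set.Icc 0 T, IsLocal L k g (a t)) (hO : CommBound L C O) (hC : 0 ≤ C)
    (hρ : 1 < ρ) (h1 : 4 * k * g * (ρ * T) ≤ 1)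
    (h2 : 4 * ((n + 1) * k : ℕ) * magnusSumBound k g n (ρ * T) ≤ 1) :
    ‖star (evolution a T 1) * O * evolution a T 1 -
        star (NormedSpace.exp (magnusSum a T n 1)) * O * NormedSpace.exp (magnusSum a T n 1)‖ ≤
      (8 * C * T * (magnusSumDerivBound k g n (ρ * T) + g)) * (1 / ρ) ^ (n + 1) := by
  set Ω := magnusSum a T n with hΩ
  set U := evolution a T with hU
  set D : ℂ → A := fun z => magnusLogDeriv a T n z - evolutionLogDeriv a T z with hD
  set O₁ := NormedSpace.exp (-Ω 1) * O * NormedSpace.exp (Ω 1) with hO₁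
  have hρT : 0 ≤ ρ * T := mul_nonneg (by linarith) hT
  have hΩstar : ∀ t : ℝ, star (Ω t) = -Ω t := star_magnusSum hT ha hstar
  have hΩ1 : star (Ω 1) = -Ω 1 := by simpa using hΩstar 1
  have hVstar : ∀ t : ℝ, star (NormedSpace.exp (-Ω t)) = NormedSpace.exp (Ω t) := fun t => by
    rw [NormedSpace.star_exp, star_neg, hΩstar, neg_neg]
  have hΩloc : ∀ z : ℂ, ‖z‖ ≤ 1 → IsLocal L ((n + 1) * k) (magnusSumBound k g n (ρ * T)) (Ω z) :=
    fun z hz => isLocal_magnusSum hL hg hT ha hloc (hz.trans hρ.le)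
  have hω := magnusSumBound_nonneg (k := k) (n := n) hg hρT
  have hB1 : CommBound L (2 * C) O₁ := by
    have h := hO.conj_exp hL (G := (-1 : ℂ) • Ω 1) (r := magnusSumBound k g n (ρ * T))
      (by simpa using (hΩloc 1 (by simp)).smul (-1)) (by simp [hΩ1]) hω hC h2
    simpa using h
  have hB : ∀ t ∈ Set.Icc (0 : ℝ) 1,
      CommBound L (2 * (2 * C)) (NormedSpace.exp (Ω t) * O₁ * NormedSpace.exp (-Ω t)) :=
    fun t ht => hB1.conj_exp hL (hΩloc t (by
      rw [Complex.norm_of_nonneg ht.1]; exact ht.2)) (hΩstar t) hω (by positivity) h2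
  set W : ℝ → A := fun t => NormedSpace.exp (-Ω t) * U t with hW
  have hWd : ∀ t : ℝ, HasDerivAt W (-(NormedSpace.exp (-Ω t) * D t * U t)) t := by
    intro t
    have d1 := hasDerivAt_comp_ofReal (hasDerivAt_exp_neg_magnusSum (a := a) (T := T) (n := n) t)
    have d2 := hasDerivAt_comp_ofReal (hasDerivAt_evolution hT ha (t : ℂ))
    refine (d1.mul d2).congr_deriv ?_
    simp only [hD, ← hΩ, ← hU]
    noncomm_ring
  have hDstar : ∀ t : ℝ, star (D t) = -D t := fun t => by
    simp only [hD]
    rw [star_sub, star_magnusLogDeriv hT ha hstar, star_evolutionLogDeriv hstar]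
    abel
  have hF : ∀ t : ℝ, HasDerivAt (fun t => star (W t) * O₁ * W t)
      (star (U t) * ⁅D t, NormedSpace.exp (Ω t) * O₁ * NormedSpace.exp (-Ω t)⁆ * U t) t := by
    intro t
    refine (((hWd t).star.mul_const O₁).mul (hWd t)).congr_deriv ?_
    simp only [hW, star_neg, star_mul, hVstar, hDstar, Ring.lie_def]
    noncomm_ring
  have hUle : ∀ t : ℝ, ‖U t‖ ≤ 1 := norm_evolution_le hT ha hstar
  have key := norm_image_sub_le_of_norm_deriv_le_segment_01' (f := fun t => star (W t) * O₁ * W t)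
    (fun t _ => (hF t).hasDerivWithinAt) (C := (8 * C * T * (magnusSumDerivBound k g n (ρ * T) + g)) *
      (1 / ρ) ^ (n + 1)) (fun t ht => by
      have ht' := Set.Ico_subset_Icc_self ht
      have b := norm_lie_magnusLogDeriv_sub_le hL hg hT ha hloc (hB t ht') (by positivity) hρ h1 h2
        (z := t) (by rw [Complex.norm_of_nonneg ht'.1]; exact ht'.2)
      set X := ⁅D t, NormedSpace.exp (Ω t) * O₁ * NormedSpace.exp (-Ω t)⁆ with hX
      have b3 : ‖star (U t) * X * U t‖ ≤ ‖X‖ := by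
        calc ‖star (U t) * X * U t‖ ≤ ‖star (U t)‖ * ‖X‖ * ‖U t‖ :=
              (norm_mul_le _ _).trans (mul_le_mul_of_nonneg_right (norm_mul_le _ _) (norm_nonneg _))
          _ ≤ 1 * ‖X‖ * 1 := by
              rw [norm_star]
              gcongr
              · exact hUle t
              · exact hUle t
          _ = ‖X‖ := by ring
      refine b3.trans (b.trans (le_of_eq ?_))
      ring)
  have e1 : star (W 1) * O₁ * W 1 = star (U 1) * O * U 1 := by
    have hv := hVstar 1
    simp only [hW, hO₁, star_mul]
    rw [hv]
    simp only [Complex.ofReal_one]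
    have e := exp_mul_exp_neg (Ω 1)
    calc _ = star (U 1) * (NormedSpace.exp (Ω 1) * NormedSpace.exp (-Ω 1)) * O *
          (NormedSpace.exp (Ω 1) * NormedSpace.exp (-Ω 1)) * U 1 := by noncomm_ring
      _ = _ := by rw [e]; noncomm_ring
  have e0 : star (W 0) * O₁ * W 0 = star (NormedSpace.exp (Ω 1)) * O * NormedSpace.exp (Ω 1) := by
    have : W 0 = 1 := by
      simp [hW, hΩ, hU, magnusSum_zero, evolution_zero]
    rw [this, NormedSpace.star_exp, hΩ1]
    simp [hO₁]
  rw [e1, e0] at key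
  exact key

end comparison

/-! ### The Floquet evolution of a local observable -/

section constants

/-- Periods below this threshold are treated by comparison of the generators. -/
noncomputable def periodThreshold (n k : ℕ) (g : ℝ) : ℝ :=
  1 / (4 * k * g + 4 * ((n + 1) * k : ℕ) * magnusSumBound k g n 1 + 1)

/-- The constant in the comparison of the Floquet evolutions. -/
noncomputable def comparisonConst (n k : ℕ) (g : ℝ) : ℝ :=
  16 * (magnusSumDerivBound k g n 1 + g) / periodThreshold n k g ^ (n + 1) +
    2 / periodThreshold n k g ^ (n + 2)

variable {n k : ℕ} {g : ℝ}

theorem periodThreshold_pos (hg : 0 ≤ g) : 0 < periodThreshold n k g := by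
  have := magnusSumBound_nonneg (k := k) (n := n) hg zero_le_one
  unfold periodThreshold
  positivity

theorem comparisonConst_pos (hg : 0 ≤ g) : 0 < comparisonConst n k g := by
  have h1 := magnusSumDerivBound_nonneg (k := k) (n := n) hg zero_le_one
  have h2 := periodThreshold_pos (n := n) (k := k) hg
  unfold comparisonConst
  positivity

theorem periodThreshold_le_one (hg : 0 ≤ g) : periodThreshold n k g ≤ 1 := by
  have h := magnusSumBound_nonneg (k := k) (n := n) hg zero_le_one
  have h2 : 0 ≤ 4 * k * g + 4 * ((n + 1) * k : ℕ) * magnusSumBound k g n 1 := by positivity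
  rw [periodThreshold, div_le_one (by linarith)]
  linarith

theorem mul_periodThreshold_le_one (hg : 0 ≤ g) : 4 * k * g * periodThreshold n k g ≤ 1 := by
  have h := magnusSumBound_nonneg (k := k) (n := n) hg zero_le_one
  have h2 : 0 ≤ 4 * ((n + 1) * k : ℕ) * magnusSumBound k g n 1 := by positivity
  have h3 : 0 ≤ 4 * k * g := by positivity
  rw [periodThreshold, mul_one_div, div_le_one (by linarith)]
  linarith

theorem mul_magnusSumBound_periodThreshold_le_one (hg : 0 ≤ g) :
    4 * ((n + 1) * k : ℕ) * magnusSumBound k g n (periodThreshold n k g) ≤ 1 := by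
  have h := magnusSumBound_nonneg (k := k) (n := n) hg zero_le_one
  have h0 := periodThreshold_pos (n := n) (k := k) hg
  have h1 := periodThreshold_le_one (n := n) (k := k) hg
  have h2 : 0 ≤ 4 * ((n + 1) * k : ℕ) * magnusSumBound k g n 1 := by positivity
  have h3 : 0 ≤ 4 * k * g := by positivity
  -- The bound is a polynomial in x without constant term and with nonnegative coefficients, so at x
  -- ≤ 1 it is at most x times its value at 1.
  have hle : magnusSumBound k g n (periodThreshold n k g) ≤
      magnusSumBound k g n 1 * periodThreshold n k g := by
    rw [magnusSumBound, magnusSumBound, Finset.sum_mul]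
    refine Finset.sum_le_sum fun m _ => ?_
    rw [one_pow, mul_one]
    refine mul_le_mul_of_nonneg_left ?_ (magnusBound_nonneg hg m)
    exact pow_le_of_le_one h0.le h1 m.succ_ne_zero
  calc 4 * ((n + 1) * k : ℕ) * magnusSumBound k g n (periodThreshold n k g)
      ≤ 4 * ((n + 1) * k : ℕ) * (magnusSumBound k g n 1 * periodThreshold n k g) := by gcongr
    _ = 4 * ((n + 1) * k : ℕ) * magnusSumBound k g n 1 /
        (4 * k * g + 4 * ((n + 1) * k : ℕ) * magnusSumBound k g n 1 + 1) := by
        rw [periodThreshold]; ring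
    _ ≤ 1 := by rw [div_le_one (by linarith)]; linarith

theorem magnusSumDerivBound_periodThreshold_le (hg : 0 ≤ g) :
    magnusSumDerivBound k g n (periodThreshold n k g) ≤ magnusSumDerivBound k g n 1 := by
  refine Finset.sum_le_sum fun m _ => ?_
  have := magnusBound_nonneg (k := k) hg m
  have h0 := periodThreshold_pos (n := n) (k := k) hg
  have h1 := periodThreshold_le_one (n := n) (k := k) hg
  gcongr

end constants

/-! ### Short and long periods. -/

section floquet

variable {Λ : Type*} [Fintype Λ] [DecidableEq Λ] {A : Type*} [NormedRing A] [StarRing A]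
  [CStarRing A] [NormedAlgebra ℂ A] [StarModule ℂ A] [FiniteDimensional ℂ A] [CompleteSpace A]
  {L : Finset Λ → Submodule ℂ A} {k n : ℕ} {g T : ℝ} {O : A} {a H : ℝ → A} {X : Finset Λ}

theorem dysonTerm_eq_iteratedProd (H : ℝ → A) (m : ℕ) (t : ℝ) :
    dysonTerm H m t = iteratedProd (fun t => (-I) • H t) m t := by
  induction m generalizing t with
  | zero => rfl
  | succ m ih => simp only [dysonTerm, iteratedProd, ih, smul_mul_assoc]

theorem timeOrderedExp_eq_evolution (H : ℝ → A) (T : ℝ) :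
    timeOrderedExp H T = evolution (fun t => (-I) • H t) T 1 := by
  simp only [timeOrderedExp, evolution, dysonTerm_eq_iteratedProd, one_pow, one_smul]

theorem smul_truncatedFloquet_eq_magnusSum (hT : 0 < T) (hH : IntervalIntegrable H volume 0 T)
    (n : ℕ) : (-(I * T)) • truncatedFloquet H T n = magnusSum (fun t => (-I) • H t) T n 1 := by
  simp only [truncatedFloquet, magnusSum, one_pow, one_smul, Finset.smul_sum,
    magnusCoeff_neg_I_smul hT hH]

theorem norm_conj_sub_le [NormOneClass A] (hL : LocalAlgebras L) (hg : 0 ≤ g) (hT : 0 < T)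
    (ha : IntervalIntegrable a volume 0 T) (hstar : ∀ t, star (a t) = -a t)
    (hloc : ∀ t ∈ Set.Icc 0 T, IsLocal L k g (a t)) (hOX : O ∈ L X) (hO : ‖O‖ = 1)
    (hempty : X = ∅ → ∃ c : ℂ, O = c • (1 : A)) :
    ‖star (evolution a T 1) * O * evolution a T 1 -
        star (NormedSpace.exp (magnusSum a T n 1)) * O * NormedSpace.exp (magnusSum a T n 1)‖ ≤
      comparisonConst n k g * X.card * T ^ (n + 2) := by
  have hU := star_evolution_mul_self hT.le ha hstar 1
  have hΩ := star_magnusSum (n := n) hT.le ha hstar 1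
  rw [Complex.ofReal_one] at hU hΩ
  have hV := Unitary.star_mul_self_of_mem (exp_mem_unitary hΩ)
  rcases X.eq_empty_or_nonempty with hX | hX
  · obtain ⟨c, rfl⟩ := hempty hX
    simp [hX, hU, hV]
  have hX1 : (1 : ℝ) ≤ X.card := by exact_mod_cast hX.card_pos
  obtain ⟨i, -⟩ := hX
  have : Nonempty Λ := ⟨i⟩
  have hτ := periodThreshold_pos (n := n) (k := k) hg
  have hE := magnusSumDerivBound_nonneg (k := k) (n := n) hg zero_le_one
  set τ := periodThreshold n k g with hτdef
  rcases lt_or_ge T τ with hlt | hge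
  -- The largest admissible radius is ρ = τ/T, which exceeds 1 exactly because T < τ. Then
  -- ρ^{-(n+1)} = (T/τ)^{n+1}, and ρT = τ removes T from the remaining constants.
  · have hρT : τ / T * T = τ := div_mul_cancel₀ τ hT.ne'
    have h := norm_conj_evolution_sub_conj_exp_le (n := n) (ρ := τ / T) hL hg hT.le ha hstar hloc
      (commBound_of_mem hL hOX) (by positivity) ((one_lt_div hT).2 hlt)
      (by rw [hρT]; exact mul_periodThreshold_le_one hg)
      (by rw [hρT]; exact mul_magnusSumBound_periodThreshold_le_one hg)
    refine h.trans ?_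
    rw [hρT, hO, one_div_div]
    have hD := magnusSumDerivBound_periodThreshold_le (n := n) (k := k) hg
    rw [← hτdef] at hD
    calc 8 * (2 * X.card * 1) * T * (magnusSumDerivBound k g n τ + g) * (T / τ) ^ (n + 1)
        ≤ 8 * (2 * X.card * 1) * T * (magnusSumDerivBound k g n 1 + g) * (T / τ) ^ (n + 1) := by
          gcongr
      _ = 16 * (magnusSumDerivBound k g n 1 + g) / τ ^ (n + 1) * X.card * T ^ (n + 2) := by
          rw [div_pow, pow_succ T (n + 1)]; ring
      _ ≤ comparisonConst n k g * X.card * T ^ (n + 2) := by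
          gcongr
          rw [comparisonConst]
          exact le_add_of_nonneg_right (by positivity)
  -- For T ≥ τ each conjugated observable has norm at most 1, and 2 ≤ 2|X|(T/τ)^{n+2} since X is
  -- nonempty.
  · have hconj : ∀ Q : A, star Q * Q = 1 → ‖star Q * O * Q‖ ≤ 1 := by
      intro Q hQ
      have h := CStarRing.norm_star_mul_self (x := Q)
      rw [hQ, norm_one] at h
      have hQ1 : ‖Q‖ ≤ 1 := by nlinarith [norm_nonneg Q]
      calc ‖star Q * O * Q‖ ≤ ‖star Q‖ * ‖O‖ * ‖Q‖ :=
            (norm_mul_le _ _).trans (mul_le_mul_of_nonneg_right (norm_mul_le _ _) (norm_nonneg _))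
        _ ≤ 1 * 1 * 1 := by rw [norm_star, hO]; gcongr
        _ = 1 := by norm_num
    refine (norm_sub_le _ _).trans ((add_le_add (hconj _ hU) (hconj _ hV)).trans ?_)
    calc (1 : ℝ) + 1 = 2 * 1 * 1 := by norm_num
      _ ≤ 2 * X.card * (T / τ) ^ (n + 2) := by
          gcongr
          exact one_le_pow₀ ((one_le_div hτ).2 hge)
      _ = 2 / τ ^ (n + 2) * X.card * T ^ (n + 2) := by rw [div_pow]; ring
      _ ≤ comparisonConst n k g * X.card * T ^ (n + 2) := by
          gcongr
          rw [comparisonConst]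
          exact le_add_of_nonneg_left (by positivity)

theorem norm_conj_timeOrderedExp_sub_le [NormOneClass A] (hL : LocalAlgebras L) (hg : 0 ≤ g)
    (hT : 0 < T) {h : Finset Λ → ℝ → A}
    (hH : ∀ t, H t = ∑ Y : Finset Λ with Y.card ≤ k, h Y t)
    (hmem : ∀ Y : Finset Λ, Y.card ≤ k → ∀ t, h Y t ∈ L Y) (hsa : ∀ t, IsSelfAdjoint (H t))
    (hInt : ∀ Y : Finset Λ, Y.card ≤ k → IntervalIntegrable (h Y) volume 0 T)
    (hext : ∀ t ∈ Set.Icc 0 T, ∀ i, ∑ Y : Finset Λ with Y.card ≤ k ∧ i ∈ Y, ‖h Y t‖ ≤ g)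
    (hOX : O ∈ L X) (hO : ‖O‖ = 1) (hempty : X = ∅ → ∃ c : ℂ, O = c • (1 : A)) (n : ℕ) :
    ‖star (timeOrderedExp H T) * O * timeOrderedExp H T -
        star (NormedSpace.exp ((-(I * T)) • truncatedFloquet H T n)) * O *
          NormedSpace.exp ((-(I * T)) • truncatedFloquet H T n)‖ ≤
      comparisonConst n k g * X.card * T ^ (n + 2) := by
  have hHint : IntervalIntegrable H volume 0 T := by
    rw [show H = fun t => ∑ Y : Finset Λ with Y.card ≤ k, h Y t from funext hH]
    exact ⟨integrable_finsetSum _ fun Y hY => (hInt Y (Finset.mem_filter.1 hY).2).1,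
      integrable_finsetSum _ fun Y hY => (hInt Y (Finset.mem_filter.1 hY).2).2⟩
  rw [timeOrderedExp_eq_evolution, smul_truncatedFloquet_eq_magnusSum hT hHint]
  refine norm_conj_sub_le hL hg hT (hHint.smul (-I)) (fun t => ?_) (fun t ht => ?_) hOX hO hempty
  · rw [star_smul, (hsa t).star_eq]
    simp
  · have hfam : LocalFamily L k g fun Y => if Y.card ≤ k then h Y t else 0 := by
      refine ⟨fun Y => ?_, fun Y hY => if_neg (not_le.2 hY), fun i => ?_⟩
      · split_ifs with hY
        exacts [hmem Y hY t, (L Y).zero_mem]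
      · refine le_trans (le_of_eq ?_) (hext t ht i)
        simp only [apply_ite norm, norm_zero]
        rw [← Finset.sum_filter, Finset.filter_filter]
        simp only [and_comm]
    have hloc : IsLocal L k g (H t) := ⟨_, hfam, by rw [hH, Finset.sum_filter]⟩
    simpa using hloc.smul (-I)

end floquet

/-! ### From the abstract local algebras to the lattice system. -/

section system

variable {Λ : Type*} {s : Λ → Type*} [Fintype Λ] [DecidableEq Λ]
  [∀ i, Fintype (s i)] [∀ i, DecidableEq (s i)]

theorem localAlgebras_localSubmodule : LocalAlgebras (localSubmodule s) where
  lie_mem hA hB := ActsOn.lie hA hB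
  lie_eq_zero hA hB h := ActsOn.lie_eq_zero hA hB h
  star_mem hA := ActsOn.star hA

/-- Passage to the Heisenberg picture, which makes the bound uniform in the state. -/
theorem norm_inner_sub_inner_le {E : Type*} [NormedAddCommGroup E] [InnerProductSpace ℂ E]
    [CompleteSpace E] (O P Q : E →L[ℂ] E) {ψ : E} (hψ : ‖ψ‖ = 1) :
    ‖⟪P ψ, O (P ψ)⟫_ℂ - ⟪Q ψ, O (Q ψ)⟫_ℂ‖ ≤ ‖star P * O * P - star Q * O * Q‖ := by
  have h : ∀ R : E →L[ℂ] E, ⟪R ψ, O (R ψ)⟫_ℂ = ⟪ψ, (star R * O * R) ψ⟫_ℂ := fun R => by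
    rw [ContinuousLinearMap.star_eq_adjoint]
    exact (ContinuousLinearMap.adjoint_inner_right R ψ (O (R ψ))).symm
  rw [h P, h Q, ← inner_sub_right]
  refine (norm_inner_le_norm _ _).trans ?_
  rw [hψ, one_mul]
  have := (star P * O * P - star Q * O * Q).le_opNorm ψ
  rwa [hψ, mul_one] at this

end system

end FloquetSpin

theorem mainTheorem4 (n k : ℕ) (hk : 1 ≤ k) (g : ℝ) (hg : 0 < g) :
    ∃ α : ℝ, 0 < α ∧
      ∀ (Λ : Type*) [Fintype Λ] [DecidableEq Λ] (s : Λ → Type*)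
        [∀ i, Fintype (s i)] [∀ i, DecidableEq (s i)]
        (T : ℝ) (h : Finset Λ → ℝ → FloquetSpin.Op s),
        0 < T →
        FloquetSpin.IsDrivenKLocal k g T h →
        (n : ℤ) ≤ FloquetSpin.nZeroPrime k g T →
        ∀ (X : Finset Λ) (O : FloquetSpin.Op s), FloquetSpin.ActsOn X O → ‖O‖ = 1 →
        ∀ ψ₀ ψT ψnT : FloquetSpin.TotalSpace s, ‖ψ₀‖ = 1 →
          ψT = FloquetSpin.timeOrderedExp (FloquetSpin.hamiltonian k h) T ψ₀ →
          ψnT = NormedSpace.exp ((-(I * T)) •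
            FloquetSpin.truncatedFloquet (FloquetSpin.hamiltonian k h) T n) ψ₀ →
          ‖⟪ψT, O ψT⟫_ℂ - ⟪ψnT, O ψnT⟫_ℂ‖ ≤ α * X.card * T ^ (n + 2) := by
  refine ⟨FloquetSpin.comparisonConst n k g, FloquetSpin.comparisonConst_pos hg.le, ?_⟩
  intro Λ _ _ s _ _ T h hT hH _ X O hOX hO ψ₀ ψT ψnT hψ hψT hψnT
  rw [hψT, hψnT]
  -- A unit vector exists, so the space is nontrivial and the identity operator has norm 1.
  have : Nontrivial (FloquetSpin.TotalSpace s) :=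
    ⟨ψ₀, 0, fun h0 => by rw [h0, norm_zero] at hψ; exact zero_ne_one hψ⟩
  refine (FloquetSpin.norm_inner_sub_inner_le O _ _ hψ).trans ?_
  exact FloquetSpin.norm_conj_timeOrderedExp_sub_le FloquetSpin.localAlgebras_localSubmodule hg.le
    hT (fun t => rfl) hH.actsOn hH.selfAdjoint hH.integrable hH.extensive hOX hO
    (fun hX => FloquetSpin.actsOn_empty_iff.1 (hX ▸ hOX)) n
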